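/- Let $m\in\{1,2\}$ (cylindrical or spherical symmetry), $\gamma>1$, $z>0$ and $\lambda=1+m\gamma z$. Put $D(V,C)=(1+V)^2-C^2$, $$G(V,C)=C^2[(m+1)V+2mz]-V(1+V)(\lambda+V),\qquad F(V,C)=C\Big\{C^2\Big[1+\tfrac{mz}{1+V}\Big]-a_1(1+V)^2+a_2(1+V)-a_3\Big\},$$ with $a_1=1+\frac{m(\gamma-1)}2$, $a_2=\frac{m(\gamma-1)+mz\gamma(\gamma-3)}2$, $a_3=\frac{mz\gamma(\gamma-1)}2$. Let $P_1=(V_1,C_1)=\big(-\frac2{\gamma+1},\frac{\sqrt{2\gamma(\gamma-1)}}{\gamma+1}\big)$, and for $0<z\le z_M(\gamma)=(\sqrt\gamma+\sqrt2)^{-2}$ let $w=\sqrt{1-2(\gamma+2)z+(\gamma-2)^2z^2}$, $V_6=\frac{-1+(\gamma-2)z-w}2$, $V_8=\frac{-1+(\gamma-2)z+w}2$, $P_6=(V_6,1+V_6)$, $P_8=(V_8,1+V_8)$; these are triple points, $F=G=D=0$, and they coincide for $z=z_M$. A *connection* for $(\gamma,z)$ is a positive, strictly decreasing, real-analytic function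 $C$ on $[V_1,0)$ with $C(V_1)=C_1$ and $C(V)\to0$ as $V\to0^-$, which satisfies $G\ne0$ and $\frac{dC}{dV}=\frac FG$ wherever $D(V,C(V))\neq0$, and for which $F=G=0$ wherever $D(V,C(V))=0$ (so it crosses the sonic line $D=0$ only at a triple point). Let $z_1(\gamma)=\frac{\sqrt5-1}{2(1+\sqrt5+\gamma)}$ and $z_2(\gamma)=\frac{\sqrt{33}-3}{6+2\sqrt{33}+4\gamma}$ (the values of $z$ for which $P_8$ lies on $C=\sqrt{-V}$ and on $C=\sqrt{-\frac32V}$ respectively), and for $\gamma\in(1,2]$ let $z_g(\gamma)$ be the value of $z$ for which $V_6=\frac{-2\lambda}{\gamma+1+m(\gamma-1)}$, i.e. $z_g=\frac{\sqrt{\gamma^2+(\gamma-1)^2}-\gamma}{\gamma(\gamma-1)}$ if $m=1$ and $z_g=\frac{\sqrt{(2\gamma^2-\gamma+1)^2+2\gamma(\gamma-1)[4\gamma(\gamma-1)+\frac83]}-(2\gamma^2-\gamma+1)}{\gamma[4\gamma(\gamma-1)+\frac83]}$ if $m=2$. There is exactly one $\gamma_\star>1$ with $C_1(\gamma_\star)=\sqrt{-k\,V_1(\gamma_\star)}$,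 where $k=-\frac{(1+V_6)^2}{V_6}$ is evaluated at $(\gamma_\star,z_M(\gamma_\star))$; it satisfies $\frac53<\gamma_\star<2$, and the following hold. (i) For every $\gamma\in(1,3]$ there is a connection for some $z>0$. Every connection for $(\gamma,z)$ has $z\le z_M(\gamma)$, passes through $P_6$ or $P_8$, and gives a self-similar converging shock for the non-isentropic Euler equations $$\rho_t+(\rho u)_r+\tfrac{m\rho u}r=0,\quad u_t+uu_r+\tfrac1{\gamma\rho}(\rho c^2)_r=0,\quad c_t+uc_r+\tfrac{\gamma-1}2c\big(u_r+\tfrac{mu}r\big)=0.$$ That is, there are profiles $V(x),C(x),R(x)$ of $x=t/r^\lambda$ such that: $V=C=0$, $R=1$ for $x<-1$; the profiles are analytic on $(-1,0)$ and continuous on $[-1,0)$, with $C,R>0$, $V(-1)=V_1$, $V(x)\in[V_1,0)$, and $(V(x),C(x))$ on the graph of the connection for $x\in[-1,0)$; $V,C\to0$ and $V/x$, $C/x$, $R$ have finite limits as $x\to0^-$; the fields $u=-\frac r{\lambda t}V(x)$, $c=-\frac r{\lambda t}C(x)$, $\rho=R(x)$ solve the Euler equations for $t<0$, $r>0$ away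 from the shock $r=(-t)^{1/\lambda}$; and across the shock the Rankine–Hugoniot conditions for mass, momentum and energy (pressure $p=\rho c^2/\gamma$, specific internal energy $e=p/((\gamma-1)\rho)$) and the Lax condition hold. (ii) For $\gamma\in(1,\gamma_\star]$ there is exactly one $z>0$ for which a connection exists; every connection passes through $P_6$, and $z\in(z_g,z_M]$. (iii) For $\gamma\in(\gamma_\star,2)$: if a connection passes through $P_6$, then $z\in(z_g,z_M]$, and this $z$ is the only value for which a connection through $P_6$ exists; if a connection passes through $P_8$, then $z\in(z_1,z_M]$. (iv) For $\gamma\in[2,3]$ every connection passes through $P_8$, with $z\in(z_1,z_M]$ if $\gamma\le1+\sqrt2$ and $z\in(z_2,z_M]$ if $\gamma>1+\sqrt2$. -/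

import Mathlib

open Set Filter Topology

namespace ShockODE

noncomputable section

/-! ### The phase-plane equation `dC/dV = F / G`

`m = 1` is cylindrical and `m = 2` spherical symmetry, `γ` is the adiabatic index, and the
parameter `z` encodes the similarity exponent through `λ = 1 + m γ z`. -/

/-- The similarity exponent `λ = 1 + m γ z`. -/
def lam (m : ℕ) (γ z : ℝ) : ℝ := 1 + m * γ * z

def a₁ (m : ℕ) (γ : ℝ) : ℝ := 1 + m * (γ - 1) / 2

def a₂ (m : ℕ) (γ z : ℝ) : ℝ := (m * (γ - 1) + m * z * γ * (γ - 3)) / 2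

def a₃ (m : ℕ) (γ z : ℝ) : ℝ := m * z * γ * (γ - 1) / 2

/-- The sonic function; `D = 0` is the sonic line. -/
def D (V C : ℝ) : ℝ := (1 + V) ^ 2 - C ^ 2

def G (m : ℕ) (γ z V C : ℝ) : ℝ :=
  C ^ 2 * ((m + 1) * V + 2 * m * z) - V * (1 + V) * (lam m γ z + V)

def F (m : ℕ) (γ z V C : ℝ) : ℝ :=
  C * (C ^ 2 * (1 + m * z / (1 + V)) - a₁ m γ * (1 + V) ^ 2 + a₂ m γ z * (1 + V) - a₃ m γ z)

/-- The post-shock point is `P₁ = (V₁, C₁)`. -/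
def V₁ (γ : ℝ) : ℝ := -2 / (γ + 1)

def C₁ (γ : ℝ) : ℝ := √(2 * γ * (γ - 1)) / (γ + 1)

/-! ### Triple points and distinguished parameter values -/

def w (γ z : ℝ) : ℝ := √(1 - 2 * (γ + 2) * z + (γ - 2) ^ 2 * z ^ 2)

def V₆ (γ z : ℝ) : ℝ := (-1 + (γ - 2) * z - w γ z) / 2

def V₈ (γ z : ℝ) : ℝ := (-1 + (γ - 2) * z + w γ z) / 2

def P₆ (γ z : ℝ) : ℝ × ℝ := (V₆ γ z, 1 + V₆ γ z)

def P₈ (γ z : ℝ) : ℝ × ℝ := (V₈ γ z, 1 + V₈ γ z)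

/-- The value of `z` at which `P₆ = P₈`, i.e. `w γ z = 0`. -/
def zM (γ : ℝ) : ℝ := 1 / (√γ + √2) ^ 2

/-- The value of `z` at which `V₆` equals `V₄ = -2λ / (γ + 1 + m (γ - 1))`, i.e. at which `P₆`
meets the critical point `P₄` of `F = G = 0` (for `1 < γ ≤ 2` and `m = 1, 2`). -/
def zg (m : ℕ) (γ : ℝ) : ℝ :=
  if m = 1 then (√(γ ^ 2 + (γ - 1) ^ 2) - γ) / (γ * (γ - 1))
  else
    (√((2 * γ ^ 2 - γ + 1) ^ 2 + 2 * γ * (γ - 1) * (4 * γ * (γ - 1) + 8 / 3))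
        - (2 * γ ^ 2 - γ + 1)) / (γ * (4 * γ * (γ - 1) + 8 / 3))

/-- The value of `z` at which `P₈` lies on the curve `C = √(-V)`. -/
def z₁ (γ : ℝ) : ℝ := (√5 - 1) / (2 * (1 + √5 + γ))

/-- The value of `z` at which `P₈` lies on the curve `C = √(-3V/2)`. -/
def z₂ (γ : ℝ) : ℝ := (√33 - 3) / (6 + 2 * √33 + 4 * γ)

/-- `k = -(1 + V₆)² / V₆`, so that `P₆` lies on the curve `C = √(-k V)`. -/
def k (γ z : ℝ) : ℝ := -(1 + V₆ γ z) ^ 2 / V₆ γ z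

/-- The equation that defines `γ⋆`: the post-shock point lies on `C = √(-k(γ, z_M) V)`. -/
def IsGammaStar (γ : ℝ) : Prop :=
  1 < γ ∧ C₁ γ = √(-k γ (zM γ) * V₁ γ)

/-! ### Connecting solutions -/

/-- `C` is a monotone decreasing analytic solution of `dC/dV = F / G` with parameter `z > 0`
(that is, `λ > 1`) which connects `P₁` to the origin within the second quadrant and meets the
sonic line `D = 0` only at triple points `F = G = D = 0`, where the quotient `F / G` is `0 / 0`.
As `D < 0` at `P₁` and `D > 0` at the origin, such a curve does meet the sonic line. -/
structure IsConnection (m : ℕ) (γ z : ℝ) (C : ℝ → ℝ) : Prop where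
  z_pos : 0 < z
  analytic : AnalyticOnNhd ℝ C (Ico (V₁ γ) 0)
  pos : ∀ V ∈ Ico (V₁ γ) 0, 0 < C V
  decreasing : StrictAntiOn C (Ico (V₁ γ) 0)
  ode : ∀ V ∈ Ico (V₁ γ) 0, D V (C V) ≠ 0 →
    G m γ z V (C V) ≠ 0 ∧ HasDerivAt C (F m γ z V (C V) / G m γ z V (C V)) V
  sonic : ∀ V ∈ Ico (V₁ γ) 0, D V (C V) = 0 → F m γ z V (C V) = 0 ∧ G m γ z V (C V) = 0
  start : C (V₁ γ) = C₁ γ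
  origin : Tendsto C (𝓝[<] 0) (𝓝 0)

/-- The curve `C`, defined on `[V₁, 0)`, passes through the point `P`. -/
def PassesThrough (γ : ℝ) (C : ℝ → ℝ) (P : ℝ × ℝ) : Prop :=
  P.1 ∈ Ico (V₁ γ) 0 ∧ C P.1 = P.2

/-! ### Converging shocks for the radial Euler equations -/

/-- The radially symmetric non-isentropic Euler equations for the density `ρ`, the radial
velocity `u` and the sound speed `c` hold at time `t` and radius `r`. -/
structure EulerAt (m : ℕ) (γ : ℝ) (ρ u c : ℝ → ℝ → ℝ) (t r : ℝ) : Prop where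
  diff_ρ : DifferentiableAt ℝ (fun p : ℝ × ℝ => ρ p.1 p.2) (t, r)
  diff_u : DifferentiableAt ℝ (fun p : ℝ × ℝ => u p.1 p.2) (t, r)
  diff_c : DifferentiableAt ℝ (fun p : ℝ × ℝ => c p.1 p.2) (t, r)
  mass : deriv (fun s => ρ s r) t + deriv (fun y => ρ t y * u t y) r
    + m * ρ t r * u t r / r = 0
  momentum : deriv (fun s => u s r) t + u t r * deriv (fun y => u t y) r
    + 1 / (γ * ρ t r) * deriv (fun y => ρ t y * c t y ^ 2) r = 0
  sound : deriv (fun s => c s r) t + u t r * deriv (fun y => c t y) r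
    + (γ - 1) / 2 * c t r * (deriv (fun y => u t y) r + m * u t r / r) = 0

/-- Pressure from density and sound speed, `c² = γ p / ρ`. -/
def pressure (γ ρ c : ℝ) : ℝ := ρ * c ^ 2 / γ

/-- Total energy per unit volume, `ρ (e + u² / 2)` with `p = (γ - 1) ρ e`. -/
def energy (γ ρ u c : ℝ) : ℝ := pressure γ ρ c / (γ - 1) + ρ * u ^ 2 / 2

/-- Rankine-Hugoniot conditions (mass, momentum, energy) for a shock of speed `σ` between the
state `(ρ₀, u₀, c₀)` ahead of it and `(ρ₁, u₁, c₁)` behind it, and the Lax condition: the shock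
is supersonic relative to the state ahead and subsonic relative to the state behind. -/
structure ShockConditions (γ σ ρ₀ u₀ c₀ ρ₁ u₁ c₁ : ℝ) : Prop where
  mass : ρ₁ * (u₁ - σ) = ρ₀ * (u₀ - σ)
  momentum : ρ₁ * u₁ * (u₁ - σ) + pressure γ ρ₁ c₁ = ρ₀ * u₀ * (u₀ - σ) + pressure γ ρ₀ c₀
  energy : energy γ ρ₁ u₁ c₁ * (u₁ - σ) + pressure γ ρ₁ c₁ * u₁
    = energy γ ρ₀ u₀ c₀ * (u₀ - σ) + pressure γ ρ₀ c₀ * u₀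
  lax_ahead : c₀ < |u₀ - σ|
  lax_behind : |u₁ - σ| < c₁

/-- The field `-(r / (l t)) Q(t / r ^ l)`, the self-similar form of `u` and `c`. -/
def scaledField (l : ℝ) (Q : ℝ → ℝ) (t r : ℝ) : ℝ := -(r / (l * t)) * Q (t / r ^ l)

/-- The field `R(t / r ^ l)`, the self-similar form of the density. -/
def densityField (l : ℝ) (R : ℝ → ℝ) (t r : ℝ) : ℝ := R (t / r ^ l)

/-- The radius `(-t) ^ (1 / l)` of the shock, i.e. `t / r ^ l = -1`. -/
def shockRadius (l t : ℝ) : ℝ := (-t) ^ (1 / l)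

/-- The profiles `V`, `C`, `R` of the similarity variable `x = t / r ^ l`, `t < 0`, describe a
self-similar shock that converges to the origin at time `t = 0` into a gas at rest of density `1`
and zero pressure.  The value of a profile at `x = -1` is its value immediately behind the
shock. -/
structure IsConvergingShock (m : ℕ) (γ l : ℝ) (V C R : ℝ → ℝ) : Prop where
  one_lt : 1 < l
  ahead : ∀ x < -1, V x = 0 ∧ C x = 0 ∧ R x = 1
  continuous_behind : ContinuousOn V (Ico (-1) 0) ∧ ContinuousOn C (Ico (-1) 0) ∧
    ContinuousOn R (Ico (-1) 0)
  analytic_behind : AnalyticOnNhd ℝ V (Ioo (-1) 0) ∧ AnalyticOnNhd ℝ C (Ioo (-1) 0) ∧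
    AnalyticOnNhd ℝ R (Ioo (-1) 0)
  pos_behind : ∀ x ∈ Ico (-1 : ℝ) 0, 0 < C x ∧ 0 < R x
  euler : ∀ t r : ℝ, t < 0 → 0 < r → r ≠ shockRadius l t →
    EulerAt m γ (densityField l R) (scaledField l V) (scaledField l C) t r
  shock : ∀ t < 0, ShockConditions γ (deriv (shockRadius l) t) 1 0 0
    (densityField l R t (shockRadius l t)) (scaledField l V t (shockRadius l t))
    (scaledField l C t (shockRadius l t))
  origin : Tendsto V (𝓝[<] 0) (𝓝 0) ∧ Tendsto C (𝓝[<] 0) (𝓝 0)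
  /-- At the time of collapse the fields have finite values at every `r > 0`. -/
  collapse : ∃ v c ρ : ℝ, Tendsto (fun x => V x / x) (𝓝[<] 0) (𝓝 v) ∧
    Tendsto (fun x => C x / x) (𝓝[<] 0) (𝓝 c) ∧ Tendsto R (𝓝[<] 0) (𝓝 ρ)

end

end ShockODE

/-! Write a = -V, Y = C² and κ = Y / a. The phase-plane equation becomes a scalar equation for Y(a),
with right-hand side `slopeT`; the post-shock point is at a = 2/(γ+1), the origin at a = 0. Along a
connection C grows with a while 1 - a falls, so the sonic line is met at exactly one a = t, and G =
0 there forces z = `zT γ t`. Thus t replaces z as parameter, and a connection becomes a `SonicOrbit`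
(`IsConnection.exists_orbit`).

Everything rests on one barrier, the line Y = kT t · a through the origin and the triple point. On
it the slope of the orbits exceeds the slope of the line by a positive multiple of `eT`
(`slopeT_sub_kT`), and `eT` is positive on [0, 2/(γ+1)] (`SonicOrbit.eT_pos`). This positivity is a
polynomial inequality that needs a priori bounds on t, among them λ - B t > 0
(`SonicOrbit.theta_pos`), without which the orbit would end below the post-shock point. Hence an
orbit crosses the line only at t, staying above it towards the shock and below it towards the
origin.

At the shock the barrier reads kT t < γ(γ-1)/(γ+1) (`SonicOrbit.kT_lt`), a lower bound for t.
Compared with the double triple point `aM` it forces P₆ for γ ≤ γ⋆ (`steep_of_kT_lt`); since the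
right side is at most 1 for γ ≤ 1+√2 and at most 3/2 for γ ≤ 3, it also yields the bounds z₁ and z₂.
The bound z_g is λ - B t > 0 in disguise (`zg_lt`). For γ ≥ 2 the parabola Y = (γ/2)a² is a second
barrier, and it forces P₈ (`SonicOrbit.gamma_mul_sq_le`).

Uniqueness through P₆ for γ < 2 is a comparison argument: between shock and triple point the slope
increases with z, and two orbits leaving the post-shock point with different z cannot both reach
their own triple points (`SonicOrbit.not_lt_of_steep`).

Existence is shooting in t. Subtracting the barrier turns the singular equation at the triple point
into a Briot-Bouquet equation, whose analytic solution depends continuously on t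
(`exists_local_orbit`). It is continued to the shock above the barrier (`exists_left_family`); over
a suitable interval of t (`exists_triple_range`) the end value passes from too high to too low, so
some t hits the post-shock point. That orbit is continued to the origin below the barrier
(`exists_right_orbit`).

For the shock, D / G extends analytically and positively over the triple point
(`SonicOrbit.exists_ratio`). Integrating λ D / G gives log(-x) as an increasing analytic function of
a, whose inverse gives the profiles; a decay estimate for κ at a = 0 gives the limits at collapse
(`SonicOrbit.exists_limits`). -/

namespace ShockODE

/-! ### Real-variable preliminaries -/

/-- A differentiable function that starts nonnegative and has positive derivative at each of its
zeros is positive afterwards. -/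
theorem pos_of_deriv_pos_of_eq_zero {f f' : ℝ → ℝ} {a b : ℝ}
    (hf : ∀ x ∈ Icc a b, HasDerivAt f (f' x) x) (h0 : 0 ≤ f a)
    (hb : ∀ x ∈ Icc a b, f x = 0 → 0 < f' x) : ∀ x ∈ Ioc a b, 0 < f x := by
  have hcont : ContinuousOn f (Icc a b) := fun x hx => (hf x hx).continuousAt.continuousWithinAt
  have hle : ∀ x ∈ Icc a b, 0 ≤ f x := by
    intro x hx
    have := image_le_of_deriv_right_lt_deriv_boundary' (f := fun y => -f y) (f' := fun y => -f' y)
      (B := fun _ => 0) (B' := fun _ => 0) (a := a) (b := b) hcont.neg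
      (fun y hy => (hf y (Ico_subset_Icc_self hy)).neg.hasDerivWithinAt) (by simpa using h0)
      continuousOn_const (fun y _ => (hasDerivAt_const _ _).hasDerivWithinAt)
      (fun y hy h => by
        have := hb y (Ico_subset_Icc_self hy) (by simpa using h)
        simpa using this) hx
    simpa using this
  intro x hx
  rcases (hle x (Ioc_subset_Icc_self hx)).lt_or_eq with h | h
  · exact h
  exfalso
  have hd := hb x (Ioc_subset_Icc_self hx) h.symm
  -- A zero with positive derivative would make f negative just to its left.
  have hs := (hf x (Ioc_subset_Icc_self hx)).tendsto_slope
  have h2 : ∀ᶠ y in 𝓝[<] x, 0 < slope f x y :=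
    (hs.mono_left (nhdsWithin_mono _ fun y hy => ne_of_lt hy)).eventually (lt_mem_nhds hd)
  have h3 : ∀ᶠ y in 𝓝[<] x, y ∈ Ioo a x := Ioo_mem_nhdsLT hx.1
  obtain ⟨y, hy1, hy2⟩ := (h2.and h3).exists
  have hy := hle y ⟨hy2.1.le, hy2.2.le.trans hx.2⟩
  rw [slope_def_field, ← h, sub_zero] at hy1
  have : f y / (y - x) ≤ 0 := div_nonpos_of_nonneg_of_nonpos hy (by linarith [hy2.2])
  linarith

/-- The mirror image of `pos_of_deriv_pos_of_eq_zero`. -/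
theorem neg_of_deriv_pos_of_eq_zero {f f' : ℝ → ℝ} {a b : ℝ}
    (hf : ∀ x ∈ Icc a b, HasDerivAt f (f' x) x) (h0 : f b ≤ 0)
    (hb : ∀ x ∈ Icc a b, f x = 0 → 0 < f' x) : ∀ x ∈ Ico a b, f x < 0 := by
  intro x hx
  have := pos_of_deriv_pos_of_eq_zero (f := fun y => -f (-y)) (f' := fun y => f' (-y))
    (a := -b) (b := -a)
    (fun y hy => by
      have h1 := hf (-y) ⟨by linarith [hy.2], by linarith [hy.1]⟩
      have h2 := (h1.comp y (hasDerivAt_neg y)).neg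
      rw [mul_neg_one, neg_neg] at h2
      exact h2)
    (by simpa using h0)
    (fun y hy h => hb (-y) ⟨by linarith [hy.2], by linarith [hy.1]⟩ (by simpa using h))
    (-x) ⟨by linarith [hx.2], by linarith [hx.1]⟩
  simpa using this

/-- A function on `(0, b]` whose derivative is dominated by that of a bounded function has a limit
at `0`. -/
theorem exists_tendsto_of_abs_deriv_le {f f' g g' : ℝ → ℝ} {b B : ℝ} (hb : 0 < b)
    (hf : ∀ x ∈ Ioc 0 b, HasDerivAt f (f' x) x) (hg : ∀ x ∈ Ioc 0 b, HasDerivAt g (g' x) x)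
    (hfg : ∀ x ∈ Ioc 0 b, |f' x| ≤ g' x) (hB : ∀ x ∈ Ioc 0 b, |g x| ≤ B) :
    ∃ l, Tendsto f (𝓝[>] 0) (𝓝 l) := by
  have hmono : ∀ {h h' : ℝ → ℝ}, (∀ x ∈ Ioc 0 b, HasDerivAt h (h' x) x) →
      (∀ x ∈ Ioc 0 b, 0 ≤ h' x) → MonotoneOn h (Ioc 0 b) := by
    intro h h' hh hn
    apply monotoneOn_of_deriv_nonneg (convex_Ioc 0 b)
      (fun x hx => (hh x hx).continuousAt.continuousWithinAt)
      (fun x hx => ((hh x (interior_subset hx)).differentiableAt).differentiableWithinAt)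
    intro x hx
    rw [(hh x (interior_subset hx)).deriv]
    exact hn x (interior_subset hx)
  -- f is half the difference of the monotone functions f + g and g - f, each bounded below near 0
  -- because the other one is monotone and g is bounded.
  have h1 : MonotoneOn (fun x => f x + g x) (Ioc 0 b) :=
    hmono (fun x hx => (hf x hx).add (hg x hx)) fun x hx => by linarith [abs_le.1 (hfg x hx)]
  have h2 : MonotoneOn (fun x => g x - f x) (Ioc 0 b) :=
    hmono (fun x hx => (hg x hx).sub (hf x hx)) fun x hx => by linarith [abs_le.1 (hfg x hx)]
  have hlim : ∀ {h : ℝ → ℝ}, MonotoneOn h (Ioc 0 b) → (∃ c, ∀ x ∈ Ioc 0 b, c ≤ h x) →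
      ∃ l, Tendsto h (𝓝[>] 0) (𝓝 l) := by
    rintro h hm ⟨c, hc⟩
    refine ⟨_, (hm.mono Ioo_subset_Ioc_self).tendsto_nhdsWithin_Ioo_right (nonempty_Ioo.2 hb) ?_⟩
    exact ⟨c, by rintro _ ⟨x, hx, rfl⟩; exact hc x (Ioo_subset_Ioc_self hx)⟩
  have hbb : b ∈ Ioc 0 b := ⟨hb, le_rfl⟩
  obtain ⟨l1, hl1⟩ := hlim h1 ⟨-(g b - f b) - 2 * B, fun x hx => by
    have := h2 hx hbb hx.2
    have := abs_le.1 (hB x hx)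
    simp only at *
    linarith⟩
  obtain ⟨l2, hl2⟩ := hlim h2 ⟨-(f b + g b) - 2 * B, fun x hx => by
    have := h1 hx hbb hx.2
    have := abs_le.1 (hB x hx)
    simp only at *
    linarith⟩
  refine ⟨(l1 - l2) / 2, ((hl1.sub hl2).div_const 2).congr fun x => by ring⟩

/-! ### Real-analytic functions and their holomorphic extensions -/

/-- The real part of a holomorphic function restricted to the real line is real-analytic. -/
theorem analyticAt_re_ofReal {h : ℂ → ℂ} {x : ℝ} (hh : AnalyticAt ℂ h (x : ℂ)) :
    AnalyticAt ℝ (fun y : ℝ => (h (y : ℂ)).re) x := by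
  have h1 : AnalyticAt ℝ h (x : ℂ) := hh.restrictScalars
  have h2 : AnalyticAt ℝ (fun y : ℝ => (y : ℂ)) x := Complex.ofRealCLM.analyticAt x
  have h3 : AnalyticAt ℝ (fun y : ℝ => h (y : ℂ)) x := h1.comp_of_eq h2 rfl
  exact (Complex.reCLM.analyticAt _).comp h3

/-- The real power series at x₀ converges on a complex disc too. -/
theorem exists_holomorphic_extension {f : ℝ → ℝ} {x₀ : ℝ} (hf : AnalyticAt ℝ f x₀) :
    ∃ r > 0, ∃ h : ℂ → ℂ, DifferentiableOn ℂ h (Metric.ball 0 r) ∧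
      ∀ y : ℝ, |y| < r → h y = f (x₀ + y) := by
  obtain ⟨p, R, hp⟩ := hf
  obtain ⟨r, hr0, hrR⟩ := ENNReal.lt_iff_exists_nnreal_btwn.1 hp.r_pos
  have hr : 0 < (r : ℝ) := by exact_mod_cast hr0
  have hsum := p.summable_norm_mul_pow (r := r) (hrR.trans_le hp.r_le)
  refine ⟨r, hr, fun w => ∑' n, (p.coeff n : ℂ) * w ^ n, ?_, ?_⟩
  · apply Complex.differentiableOn_tsum_of_summable_norm hsum
      (fun n => by fun_prop) Metric.isOpen_ball
    intro n w hw
    rw [mem_ball_zero_iff] at hw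
    rw [norm_mul, norm_pow, Complex.norm_real]
    gcongr
    exact (p.norm_apply_eq_norm_coef (n := n)).ge
  · intro y hy
    have hy' : y ∈ Metric.eball (0 : ℝ) R := by
      rw [Metric.mem_eball, edist_zero_right]
      refine lt_trans ?_ hrR
      rw [enorm_eq_nnnorm]
      exact_mod_cast hy
    have := hp.hasSum hy'
    have h2 : HasSum (fun n => (p.coeff n : ℂ) * (y : ℂ) ^ n) (f (x₀ + y) : ℂ) := by
      have h3 := Complex.hasSum_ofReal.2 this
      convert h3 using 2 with n
      simp [mul_comm]
    exact h2.tsum_eq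

/-- Antiderivatives of real-analytic functions are real-analytic. -/
theorem analyticAt_of_hasDerivAt {f g : ℝ → ℝ} {x₀ : ℝ} (hg : AnalyticAt ℝ g x₀)
    (hf : ∀ᶠ x in 𝓝 x₀, HasDerivAt f (g x) x) : AnalyticAt ℝ f x₀ := by
  obtain ⟨r, hr, h, hh, hhg⟩ := exists_holomorphic_extension hg
  obtain ⟨H, hH⟩ := hh.isExactOn_ball
  obtain ⟨ε, hε, hfε⟩ := Metric.eventually_nhds_iff_ball.1 hf
  set δ := min r ε
  have hδ : 0 < δ := lt_min hr hε
  have hHd : ∀ x ∈ Metric.ball x₀ δ,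
      HasDerivAt (fun x : ℝ => (H ((x - x₀ : ℝ) : ℂ)).re) (g x) x := by
    intro x hx
    have hx' : |x - x₀| < r := by
      rw [← Real.dist_eq]; exact (Metric.mem_ball.1 hx).trans_le (min_le_left _ _)
    have h1 := hH ((x - x₀ : ℝ) : ℂ) (by rwa [mem_ball_zero_iff, Complex.norm_real])
    have h2 := (h1.real_of_complex).comp x ((hasDerivAt_id x).sub_const x₀)
    rw [hhg _ hx', Complex.ofReal_re, mul_one, add_sub_cancel] at h2
    exact h2
  have hconst : ∀ x ∈ Metric.ball x₀ δ,
      f x = (H ((x - x₀ : ℝ) : ℂ)).re + (f x₀ - (H ((x₀ - x₀ : ℝ) : ℂ)).re) := by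
    intro x hx
    have hfd : ∀ y ∈ Metric.ball x₀ δ, HasDerivAt f (g y) y := fun y hy =>
      hfε y (Metric.ball_subset_ball (min_le_right _ _) hy)
    have := (convex_ball x₀ δ).is_const_of_fderivWithin_eq_zero (𝕜 := ℝ)
      (f := fun y => f y - (H ((y - x₀ : ℝ) : ℂ)).re)
      (fun y hy => ((hfd y hy).sub (hHd y hy)).differentiableAt.differentiableWithinAt)
      (fun y hy => by
        rw [fderivWithin_of_isOpen Metric.isOpen_ball hy]
        have h1 := ((hfd y hy).sub (hHd y hy)).hasFDerivAt.fderiv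
        rw [sub_self] at h1
        refine h1.trans ?_
        ext
        simp)
      hx (Metric.mem_ball_self hδ)
    linarith
  have hA : AnalyticAt ℝ (fun x : ℝ => (H ((x - x₀ : ℝ) : ℂ)).re) x₀ := by
    have hHa : AnalyticAt ℂ H ((0 : ℝ) : ℂ) := by
      have : DifferentiableOn ℂ H (Metric.ball 0 r) := fun w hw =>
        (hH w hw).differentiableAt.differentiableWithinAt
      exact this.analyticAt (by simpa using Metric.ball_mem_nhds (0 : ℂ) hr)
    have h1 := analyticAt_re_ofReal hHa
    exact h1.comp_of_eq (f := fun x : ℝ => x - x₀) (by fun_prop) (by simp)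
  refine (hA.add (analyticAt_const (v := f x₀ - (H ((x₀ - x₀ : ℝ) : ℂ)).re))).congr ?_
  filter_upwards [Metric.ball_mem_nhds x₀ hδ] with x hx
  simpa using (hconst x hx).symm

end ShockODE

namespace ShockODE

/-! ### Briot-Bouquet equations

The equation `(ξ H)' = Ψ(ξ, H)`, which is regular-singular at `ξ = 0`, is solved as the fixed-point
equation `H(ξ) = ∫₀¹ Ψ(sξ, H(sξ)) ds`. -/

/-- The mean of a holomorphic function over the segment `[0, ξ]`. -/
theorem exists_primitive_mean {g : ℂ → ℂ} {r : ℝ}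
    (hg : DifferentiableOn ℂ g (Metric.ball 0 r)) :
    DifferentiableOn ℂ (fun ξ : ℂ => ∫ s in (0 : ℝ)..1, g (s * ξ)) (Metric.ball 0 r) ∧
      ∀ ξ ∈ Metric.ball (0 : ℂ) r,
        HasDerivAt (fun w : ℂ => w * ∫ s in (0 : ℝ)..1, g (s * w)) (g ξ) ξ := by
  obtain ⟨H, hH⟩ := hg.isExactOn_ball
  have hseg : ∀ ξ ∈ Metric.ball (0 : ℂ) r, ∀ s ∈ uIcc (0 : ℝ) 1,
      (s : ℂ) * ξ ∈ Metric.ball (0 : ℂ) r := by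
    intro ξ hξ s hs
    rw [uIcc_of_le zero_le_one] at hs
    rw [mem_ball_zero_iff] at hξ ⊢
    rw [norm_mul, Complex.norm_real, Real.norm_of_nonneg hs.1]
    nlinarith [norm_nonneg ξ, hs.2]
  have hcont : ∀ ξ ∈ Metric.ball (0 : ℂ) r,
      ContinuousOn (fun s : ℝ => g (s * ξ)) (uIcc (0 : ℝ) 1) := fun ξ hξ =>
    hg.continuousOn.comp (by fun_prop) fun s hs => hseg ξ hξ s hs
  have key : ∀ ξ ∈ Metric.ball (0 : ℂ) r,
      ξ * ∫ s in (0 : ℝ)..1, g (s * ξ) = H ξ - H 0 := by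
    intro ξ hξ
    have h1 : ∀ s ∈ uIcc (0 : ℝ) 1,
        HasDerivAt (fun s : ℝ => H (s * ξ)) (ξ * g (s * ξ)) s := by
      intro s hs
      have h2 : HasDerivAt (fun s : ℝ => (s : ℂ) * ξ) ξ s := by
        simpa using (Complex.ofRealCLM.hasDerivAt (x := s)).mul_const ξ
      have := (hH _ (hseg ξ hξ s hs)).comp s h2
      rwa [mul_comm] at this
    have := intervalIntegral.integral_eq_sub_of_hasDerivAt h1
      ((continuousOn_const.mul (hcont ξ hξ)).intervalIntegrable)
    simpa using this
  have hHd : DifferentiableOn ℂ H (Metric.ball 0 r) := fun w hw =>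
    (hH w hw).differentiableAt.differentiableWithinAt
  constructor
  · rcases le_or_gt r 0 with hr | hr
    · rw [Metric.ball_eq_empty.2 hr]; exact differentiableOn_empty
    have h0 : (0 : ℂ) ∈ Metric.ball (0 : ℂ) r := Metric.mem_ball_self hr
    -- The mean is the difference quotient of a primitive at 0, where the singularity is removable.
    have hd : DifferentiableOn ℂ (dslope H 0) (Metric.ball 0 r) :=
      (Complex.differentiableOn_dslope (Metric.isOpen_ball.mem_nhds h0)).2 hHd
    refine hd.congr fun ξ hξ => ?_
    rcases eq_or_ne ξ 0 with rfl | hne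
    · simp [dslope_same, (hH 0 h0).deriv]
    · rw [dslope_of_ne _ hne, slope_def_field, sub_zero, ← key ξ hξ, mul_div_cancel_left₀ _ hne]
  · intro ξ hξ
    have h1 := (hH ξ hξ).sub_const (H 0)
    refine h1.congr_of_eventuallyEq ?_
    filter_upwards [Metric.isOpen_ball.mem_nhds hξ] with w hw using key w hw

/-- Solution of a family of Briot-Bouquet equations by iteration: the solution is holomorphic in
`ξ`, depends continuously on the parameter and is real on the real line. -/
theorem exists_briotBouquet {K : Set ℝ} {h₀ : ℝ → ℝ} {Ψ : ℝ → ℂ → ℂ → ℂ} {r ρ q M : ℝ}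
    (hρ : 0 < ρ) (hq0 : 0 ≤ q) (hq : q < 1)
    (h₀c : ContinuousOn h₀ K) (hM : ∀ x ∈ K, |h₀ x| ≤ M)
    (hcont : ∀ x ∈ K, ∀ ξ ∈ Metric.ball (0 : ℂ) r, ∀ η ∈ Metric.closedBall (h₀ x : ℂ) ρ,
      ContinuousWithinAt (fun p : ℝ × ℂ => Ψ p.1 ξ p.2) (K ×ˢ univ) (x, η))
    (hlip : ∀ x ∈ K, ∀ ξ ∈ Metric.ball (0 : ℂ) r, ∀ η ∈ Metric.closedBall (h₀ x : ℂ) ρ,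
      ∀ η' ∈ Metric.closedBall (h₀ x : ℂ) ρ, ‖Ψ x ξ η - Ψ x ξ η'‖ ≤ q * ‖η - η'‖)
    (hsmall : ∀ x ∈ K, ∀ ξ ∈ Metric.ball (0 : ℂ) r, ‖Ψ x ξ (h₀ x) - h₀ x‖ ≤ (1 - q) * ρ)
    (hdiff : ∀ x ∈ K, ∀ ξ ∈ Metric.ball (0 : ℂ) r, ∀ η ∈ Metric.closedBall (h₀ x : ℂ) ρ,
      DifferentiableAt ℂ (fun p : ℂ × ℂ => Ψ x p.1 p.2) (ξ, η))
    (hreal : ∀ x ∈ K, ∀ ξ η : ℝ, (Ψ x ξ η).im = 0) :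
    ∃ H : ℝ → ℂ → ℂ, (∀ ξ ∈ Metric.ball (0 : ℂ) r, ContinuousOn (fun x => H x ξ) K) ∧
      (∀ x ∈ K, DifferentiableOn ℂ (H x) (Metric.ball 0 r)) ∧
      (∀ x ∈ K, ∀ ξ ∈ Metric.ball (0 : ℂ) r, H x ξ ∈ Metric.closedBall (h₀ x : ℂ) ρ) ∧
      (∀ x ∈ K, ∀ ξ : ℝ, |ξ| < r → (H x ξ).im = 0) ∧
      ∀ x ∈ K, ∀ ξ ∈ Metric.ball (0 : ℂ) r,
        HasDerivAt (fun w => w * H x w) (Ψ x ξ (H x ξ)) ξ := by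
  set Ω := Metric.ball (0 : ℂ) r with hΩ
  have hseg : ∀ ξ ∈ Ω, ∀ s ∈ Icc (0 : ℝ) 1, (s : ℂ) * ξ ∈ Ω := by
    intro ξ hξ s hs
    rw [hΩ, mem_ball_zero_iff] at hξ ⊢
    rw [norm_mul, Complex.norm_real, Real.norm_of_nonneg hs.1]
    nlinarith [norm_nonneg ξ, hs.2]
  let T : (ℝ → ℂ → ℂ) → ℝ → ℂ → ℂ := fun f x ξ => ∫ s in (0 : ℝ)..1, Ψ x (s * ξ) (f x (s * ξ))
  -- The class in which the iteration runs. Each of its four conditions is preserved by `T` and by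
  -- uniform limits, so the fixed point inherits all of them.
  let P : (ℝ → ℂ → ℂ) → Prop := fun f =>
    (∀ ξ ∈ Ω, ContinuousOn (fun x => f x ξ) K) ∧ (∀ x ∈ K, DifferentiableOn ℂ (f x) Ω) ∧
    (∀ x ∈ K, ∀ ξ ∈ Ω, f x ξ ∈ Metric.closedBall (h₀ x : ℂ) ρ) ∧
    (∀ x ∈ K, ∀ ξ : ℝ, |ξ| < r → (f x ξ).im = 0)
  have hbound : ∀ x ∈ K, ∀ ξ ∈ Ω, ∀ η ∈ Metric.closedBall (h₀ x : ℂ) ρ,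
      ‖Ψ x ξ η - h₀ x‖ ≤ ρ := by
    intro x hx ξ hξ η hη
    have hη' : ‖η - h₀ x‖ ≤ ρ := by simpa [dist_eq_norm] using hη
    calc ‖Ψ x ξ η - h₀ x‖ = ‖(Ψ x ξ η - Ψ x ξ (h₀ x)) + (Ψ x ξ (h₀ x) - h₀ x)‖ := by ring_nf
      _ ≤ q * ‖η - h₀ x‖ + (1 - q) * ρ := (norm_add_le _ _).trans (add_le_add
          (hlip x hx ξ hξ η hη _ (Metric.mem_closedBall_self hρ.le)) (hsmall x hx ξ hξ))
      _ ≤ ρ := by nlinarith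
  have hgd : ∀ f, P f → ∀ x ∈ K, DifferentiableOn ℂ (fun ξ => Ψ x ξ (f x ξ)) Ω := by
    intro f hf x hx ξ hξ
    have h1 := hdiff x hx ξ hξ _ (hf.2.2.1 x hx ξ hξ)
    have h2 : DifferentiableAt ℂ (f x) ξ :=
      (hf.2.1 x hx).differentiableAt (Metric.isOpen_ball.mem_nhds hξ)
    exact (DifferentiableAt.comp (f := fun ξ => (ξ, f x ξ)) ξ h1
      (differentiableAt_id.prodMk h2)).differentiableWithinAt
  have hgc : ∀ f, P f → ∀ x ∈ K, ∀ ξ ∈ Ω,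
      ContinuousOn (fun s : ℝ => Ψ x (s * ξ) (f x (s * ξ))) (Icc 0 1) := by
    intro f hf x hx ξ hξ
    exact (hgd f hf x hx).continuousOn.comp (f := fun s : ℝ => (s : ℂ) * ξ) (by fun_prop)
      fun s hs => hseg ξ hξ s hs
  have hsub : ∀ f, P f → ∀ x ∈ K, ∀ ξ ∈ Ω, ∀ w : ℂ, ∀ C : ℝ,
      (∀ s ∈ Icc (0 : ℝ) 1, ‖Ψ x (s * ξ) (f x (s * ξ)) - w‖ ≤ C) → ‖T f x ξ - w‖ ≤ C := by
    intro f hf x hx ξ hξ w C hC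
    have h1 : T f x ξ - w = ∫ s in (0 : ℝ)..1, (Ψ x (s * ξ) (f x (s * ξ)) - w) := by
      rw [intervalIntegral.integral_sub]
      · simp [T]
      · exact ((hgc f hf x hx ξ hξ).mono (by rw [uIcc_of_le zero_le_one])).intervalIntegrable
      · simp
    rw [h1]
    have := intervalIntegral.norm_integral_le_of_norm_le_const (a := (0 : ℝ)) (b := 1) (C := C)
      (f := fun s : ℝ => Ψ x (s * ξ) (f x (s * ξ)) - w) fun s hs => by
        rw [uIoc_of_le zero_le_one] at hs
        exact hC s ⟨hs.1.le, hs.2⟩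
    simpa using this
  have hPT : ∀ f, P f → P (T f) := by
    intro f hf
    refine ⟨fun ξ hξ => ?_, fun x hx => ?_, fun x hx ξ hξ => ?_, fun x hx ξ hξ => ?_⟩
    · intro x hx
      apply intervalIntegral.continuousWithinAt_of_dominated_interval (bound := fun _ => M + ρ)
      · filter_upwards [self_mem_nhdsWithin] with y hy
        refine ((hgc f hf y hy ξ hξ).mono ?_).aestronglyMeasurable measurableSet_uIoc
        rw [uIoc_of_le zero_le_one]
        exact Ioc_subset_Icc_self
      · filter_upwards [self_mem_nhdsWithin] with y hy
        refine Eventually.of_forall fun s hs => ?_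
        rw [uIoc_of_le zero_le_one] at hs
        have hs' := hseg ξ hξ s ⟨hs.1.le, hs.2⟩
        have h1 := hbound y hy _ hs' _ (hf.2.2.1 y hy _ hs')
        have h2 : ‖((h₀ y : ℝ) : ℂ)‖ ≤ M := by
          rw [Complex.norm_real]; exact hM y hy
        calc _ = ‖(Ψ y (s * ξ) (f y (s * ξ)) - h₀ y) + h₀ y‖ := by ring_nf
          _ ≤ _ := (norm_add_le _ _).trans (by linarith)
      · simp
      · refine Eventually.of_forall fun s hs => ?_
        rw [uIoc_of_le zero_le_one] at hs
        have hs' := hseg ξ hξ s ⟨hs.1.le, hs.2⟩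
        have h1 := hcont x hx _ hs' _ (hf.2.2.1 x hx _ hs')
        exact ContinuousWithinAt.comp (f := fun y => (y, f y (s * ξ))) (t := K ×ˢ univ) h1
          (continuousWithinAt_id.prodMk (hf.1 _ hs' x hx)) fun y hy => ⟨hy, trivial⟩
    · exact (exists_primitive_mean (hgd f hf x hx)).1
    · rw [Metric.mem_closedBall, dist_eq_norm]
      refine hsub f hf x hx ξ hξ _ _ fun s hs => ?_
      exact hbound x hx _ (hseg ξ hξ s hs) _ (hf.2.2.1 x hx _ (hseg ξ hξ s hs))
    · have h1 : T f x ξ = ((∫ s in (0 : ℝ)..1, (Ψ x (s * ξ) (f x (s * ξ))).re : ℝ) : ℂ) := by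
        rw [← intervalIntegral.integral_ofReal]
        apply intervalIntegral.integral_congr
        intro s hs
        rw [uIcc_of_le zero_le_one] at hs
        have h2 : (f x ((s * ξ : ℝ) : ℂ)).im = 0 := hf.2.2.2 x hx _ (by
          rw [abs_mul, abs_of_nonneg hs.1]; nlinarith [abs_nonneg ξ, hs.2])
        have h3 : f x ((s * ξ : ℝ) : ℂ) = ((f x ((s * ξ : ℝ) : ℂ)).re : ℂ) :=
          Complex.ext rfl (by simpa using h2)
        have h4 := hreal x hx (s * ξ) (f x ((s * ξ : ℝ) : ℂ)).re
        rw [← h3] at h4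
        push_cast at h4 ⊢
        exact Complex.ext rfl (by simpa using h4)
      rw [h1]; exact Complex.ofReal_im _
  have hlipT : ∀ f g, P f → P g → ∀ C : ℝ, (∀ x ∈ K, ∀ ξ ∈ Ω, ‖f x ξ - g x ξ‖ ≤ C) →
      ∀ x ∈ K, ∀ ξ ∈ Ω, ‖T f x ξ - T g x ξ‖ ≤ q * C := by
    intro f g hf hg C hC x hx ξ hξ
    have h1 : T f x ξ - T g x ξ
        = ∫ s in (0 : ℝ)..1, (Ψ x (s * ξ) (f x (s * ξ)) - Ψ x (s * ξ) (g x (s * ξ))) := by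
      rw [intervalIntegral.integral_sub]
      · exact ((hgc f hf x hx ξ hξ).mono (by rw [uIcc_of_le zero_le_one])).intervalIntegrable
      · exact ((hgc g hg x hx ξ hξ).mono (by rw [uIcc_of_le zero_le_one])).intervalIntegrable
    rw [h1]
    have := intervalIntegral.norm_integral_le_of_norm_le_const (a := (0 : ℝ)) (b := 1) (C := q * C)
      (f := fun s : ℝ => Ψ x (s * ξ) (f x (s * ξ)) - Ψ x (s * ξ) (g x (s * ξ))) fun s hs => by
        rw [uIoc_of_le zero_le_one] at hs
        have hs' := hseg ξ hξ s ⟨hs.1.le, hs.2⟩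
        refine (hlip x hx _ hs' _ (hf.2.2.1 x hx _ hs') _ (hg.2.2.1 x hx _ hs')).trans ?_
        exact mul_le_mul_of_nonneg_left (hC x hx _ hs') hq0
    simpa using this
  let f : ℕ → ℝ → ℂ → ℂ := fun n => T^[n] (fun x _ => (h₀ x : ℂ))
  have hfsucc : ∀ n, f (n + 1) = T (f n) := fun n => Function.iterate_succ_apply' T n _
  have hPf : ∀ n, P (f n) := by
    intro n
    induction n with
    | zero =>
      refine ⟨fun ξ _ => Complex.continuous_ofReal.comp_continuousOn h₀c, fun x _ => ?_,
        fun x _ ξ _ => Metric.mem_closedBall_self hρ.le, fun x _ ξ _ => Complex.ofReal_im _⟩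
      exact differentiableOn_const _
    | succ n ih => rw [hfsucc]; exact hPT _ ih
  have hstep : ∀ n, ∀ x ∈ K, ∀ ξ ∈ Ω, ‖f n x ξ - f (n + 1) x ξ‖ ≤ ρ * q ^ n := by
    intro n
    induction n with
    | zero =>
      intro x hx ξ hξ
      have := (hPf 1).2.2.1 x hx ξ hξ
      rw [Metric.mem_closedBall, dist_comm, dist_eq_norm] at this
      rw [pow_zero, mul_one]
      exact this
    | succ n ih =>
      intro x hx ξ hξ
      have := hlipT _ _ (hPf n) (hPf (n + 1)) _ ih x hx ξ hξ
      rw [← hfsucc, ← hfsucc] at this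
      calc _ ≤ _ := this
        _ = _ := by ring
  have hcauchy : ∀ x ∈ K, ∀ ξ ∈ Ω, CauchySeq fun n => f n x ξ := fun x hx ξ hξ =>
    cauchySeq_of_le_geometric q ρ hq fun n => by
      rw [dist_eq_norm]; exact hstep n x hx ξ hξ
  choose! H hH using fun x (hx : x ∈ K) ξ (hξ : ξ ∈ Ω) =>
    cauchySeq_tendsto_of_complete (hcauchy x hx ξ hξ)
  have hdist : ∀ n, ∀ x ∈ K, ∀ ξ ∈ Ω, ‖f n x ξ - H x ξ‖ ≤ ρ * q ^ n / (1 - q) := by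
    intro n x hx ξ hξ
    rw [← dist_eq_norm]
    exact dist_le_of_le_geometric_of_tendsto q ρ hq (fun n => by
      rw [dist_eq_norm]; exact hstep n x hx ξ hξ) (hH x hx ξ hξ) n
  have hlim0 : Tendsto (fun n : ℕ => ρ * q ^ n / (1 - q)) atTop (𝓝 0) := by
    have := ((tendsto_pow_atTop_nhds_zero_of_lt_one hq0 hq).const_mul ρ).div_const (1 - q)
    simpa using this
  have hunif : ∀ (ι : Type) (s : Set ι) (a : ι → ℝ) (b : ι → ℂ), (∀ i ∈ s, a i ∈ K ∧ b i ∈ Ω) →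
      TendstoUniformlyOn (fun n i => f n (a i) (b i)) (fun i => H (a i) (b i)) atTop s := by
    intro ι s a b hab
    rw [Metric.tendstoUniformlyOn_iff]
    intro ε hε
    filter_upwards [hlim0.eventually (gt_mem_nhds hε)] with n hn i hi
    rw [dist_comm, dist_eq_norm]
    exact (hdist n _ (hab i hi).1 _ (hab i hi).2).trans_lt hn
  have hPH : P H := by
    refine ⟨fun ξ hξ => ?_, fun x hx => ?_, fun x hx ξ hξ => ?_, fun x hx ξ hξ => ?_⟩
    · exact (hunif ℝ K id (fun _ => ξ) fun x hx => ⟨hx, hξ⟩).continuousOn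
        (Frequently.of_forall fun n => (hPf n).1 ξ hξ)
    · exact ((hunif ℂ Ω (fun _ => x) id fun ξ hξ => ⟨hx, hξ⟩).tendstoLocallyUniformlyOn).differentiableOn
        (Eventually.of_forall fun n => (hPf n).2.1 x hx) Metric.isOpen_ball
    · exact Metric.isClosed_closedBall.mem_of_tendsto (hH x hx ξ hξ)
        (Eventually.of_forall fun n => (hPf n).2.2.1 x hx ξ hξ)
    · have hξ' : (ξ : ℂ) ∈ Ω := by
        rw [hΩ, mem_ball_zero_iff, Complex.norm_real]; exact hξ
      have h1 := (Complex.continuous_im.tendsto _).comp (hH x hx ξ hξ')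
      refine tendsto_nhds_unique h1 (tendsto_const_nhds.congr fun n => ?_)
      exact ((hPf n).2.2.2 x hx ξ hξ).symm
  have hfix : ∀ x ∈ K, ∀ ξ ∈ Ω, T H x ξ = H x ξ := by
    intro x hx ξ hξ
    have h1 : ∀ n, ‖T H x ξ - H x ξ‖ ≤ 2 * (ρ * q ^ n / (1 - q)) := by
      intro n
      have h2 := hlipT _ _ hPH (hPf n) _ (fun x hx ξ hξ => by
        rw [norm_sub_rev]; exact hdist n x hx ξ hξ) x hx ξ hξ
      have h3 := hdist (n + 1) x hx ξ hξ
      rw [← hfsucc] at h2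
      have h4 : ρ * q ^ (n + 1) / (1 - q) = q * (ρ * q ^ n / (1 - q)) := by ring
      have h5 : 0 ≤ ρ * q ^ n / (1 - q) := by
        have : 0 < 1 - q := by linarith
        positivity
      calc ‖T H x ξ - H x ξ‖ = ‖(T H x ξ - f (n + 1) x ξ) + (f (n + 1) x ξ - H x ξ)‖ := by ring_nf
        _ ≤ _ := norm_add_le _ _
        _ ≤ _ := by rw [h4] at h3; nlinarith
    have h2 : ‖T H x ξ - H x ξ‖ ≤ 0 := by
      refine ge_of_tendsto' (x := atTop) (f := fun n : ℕ => 2 * (ρ * q ^ n / (1 - q))) ?_ h1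
      simpa using hlim0.const_mul 2
    exact sub_eq_zero.1 (norm_le_zero_iff.1 h2)
  refine ⟨H, hPH.1, hPH.2.1, hPH.2.2.1, hPH.2.2.2, fun x hx ξ hξ => ?_⟩
  have h1 := (exists_primitive_mean (hgd H hPH x hx)).2 ξ hξ
  refine h1.congr_of_eventuallyEq ?_
  filter_upwards [Metric.isOpen_ball.mem_nhds hξ] with w hw
  rw [← hfix x hx w hw]

end ShockODE

/-! ### Analyticity of solutions of scalar equations -/

namespace ShockODE

/-- Solutions of a scalar ODE whose right-hand side extends holomorphically are real-analytic. -/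
theorem analyticAt_of_ode {f : ℂ × ℂ → ℂ} {g : ℝ → ℝ → ℝ} {y : ℝ → ℝ} {a₀ : ℝ}
    (hf : AnalyticAt ℂ f ((a₀ : ℂ), (y a₀ : ℂ))) (hfg : ∀ a b : ℝ, f (a, b) = g a b)
    (hy : ∀ᶠ a in 𝓝 a₀, HasDerivAt y (g a (y a)) a) : AnalyticAt ℝ y a₀ := by
  set y₀ := y a₀ with hy₀
  set p₀ : ℂ × ℂ := ((a₀ : ℂ), (y₀ : ℂ)) with hp₀
  obtain ⟨L, s, hs, hL⟩ := (hf.contDiffAt (n := 1)).exists_lipschitzOnWith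
  obtain ⟨δ, hδ, hsδ⟩ := Metric.eventually_nhds_iff_ball.1
    ((eventually_mem_set.2 hs).and hf.eventually_analyticAt)
  set h := g a₀ y₀ with hh
  set M := |h| + 1 with hM
  have hM1 : 1 ≤ M := by have := abs_nonneg h; linarith
  set A := (L : ℝ) + 1 with hA
  have hA1 : 1 ≤ A := by have := L.2; linarith [L.coe_nonneg]
  set r := min (δ / M) (1 / (2 * A * M)) with hr
  have hr0 : 0 < r := by positivity
  have hrδ : r * M ≤ δ := by
    have : r ≤ δ / M := min_le_left _ _
    rwa [le_div_iff₀ (by positivity)] at this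
  have hrA : A * (r * M) ≤ 1 / 2 := by
    have : r ≤ 1 / (2 * A * M) := min_le_right _ _
    rw [le_div_iff₀ (by positivity)] at this
    linarith
  have hmem : ∀ ξ ∈ Metric.ball (0 : ℂ) r, ∀ η ∈ Metric.closedBall (h : ℂ) 1,
      ((a₀ : ℂ) + ξ, (y₀ : ℂ) + ξ * η) ∈ Metric.ball p₀ δ := by
    intro ξ hξ η hη
    rw [mem_ball_zero_iff] at hξ
    have hη' : ‖η‖ ≤ M := by
      have h1 : ‖η - h‖ ≤ 1 := by simpa [dist_eq_norm] using hη
      calc ‖η‖ = ‖(η - h) + h‖ := by ring_nf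
        _ ≤ ‖η - h‖ + ‖(h : ℂ)‖ := norm_add_le _ _
        _ ≤ M := by rw [Complex.norm_real, Real.norm_eq_abs]; linarith
    rw [Metric.mem_ball, hp₀, Prod.dist_eq, max_lt_iff]
    constructor
    · rw [dist_eq_norm, add_sub_cancel_left]
      nlinarith
    · rw [dist_eq_norm, add_sub_cancel_left, norm_mul]
      nlinarith [norm_nonneg ξ, norm_nonneg η]
  have hlipf : ∀ p ∈ Metric.ball p₀ δ, ∀ p' ∈ Metric.ball p₀ δ, ‖f p - f p'‖ ≤ A * ‖p - p'‖ := by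
    intro p hp p' hp'
    have := hL.dist_le_mul p (hsδ p hp).1 p' (hsδ p' hp').1
    rw [dist_eq_norm, dist_eq_norm] at this
    nlinarith [norm_nonneg (p - p')]
  have hball0 : ∀ ξ ∈ Metric.ball (0 : ℂ) r, ‖ξ‖ < r := fun ξ hξ => by simpa using hξ
  have hhf : f p₀ = h := by rw [hp₀, hfg]
  -- With a = a₀ + ξ and y = y₀ + ξη the equation y' = f(a, y) reads (ξη)' = f(a₀ + ξ, y₀ + ξη).
  -- This is a Briot-Bouquet equation, contracting in η because η enters multiplied by the small ξ;
  -- the parameter set is a single dummy point.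
  obtain ⟨H, -, hHd, hHb, hHr, hHode⟩ := exists_briotBouquet (K := {(0 : ℝ)}) (h₀ := fun _ => h)
    (Ψ := fun _ ξ η => f ((a₀ : ℂ) + ξ, (y₀ : ℂ) + ξ * η)) (r := r) (ρ := 1) (q := 1 / 2) (M := |h|)
    one_pos (by norm_num) (by norm_num) continuousOn_const (fun _ _ => le_rfl)
    (fun x _ ξ hξ η hη => by
      have h1 := (hsδ _ (hmem ξ hξ η hη)).2.continuousAt
      exact (ContinuousAt.comp (f := fun p : ℝ × ℂ => ((a₀ : ℂ) + ξ, (y₀ : ℂ) + ξ * p.2))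
        (x := (x, η)) h1 (by fun_prop)).continuousWithinAt)
    (fun x _ ξ hξ η hη η' hη' => by
      refine (hlipf _ (hmem ξ hξ η hη) _ (hmem ξ hξ η' hη')).trans ?_
      rw [Prod.mk_sub_mk, sub_self, add_sub_add_left_eq_sub, ← mul_sub, Prod.norm_mk, norm_zero,
        max_eq_right (norm_nonneg _), norm_mul]
      have := hball0 ξ hξ
      have h2 : A * ‖ξ‖ ≤ 1 / 2 := le_trans (by gcongr; nlinarith) hrA
      nlinarith [norm_nonneg (η - η')])
    (fun x _ ξ hξ => by
      have h1 := hlipf _ (hmem ξ hξ h (Metric.mem_closedBall_self zero_le_one)) p₀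
        (Metric.mem_ball_self hδ)
      rw [hhf] at h1
      refine h1.trans ?_
      have := hball0 ξ hξ
      rw [hp₀, Prod.mk_sub_mk, add_sub_cancel_left, add_sub_cancel_left, Prod.norm_mk, norm_mul,
        Complex.norm_real, Real.norm_eq_abs]
      have h2 : max ‖ξ‖ (‖ξ‖ * |h|) ≤ r * M := by
        apply max_le <;> nlinarith [norm_nonneg ξ, abs_nonneg h]
      nlinarith)
    (fun x _ ξ hξ η hη => by
      have h1 := (hsδ _ (hmem ξ hξ η hη)).2.differentiableAt
      exact DifferentiableAt.comp (f := fun p : ℂ × ℂ => ((a₀ : ℂ) + p.1, (y₀ : ℂ) + p.1 * p.2))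
        (ξ, η) h1 (by fun_prop))
    (fun x _ ξ η => by
      have := hfg (a₀ + ξ) (y₀ + ξ * η)
      push_cast at this
      rw [this, Complex.ofReal_im])
  have h0 : (0 : ℝ) ∈ ({0} : Set ℝ) := rfl
  have hwd : DifferentiableOn ℂ (fun w => w * H 0 w) (Metric.ball 0 r) :=
    differentiableOn_id.mul (hHd 0 h0)
  have hana : ∀ ξ : ℝ, |ξ| < r → AnalyticAt ℂ (fun w => w * H 0 w) ξ := fun ξ hξ =>
    hwd.analyticAt (Metric.isOpen_ball.mem_nhds (by
      rwa [mem_ball_zero_iff, Complex.norm_real]))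
  set y' : ℝ → ℝ := fun a => y₀ + (((a - a₀ : ℝ) : ℂ) * H 0 ((a - a₀ : ℝ) : ℂ)).re with hy'
  have hy'a : AnalyticAt ℝ y' a₀ := by
    refine analyticAt_const.add ?_
    have := analyticAt_re_ofReal (hana 0 (by simpa using hr0))
    exact this.comp_of_eq (f := fun a : ℝ => a - a₀) (by fun_prop) (by simp)
  have hy'0 : y' a₀ = y₀ := by simp [hy']
  have hnear : ∀ᶠ a in 𝓝 a₀, |a - a₀| < r := by
    have := Metric.ball_mem_nhds a₀ hr0
    filter_upwards [this] with a ha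
    rwa [Metric.mem_ball, Real.dist_eq] at ha
  have hreal : ∀ ξ : ℝ, |ξ| < r → H 0 ξ = ((H 0 ξ).re : ℂ) := fun ξ hξ =>
    Complex.ext rfl (by simpa using hHr 0 h0 ξ hξ)
  have hy'd : ∀ᶠ a in 𝓝 a₀, HasDerivAt y' (g a (y' a)) a := by
    filter_upwards [hnear] with a ha
    have hb : ((a - a₀ : ℝ) : ℂ) ∈ Metric.ball (0 : ℂ) r := by
      rwa [mem_ball_zero_iff, Complex.norm_real]
    have h1 := hHode 0 h0 _ hb
    have h2 := ((h1.real_of_complex).comp a ((hasDerivAt_id a).sub_const a₀)).const_add y₀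
    have h3 : y' a = y₀ + (a - a₀) * (H 0 ((a - a₀ : ℝ) : ℂ)).re := by
      rw [hy']; simp only [Complex.re_ofReal_mul]
    have h4 : f ((a₀ : ℂ) + ((a - a₀ : ℝ) : ℂ), (y₀ : ℂ) + ((a - a₀ : ℝ) : ℂ) * H 0 ((a - a₀ : ℝ) : ℂ))
        = g a (y' a) := by
      rw [← hfg, h3]
      nth_rewrite 1 [hreal _ ha]
      push_cast
      ring_nf
    rw [h4, Complex.ofReal_re, mul_one] at h2
    exact h2
  have hin : ∀ z : ℝ → ℝ, ContinuousAt z a₀ → z a₀ = y₀ →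
      ∀ᶠ a : ℝ in 𝓝 a₀, z a ∈ {b : ℝ | ((a : ℂ), (b : ℂ)) ∈ Metric.ball p₀ δ} := by
    intro z hz hz0
    have h1 : ContinuousAt (fun a : ℝ => ((a : ℂ), (z a : ℂ))) a₀ :=
      (Complex.continuous_ofReal.continuousAt).prodMk
        (Complex.continuous_ofReal.continuousAt.comp hz)
    refine h1 (Metric.isOpen_ball.mem_nhds ?_)
    simp only [hz0]
    exact Metric.mem_ball_self hδ
  -- Uniqueness for the real equation identifies the given solution with the analytic one.
  have heq : y =ᶠ[𝓝 a₀] y' := by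
    refine ODE_solution_unique_of_eventually (v := g) (K := ⟨A, by linarith⟩)
      (s := fun a => {b : ℝ | ((a : ℂ), (b : ℂ)) ∈ Metric.ball p₀ δ}) ?_
      (hy.and (hin y hy.self_of_nhds.continuousAt rfl))
      (hy'd.and (hin y' hy'a.continuousAt hy'0)) hy'0.symm
    refine Eventually.of_forall fun a => LipschitzOnWith.of_dist_le_mul fun b hb b' hb' => ?_
    have := hlipf _ hb _ hb'
    rw [hfg, hfg, Prod.mk_sub_mk, sub_self, Prod.norm_mk, norm_zero,
      max_eq_right (norm_nonneg _), ← Complex.ofReal_sub, ← Complex.ofReal_sub, Complex.norm_real,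
      Complex.norm_real] at this
    exact this
  exact hy'a.congr heq.symm

end ShockODE

namespace ShockODE

/-! ### Triple points and the orbit equation in the variables `a = -V`, `κ = C² / a`

The triple point is `a = t`; its position determines the parameter `z = zT γ t`. -/

section Defs

variable {𝕂 : Type*} [Field 𝕂]

/-- The parameter `z` for which `(V, C) = (-t, 1 - t)` is a triple point. -/
def zT (γ t : 𝕂) : 𝕂 := t * (1 - t) / (2 - (2 - γ) * t)

def lT (m γ t : 𝕂) : 𝕂 := 1 + m * γ * zT γ t

/-- The critical point P₄ lies at a = λ / `BT`, so the sign of λ - `BT` · t tells on which side of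
P₄ the triple point lies. -/
def BT (m γ : 𝕂) : 𝕂 := (γ + 1 + m * (γ - 1)) / 2

/-- The value of `κ` at the triple point. -/
def kT (t : 𝕂) : 𝕂 := (1 - t) ^ 2 / t

/-- On the line κ = `kT t` the function G vanishes at a = 0, t and `bT`. -/
def bT (m γ t : 𝕂) : 𝕂 := (lT m γ t + 2 * kT t * m * zT γ t) / t

/-- Minus the coefficient of C² in G. -/
def cT (m γ t a : 𝕂) : 𝕂 := (m + 1) * a - 2 * m * zT γ t

/-- For `κ = kT t + (a - t) η` one has `D = -(a - t) * numT`. -/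
def numT (t a η : 𝕂) : 𝕂 := 1 / t - a + a * η

/-- For `κ = kT t + (a - t) η` one has `G = -a (a - t) * denT`. -/
def denT (m γ t a η : 𝕂) : 𝕂 := bT m γ t - a + η * cT m γ t a

/-- The orbit equation is `((a - t) η)' = psi (a - t) η`. -/
def psi (m γ t ξ η : 𝕂) : 𝕂 :=
  (kT t + ξ * η) * (-1 / (t + ξ) + (γ - 1) / (1 - (t + ξ))
    + 2 * (lT m γ t - BT m γ * (t + ξ)) / ((1 - (t + ξ)) * (t + ξ))
      * (numT t (t + ξ) η / denT m γ t (t + ξ) η))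

/-- `psi (a - t) 0 = kT t * eT / (a (1 - a) (bT - a))`. -/
def eT (m γ t a : 𝕂) : 𝕂 :=
  2 * (lT m γ t - BT m γ * a) * (1 / t - a) - (1 - γ * a) * (bT m γ t - a)

end Defs

/-- A concave function lies above its chords. This reduces the polynomial inequalities below to the
two ends of the range of one variable. -/
theorem concave_quadratic_pos {c₂ c₁ c₀ y₁ y₂ y : ℝ} (hc : c₂ ≤ 0)
    (h₁ : 0 < c₂ * y₁ ^ 2 + c₁ * y₁ + c₀) (h₂ : 0 < c₂ * y₂ ^ 2 + c₁ * y₂ + c₀)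
    (hy₁ : y₁ ≤ y) (hy₂ : y ≤ y₂) : 0 < c₂ * y ^ 2 + c₁ * y + c₀ := by
  rcases eq_or_lt_of_le (hy₁.trans hy₂) with h | h
  · have : y = y₁ := le_antisymm (hy₂.trans h.ge) hy₁
    rwa [this]
  have key : (y₂ - y₁) * (c₂ * y ^ 2 + c₁ * y + c₀) =
      (y₂ - y) * (c₂ * y₁ ^ 2 + c₁ * y₁ + c₀) + (y - y₁) * (c₂ * y₂ ^ 2 + c₁ * y₂ + c₀)
        + -c₂ * ((y - y₁) * (y₂ - y) * (y₂ - y₁)) := by ring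
  have h3 : 0 < y₂ - y₁ := sub_pos.2 h
  have h4 : 0 ≤ -c₂ * ((y - y₁) * (y₂ - y) * (y₂ - y₁)) := by
    have := sub_nonneg.2 hy₁
    have := sub_nonneg.2 hy₂
    have : 0 ≤ -c₂ := by linarith
    positivity
  have h5 : 0 < (y₂ - y) * (c₂ * y₁ ^ 2 + c₁ * y₁ + c₀)
      + (y - y₁) * (c₂ * y₂ ^ 2 + c₁ * y₂ + c₀) := by
    rcases eq_or_lt_of_le hy₁ with h' | h'
    · rw [← h', sub_self, zero_mul, add_zero]; exact mul_pos h3 h₁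
    · have : 0 ≤ (y₂ - y) * (c₂ * y₁ ^ 2 + c₁ * y₁ + c₀) :=
        mul_nonneg (sub_nonneg.2 hy₂) h₁.le
      have : 0 < (y - y₁) * (c₂ * y₂ ^ 2 + c₁ * y₂ + c₀) := mul_pos (sub_pos.2 h') h₂
      linarith
  exact pos_of_mul_pos_right (key ▸ by linarith) h3.le

variable {m γ t a : ℝ}

theorem dT_pos (hγ : 1 < γ) (ht : 0 < t) (ht1 : t < 1) : 0 < 2 - (2 - γ) * t := by nlinarith

theorem zT_pos (hγ : 1 < γ) (ht : 0 < t) (ht1 : t < 1) : 0 < zT γ t :=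
  div_pos (mul_pos ht (by linarith)) (dT_pos hγ ht ht1)

/-- A crude bound, enough to fix the sign of G at the post-shock point in `GT_start_neg`. -/
theorem gamma_zT_le (hγ : 1 < γ) (hγ3 : γ ≤ 3) (ht : 0 < t) (ht1 : t < 1) : γ * zT γ t ≤ 1 / 3 := by
  rw [zT, ← mul_div_assoc, div_le_iff₀ (dT_pos hγ ht ht1)]
  nlinarith [sq_nonneg (2 * t - 1), mul_nonneg ht.le (sub_nonneg.2 hγ3), sq_nonneg (t - 2 / 5), mul_nonneg (mul_nonneg ht.le (sub_nonneg.2 hγ3)) (sub_nonneg.2 ht1.le)]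

theorem one_lt_lT (hm : 0 < m) (hγ : 1 < γ) (ht : 0 < t) (ht1 : t < 1) : 1 < lT m γ t := by
  have := zT_pos hγ ht ht1
  have : 0 < m * γ * zT γ t := by positivity
  rw [lT]; linarith

theorem kT_pos (ht : 0 < t) (ht1 : t < 1) : 0 < kT t := by
  have : 0 < 1 - t := by linarith
  rw [kT]; positivity

/-- On the barrier line D vanishes at t and 1/t, and G at 0, t and `bT`. Both extra roots exceed 1,
so on (0, 1) the triple point is the only sign change of D and of G along that line. -/
theorem one_div_lt_bT (hm : 0 < m) (hγ : 1 < γ) (ht : 0 < t) (ht1 : t < 1) : 1 / t < bT m γ t := by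
  have h1 := one_lt_lT hm hγ ht ht1
  have h2 := kT_pos ht ht1
  have h3 := zT_pos hγ ht ht1
  rw [bT]
  gcongr
  have : 0 < 2 * kT t * m * zT γ t := by positivity
  linarith

theorem cT_pos (hm : 0 < m) (hγ : 1 < γ) (ht : 0 < t) (ht1 : t < 1) (ha : t ≤ a) :
    0 < cT m γ t a := by
  have hd := dT_pos hγ ht ht1
  have h1 : cT m γ t t = t * (2 * (1 - t) + (m + 1) * γ * t) / (2 - (2 - γ) * t) := by
    have hd' : 2 - (2 - γ) * t ≠ 0 := hd.ne'
    have hz : zT γ t * (2 - (2 - γ) * t) = t * (1 - t) := div_mul_cancel₀ _ hd'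
    rw [eq_div_iff hd', cT]; linear_combination (-2 * m) * hz
  have h2 : 0 < cT m γ t t := by
    rw [h1]
    have : 0 < 1 - t := by linarith
    positivity
  have h3 : cT m γ t a = cT m γ t t + (m + 1) * (a - t) := by rw [cT, cT]; ring
  have : 0 ≤ (m + 1) * (a - t) := mul_nonneg (by linarith) (by linarith)
  linarith

/-! ### Positivity of the barrier polynomial -/

/-- Expansion in the distances 1 - a and 1 - t. -/
theorem dT_mul_eT_one (hd : 2 - (2 - γ) * t ≠ 0) (ht : t ≠ 0) :
    (2 - (2 - γ) * t) * eT 1 γ t a = γ * (1 - a) * (γ * (1 - a) - (γ - 1))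
      + (2 - γ + γ ^ 2) * (1 - a) * (1 - t) + 2 * (1 - t) ^ 2
      + γ * (2 - γ) * (1 - a) ^ 2 * (1 - t) := by
  rw [eT, bT, lT, BT, kT, zT]; field_simp; ring

/-- Here u = (γ-1)/(γ+1); in this variable the post-shock point is (a, Y) = (1 - u, u(1 + u)), and γ
≤ 3 becomes u ≤ 1/2. -/
theorem dT_mul_eT_two {u : ℝ} (hγ : γ = (1 + u) / (1 - u)) (hu : 1 - u ≠ 0)
    (hd : 2 - (2 - γ) * t ≠ 0) (ht : t ≠ 0) :
    (1 - u) ^ 2 * t * (2 - (2 - γ) * t) * eT 2 γ t a =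
      4 * (1 - t) ^ 2 * (1 - u) ^ 2 * t
      + (1 - a) * (1 - t) * ((5 - 8 * u + 11 * u ^ 2) * t - 2 * (1 - u) ^ 2)
      - 4 * u * (1 + u) * (1 - a) * t
      + (1 + 3 * u) * (1 - a) ^ 2 * t * ((1 + u) + (1 - 3 * u) * (1 - t)) := by
  have h1 : (2 - (2 - γ) * t) * eT 2 γ t a * t = t * (4 * (1 - t) ^ 2 -
      (1 - a) * (2 * γ ^ 2 - 2 * γ - (2 * γ ^ 2 - 3 * γ + 6) * (1 - t))
      + (2 * γ - 1) * (1 - a) ^ 2 * (γ + (2 - γ) * (1 - t))) - 2 * (1 - a) * (1 - t) := by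
    rw [eT, bT, lT, BT, kT, zT]; field_simp; ring
  calc _ = (1 - u) ^ 2 * ((2 - (2 - γ) * t) * eT 2 γ t a * t) := by ring
    _ = _ := by rw [h1, hγ]; field_simp; ring

/-- Put x = 1 - a, y = 1 - t. The possibly negative term is γx(γx - (γ-1)). As x and y are at least
(γ-1)/(γ+1), one has γx + y ≥ γ - 1, so the deficit is at most γxy, which the mixed terms absorb. -/
theorem eT_one_pos (hγ : 1 < γ) (ht : 0 < t) (ht1 : t < 1) (ha0 : 0 ≤ a) (ha1 : a < 1)
    (hau : γ - 1 ≤ (γ + 1) * (1 - a)) (htu : γ - 1 ≤ (γ + 1) * (1 - t)) : 0 < eT 1 γ t a := by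
  have hd := dT_pos hγ ht ht1
  refine pos_of_mul_pos_right (b := eT 1 γ t a) (a := 2 - (2 - γ) * t) ?_ hd.le
  rw [dT_mul_eT_one hd.ne' ht.ne']
  set x := 1 - a with hx
  set y := 1 - t with hy
  have hx0 : 0 < x := by linarith
  have hx1 : x ≤ 1 := by linarith
  have hy0 : 0 < y := by linarith
  have h1 : -(γ * y) ≤ γ * (γ * x - (γ - 1)) := by nlinarith
  have h2 : 0 < 2 - γ + γ ^ 2 - γ + γ * (2 - γ) * x := by nlinarith [sq_nonneg (γ - 1)]
  have h3 : 0 < x * y * (2 - γ + γ ^ 2 - γ + γ * (2 - γ) * x) := by positivity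
  have h4 : 0 ≤ x * (γ * (γ * x - (γ - 1)) + γ * y) := mul_nonneg hx0.le (by linarith)
  nlinarith [sq_nonneg y]

/-- The quadratic is concave in y, so only the ends of the range of y matter. The upper end
√(u(1+u)) suffices for u ≤ 9/20 but fails at u = 1/2; there the sharper bound 827/1000 takes over.
-/
theorem barrier_poly_aux {u y : ℝ} (hu : 0 < u) (hu1 : u ≤ 1 / 2)
    (hy1 : u * (1 + u / 4) ≤ y) (hy2 : y ^ 2 ≤ u * (1 + u)) (hy3 : u ≤ 9 / 20 ∨ y ≤ 827 / 1000) :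
    0 < -(9 - 8 * u + 7 * u ^ 2) * y ^ 2 + (7 + 9 * u ^ 2) * y + -(4 * u * (1 + u)) := by
  have hc : -(9 - 8 * u + 7 * u ^ 2) ≤ 0 := by nlinarith
  have h1 : 0 < -(9 - 8 * u + 7 * u ^ 2) * (u * (1 + u / 4)) ^ 2
      + (7 + 9 * u ^ 2) * (u * (1 + u / 4)) + -(4 * u * (1 + u)) := by
    have : -(9 - 8 * u + 7 * u ^ 2) * (u * (1 + u / 4)) ^ 2
      + (7 + 9 * u ^ 2) * (u * (1 + u / 4)) + -(4 * u * (1 + u)) =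
      u * (3 + u * (-45 / 4 + 25 / 2 * u - 21 / 16 * u ^ 2 - 3 * u ^ 3 - 7 / 16 * u ^ 4)) := by ring
    rw [this]
    apply mul_pos hu
    nlinarith [sq_nonneg (u - 2 / 5), mul_pos hu hu, mul_nonneg hu.le (sub_nonneg.2 hu1),
      mul_nonneg (mul_pos hu hu).le (sub_nonneg.2 hu1), pow_pos hu 3, pow_pos hu 4,
      mul_nonneg (pow_pos hu 3).le (sub_nonneg.2 hu1), mul_nonneg (pow_pos hu 4).le (sub_nonneg.2 hu1)]
  by_cases hcase : u ≤ 9 / 20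
  · set y₂ := √(u * (1 + u)) with hy₂
    have hy20 : 0 < y₂ := Real.sqrt_pos.2 (by positivity)
    have hsq : y₂ ^ 2 = u * (1 + u) := Real.sq_sqrt (by positivity)
    refine concave_quadratic_pos (y₂ := y₂) hc h1 ?_ hy1 (Real.le_sqrt_of_sq_le hy2)
    have h2 : -(9 - 8 * u + 7 * u ^ 2) * y₂ ^ 2 + (7 + 9 * u ^ 2) * y₂ + -(4 * u * (1 + u))
        = y₂ * ((7 + 9 * u ^ 2) - (13 - 8 * u + 7 * u ^ 2) * y₂) := by
      linear_combination 4 * hsq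
    rw [h2]
    refine mul_pos hy20 (sub_pos.2 ?_)
    have h3 : 0 < 13 - 8 * u + 7 * u ^ 2 := by nlinarith
    refine lt_of_pow_lt_pow_left₀ 2 (by positivity) ?_
    rw [mul_pow, hsq]
    -- Written in u and v = 9 - 20u, both nonnegative on the range, the polynomial has only positive
    -- coefficients.
    set v := 9 - 20 * u with hv
    have hv0 : 0 ≤ v := by linarith
    have : (7 + 9 * u ^ 2) ^ 2 - (13 - 8 * u + 7 * u ^ 2) ^ 2 * (u * (1 + u)) =
      49 / 531441 * v ^ 6 +
        1453 / 177147 * u ^ 1 * v ^ 5 +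
        51755 / 177147 * u ^ 2 * v ^ 4 +
        2797498 / 531441 * u ^ 3 * v ^ 3 +
        8662049 / 177147 * u ^ 4 * v ^ 2 +
        36082789 / 177147 * u ^ 5 * v ^ 1 +
        94851931 / 531441 * u ^ 6 := by
      rw [hv]; ring
    have h4 : 0 < (7 + 9 * u ^ 2) ^ 2 - (13 - 8 * u + 7 * u ^ 2) ^ 2 * (u * (1 + u)) := by
      rw [this]; positivity
    linarith
  · have hy4 : y ≤ 827 / 1000 := hy3.resolve_left hcase
    push Not at hcase
    refine concave_quadratic_pos (y₂ := 827 / 1000) hc h1 ?_ hy1 hy4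
    nlinarith

/-- With x = 1 - a and y = 1 - t this is a quadratic in x. Once the x² coefficient is lowered by
means of `h1`, the square (1-y)(2y(1-u) - (1+u)x)² splits off, and x times the quadratic of
`barrier_poly_aux` is left. -/
theorem eT_two_pos {u : ℝ} (hu : 0 < u) (hu1 : u ≤ 1 / 2) (hγ : γ = (1 + u) / (1 - u))
    (ht : 0 < t) (ht1 : t < 1) (ha1 : a < 1) (hy1 : u * (1 + u / 4) ≤ 1 - t)
    (hy2 : (1 - t) ^ 2 ≤ u * (1 + u)) (hy3 : u ≤ 9 / 20 ∨ 1 - t ≤ 827 / 1000) :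
    0 < eT 2 γ t a := by
  have hu2 : 0 < 1 - u := by linarith
  have hγ1 : 1 < γ := by rw [hγ, lt_div_iff₀ hu2]; linarith
  have hd := dT_pos hγ1 ht ht1
  have h0 : 0 < (1 - u) ^ 2 * t * (2 - (2 - γ) * t) := by positivity
  refine pos_of_mul_pos_right (b := eT 2 γ t a) (a := (1 - u) ^ 2 * t * (2 - (2 - γ) * t)) ?_ h0.le
  rw [dT_mul_eT_two hγ hu2.ne' hd.ne' ht.ne']
  have hf := barrier_poly_aux hu hu1 hy1 hy2 hy3
  obtain ⟨y, rfl⟩ : ∃ y, t = 1 - y := ⟨1 - t, by ring⟩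
  obtain ⟨x, rfl⟩ : ∃ x, a = 1 - x := ⟨1 - a, by ring⟩
  simp only [sub_sub_cancel] at *
  have hx : 0 < x := by linarith
  have hy : y < 1 := by linarith
  have hy0 : 0 < y := by linarith
  have h1 : (1 + u) ^ 2 ≤ (1 + 3 * u) * (1 + u + (1 - 3 * u) * y) := by
    rcases le_or_gt u (1 / 3) with h | h
    · nlinarith [mul_nonneg (sub_nonneg.2 h) hy0.le]
    · nlinarith [mul_nonneg (sub_nonneg.2 h.le) (sub_nonneg.2 hy.le)]
  have h2 : 0 < x * (-(9 - 8 * u + 7 * u ^ 2) * y ^ 2 + (7 + 9 * u ^ 2) * y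
      + -(4 * u * (1 + u))) := mul_pos hx hf
  have h3 : 0 ≤ (1 - y) * (2 * y * (1 - u) - (1 + u) * x) ^ 2 :=
    mul_nonneg (by linarith) (sq_nonneg _)
  have h4 : 0 ≤ x ^ 2 * (1 - y) * ((1 + 3 * u) * (1 + u + (1 - 3 * u) * y) - (1 + u) ^ 2) :=
    mul_nonneg (mul_nonneg (sq_nonneg _) (by linarith)) (by linarith)
  linarith

/-! ### The sign of `λ - B t` -/

theorem theta_formula {u : ℝ} (hγ : γ = (1 + u) / (1 - u)) (hu : 1 - u ≠ 0)
    (hd : 1 + u + (1 - 3 * u) * (1 - t) ≠ 0) :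
    (lT m γ t - BT m γ * t) * (1 - u) * (1 + u + (1 - 3 * u) * (1 - t)) =
      (1 - t - u) * (1 + u + (1 - 3 * u) * (1 - t))
        + m * t * ((1 - t) * (1 - u + 2 * u ^ 2) - u * (1 + u)) := by
  have h1 : zT γ t = t * (1 - t) * (1 - u) / (1 + u + (1 - 3 * u) * (1 - t)) := by
    have h2 : 2 - (2 - γ) * t = (1 + u + (1 - 3 * u) * (1 - t)) / (1 - u) := by
      rw [hγ]; field_simp; ring
    rw [zT, h2]; field_simp
  have h1' : zT γ t * (1 + u + (1 - 3 * u) * (1 - t)) = t * (1 - t) * (1 - u) := by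
    rw [h1, div_mul_cancel₀ _ hd]
  have hγ' : γ * (1 - u) = 1 + u := by rw [hγ]; field_simp
  rw [lT, BT]
  linear_combination (m * γ * (1 - u)) * h1' + (m * t * (1 - t) * (1 - u)
    - (1 + m) / 2 * t * (1 + u + (1 - 3 * u) * (1 - t))) * hγ'

theorem theta_den_pos {u : ℝ} (hu : 0 < u) (hu1 : u ≤ 1 / 2) (ht : 0 < t) (ht1 : t < 1) :
    0 < 1 + u + (1 - 3 * u) * (1 - t) := by nlinarith

/-- After clearing denominators the expression is concave in 1 - t, so the ends 5u/4 and 1 decide.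
-/
theorem theta_pos_of_lt {u : ℝ} (hm : m = 1 ∨ m = 2) (hu : 0 < u) (hu1 : u ≤ 1 / 2)
    (hγ : γ = (1 + u) / (1 - u)) (ht : 0 < t) (ht1 : t < 1) (h : 5 * u ≤ 4 * (1 - t)) :
    0 < lT m γ t - BT m γ * t := by
  have hu2 : 0 < 1 - u := by linarith
  have hd := theta_den_pos hu hu1 ht ht1
  have hf := theta_formula (m := m) hγ hu2.ne' hd.ne'
  obtain ⟨y, rfl⟩ : ∃ y, t = 1 - y := ⟨1 - t, by ring⟩
  simp only [sub_sub_cancel] at *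
  have hy : 0 < y := by linarith
  suffices hS : 0 < (y - u) * (1 + u + (1 - 3 * u) * y)
      + m * (1 - y) * (y * (1 - u + 2 * u ^ 2) - u * (1 + u)) by
    rw [← hf, mul_assoc] at hS
    exact pos_of_mul_pos_left hS (mul_pos hu2 hd).le
  have e : ∀ y, (y - u) * (1 + u + (1 - 3 * u) * y)
      + m * (1 - y) * (y * (1 - u + 2 * u ^ 2) - u * (1 + u)) =
      ((1 - 3 * u) - m * (1 - u + 2 * u ^ 2)) * y ^ 2
      + (1 + u - u * (1 - 3 * u) + m * (1 + 3 * u ^ 2)) * y + -((1 + m) * u * (1 + u)) := by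
    intro y; ring
  have hc : (1 - 3 * u) - m * (1 - u + 2 * u ^ 2) ≤ 0 := by
    rcases hm with rfl | rfl <;> nlinarith
  rw [e]
  refine concave_quadratic_pos (y₁ := 5 / 4 * u) (y₂ := 1) hc ?_ ?_ (by linarith) (by linarith)
  · rw [← e]
    rcases hm with rfl | rfl
    · have : (5 / 4 * u - u) * (1 + u + (1 - 3 * u) * (5 / 4 * u)) + 1 * (1 - 5 / 4 * u) *
        (5 / 4 * u * (1 - u + 2 * u ^ 2) - u * (1 + u)) =
        u * (1 / 2 - 2 * u + 35 / 8 * u ^ 2 - 25 / 8 * u ^ 3) := by ring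
      rw [this]
      apply mul_pos hu
      nlinarith [sq_nonneg (u - 1 / 3), mul_nonneg (mul_pos hu hu).le (sub_nonneg.2 hu1)]
    · have : (5 / 4 * u - u) * (1 + u + (1 - 3 * u) * (5 / 4 * u)) + 2 * (1 - 5 / 4 * u) *
        (5 / 4 * u * (1 - u + 2 * u ^ 2) - u * (1 + u)) =
        u * (3 / 4 - 73 / 16 * u + 155 / 16 * u ^ 2 - 25 / 4 * u ^ 3) := by ring
      rw [this]
      apply mul_pos hu
      nlinarith [sq_nonneg (u - 4 / 11), mul_nonneg (sq_nonneg (u - 4 / 11)) (sub_nonneg.2 hu1)]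
  · rw [← e]; nlinarith

/-- Read contrapositively, λ ≥ B t provides the lower bound for 1 - t that `eT_two_pos` requires. -/
theorem theta_neg_two {u : ℝ} (hu : 0 < u) (hu1 : u ≤ 1 / 2)
    (hγ : γ = (1 + u) / (1 - u)) (ht : 0 < t) (ht1 : t < 1) (h : 1 - t < u * (1 + u / 4)) :
    lT 2 γ t - BT 2 γ * t < 0 := by
  have hu2 : 0 < 1 - u := by linarith
  have hd := theta_den_pos hu hu1 ht ht1
  have hf := theta_formula (m := 2) hγ hu2.ne' hd.ne'
  by_contra hcon
  push Not at hcon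
  have h1 : 0 ≤ (lT 2 γ t - BT 2 γ * t) * (1 - u) * (1 + u + (1 - 3 * u) * (1 - t)) := by positivity
  rw [hf] at h1
  obtain ⟨y, rfl⟩ : ∃ y, t = 1 - y := ⟨1 - t, by ring⟩
  simp only [sub_sub_cancel] at *
  set y₁ := u * (1 + u / 4) with hy₁
  have hy1u : y₁ ≤ 9 / 16 := by rw [hy₁]; nlinarith
  have h2 : (y₁ - u) * (1 + u + (1 - 3 * u) * y₁)
        + 2 * (1 - y₁) * (y₁ * (1 - u + 2 * u ^ 2) - u * (1 + u)) < 0 := by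
    have : (y₁ - u) * (1 + u + (1 - 3 * u) * y₁)
        + 2 * (1 - y₁) * (y₁ * (1 - u + 2 * u ^ 2) - u * (1 + u)) =
        u ^ 2 * (-13 / 4 + 15 / 2 * u - 37 / 16 * u ^ 2 - 33 / 16 * u ^ 3 - u ^ 4 / 4) := by
      rw [hy₁]; ring
    rw [this]
    apply mul_neg_of_pos_of_neg (by positivity)
    nlinarith [pow_pos hu 3, pow_pos hu 4, mul_nonneg hu.le (sub_nonneg.2 hu1), sq_nonneg (u - 1 / 2)]
  have h3 : 0 ≤ (y₁ - y) * (3 + 9 * u ^ 2 - (1 + u + 4 * u ^ 2) * (y₁ + y)) := by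
    apply mul_nonneg (by linarith)
    nlinarith [mul_pos hu hu]
  nlinarith

end ShockODE

namespace ShockODE

/-! ### Properties of orbits through a triple point

An orbit is described by `Y = C²` as a function of `a = -V`. -/

/-- The function `G` in terms of `a = -V` and `Y = C²`, for `z = zT γ t`. -/
noncomputable def GT (m γ t a Y : ℝ) : ℝ := Y * (2 * m * zT γ t - (m + 1) * a) + a * (1 - a) * (lT m γ t - a)

/-- The right-hand side of the equation for `Y = C²` as a function of `a = -V`. -/
noncomputable def slopeT (m γ t a Y : ℝ) : ℝ :=
  2 * Y / (1 - a) * ((γ - 1) / 2 + (lT m γ t - BT m γ * a) * ((1 - a) ^ 2 - Y) / GT m γ t a Y)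

/-- `Y` is an increasing solution on `(0, 2 / (γ + 1)]` which starts at the post-shock point and
crosses the sonic line at the triple point `a = t`. -/
structure SonicOrbit (m γ t : ℝ) (Y : ℝ → ℝ) : Prop where
  t_pos : 0 < t
  t_lt : t < 2 / (γ + 1)
  pos : ∀ a ∈ Ioc 0 (2 / (γ + 1)), 0 < Y a
  mono : StrictMonoOn Y (Ioc 0 (2 / (γ + 1)))
  diff : ∀ a ∈ Ioc 0 (2 / (γ + 1)), DifferentiableAt ℝ Y a
  cont_deriv : ContinuousAt (deriv Y) t
  at_t : Y t = (1 - t) ^ 2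
  start : Y (2 / (γ + 1)) = γ * (γ - 1) / (γ + 1) * (2 / (γ + 1))
  sonic_left : ∀ a ∈ Ioc t (2 / (γ + 1)), (1 - a) ^ 2 < Y a
  sonic_right : ∀ a ∈ Ioo 0 t, Y a < (1 - a) ^ 2
  G_left : ∀ a ∈ Ioc t (2 / (γ + 1)), GT m γ t a (Y a) < 0
  G_right : ∀ a ∈ Ioo 0 t, 0 < GT m γ t a (Y a)
  ode : ∀ a ∈ Ioc 0 (2 / (γ + 1)), a ≠ t → HasDerivAt Y (slopeT m γ t a (Y a)) a

variable {m γ t a : ℝ} {Y : ℝ → ℝ}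

theorem gamma_eq_of_u (hγ : 1 < γ) :
    γ = (1 + (γ - 1) / (γ + 1)) / (1 - (γ - 1) / (γ + 1)) := by
  have : γ + 1 ≠ 0 := by linarith
  have h : 1 - (γ - 1) / (γ + 1) = 2 / (γ + 1) := by field_simp; ring
  rw [h]; field_simp; ring

theorem u_mem (hγ : 1 < γ) (hγ3 : γ ≤ 3) : 0 < (γ - 1) / (γ + 1) ∧ (γ - 1) / (γ + 1) ≤ 1 / 2 := by
  have : 0 < γ + 1 := by linarith
  refine ⟨div_pos (by linarith) this, ?_⟩
  rw [div_le_iff₀ this]; linarith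

theorem one_sub_u (hγ : 1 < γ) : 2 / (γ + 1) = 1 - (γ - 1) / (γ + 1) := by
  have : γ + 1 ≠ 0 := by linarith
  field_simp; ring

theorem start_eq (hγ : 1 < γ) : γ * (γ - 1) / (γ + 1) * (2 / (γ + 1)) =
    (γ - 1) / (γ + 1) * (1 + (γ - 1) / (γ + 1)) := by
  have : γ + 1 ≠ 0 := by linarith
  field_simp; ring

theorem two_div_lt_one (hγ : 1 < γ) : 2 / (γ + 1) < 1 := by
  rw [div_lt_one (by linarith)]; linarith

/-- If `λ ≤ B t` then an orbit through the triple point ends below the post-shock point. -/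
theorem end_lt_of_theta_nonpos (hm : m = 1 ∨ m = 2) (hγ : 1 < γ) (hγ3 : γ ≤ 3) (ht : 0 < t)
    (hta : t < 2 / (γ + 1)) (hθ : lT m γ t - BT m γ * t ≤ 0) (hY0 : Y t = (1 - t) ^ 2)
    (hc : ContinuousOn Y (Icc t (2 / (γ + 1))))
    (hode : ∀ a ∈ Ioo t (2 / (γ + 1)), HasDerivAt Y (slopeT m γ t a (Y a)) a)
    (hD : ∀ a ∈ Ioo t (2 / (γ + 1)), (1 - a) ^ 2 < Y a)
    (hG : ∀ a ∈ Ioo t (2 / (γ + 1)), GT m γ t a (Y a) < 0) :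
    Y (2 / (γ + 1)) < γ * (γ - 1) / (γ + 1) * (2 / (γ + 1)) := by
  obtain ⟨hu, hu1⟩ := u_mem hγ hγ3
  have hγu := gamma_eq_of_u hγ
  have ha1 := one_sub_u hγ
  have hst := start_eq hγ
  set u := (γ - 1) / (γ + 1) with hu'
  have ht1 : t < 1 := hta.trans (two_div_lt_one hγ)
  have h54 : 4 * (1 - t) < 5 * u := by
    by_contra h'
    have := theta_pos_of_lt hm hu hu1 hγu ht ht1 (not_lt.1 h')
    linarith
  have hB : 0 < BT m γ := by
    rw [BT]; rcases hm with rfl | rfl <;> linarith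
  -- For γ ≤ 3 and λ - B a ≤ 0 both contributions to the derivative of Y(1-a)² are nonpositive.
  -- Comparing the ends gives u³(1+u) ≤ (5u/4)⁴ if Y reached the post-shock value, which is false
  -- for u ≤ 1/2.
  have hanti : AntitoneOn (fun a => Y a * (1 - a) ^ 2) (Icc t (2 / (γ + 1))) := by
    refine antitoneOn_of_hasDerivWithinAt_nonpos (convex_Icc _ _)
      (f' := fun a => slopeT m γ t a (Y a) * (1 - a) ^ 2 + Y a * (2 * (1 - a) * (-1))) ?_ ?_ ?_
    · exact hc.mul (by fun_prop)
    · intro a ha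
      rw [interior_Icc] at ha
      have h2 : HasDerivAt (fun a : ℝ => (1 - a) ^ 2) (2 * (1 - a) * (-1)) a := by
        simpa using (((hasDerivAt_id' a).const_sub 1).fun_pow 2)
      exact ((hode a ha).mul h2).hasDerivWithinAt
    · intro a ha
      rw [interior_Icc] at ha
      have hr : 0 < ((1 - a) ^ 2 - Y a) / GT m γ t a (Y a) :=
        div_pos_of_neg_of_neg (sub_neg.2 (hD a ha)) (hG a ha)
      have h1a : 0 < 1 - a := by linarith [ha.2, two_div_lt_one hγ]
      have hY : 0 < Y a := lt_trans (by positivity) (hD a ha)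
      have e : slopeT m γ t a (Y a) * (1 - a) ^ 2 + Y a * (2 * (1 - a) * (-1)) =
          2 * Y a * (1 - a) * ((γ - 3) / 2 + (lT m γ t - BT m γ * a) *
            (((1 - a) ^ 2 - Y a) / GT m γ t a (Y a))) := by
        rw [slopeT]; field_simp; ring
      rw [e]
      have h3 : lT m γ t - BT m γ * a ≤ 0 := by nlinarith [ha.1]
      have h4 := mul_nonpos_of_nonpos_of_nonneg h3 hr.le
      exact mul_nonpos_of_nonneg_of_nonpos (by positivity) (by linarith)
  have h5 := hanti ⟨le_rfl, hta.le⟩ ⟨hta.le, le_rfl⟩ hta.le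
  beta_reduce at h5
  rw [hY0] at h5
  rw [hst]
  by_contra hcon
  push Not at hcon
  have h5' : u * (1 + u) * u ^ 2 ≤ (1 - t) ^ 2 * (1 - t) ^ 2 := by
    refine le_trans ?_ h5
    rw [show 1 - 2 / (γ + 1) = u by rw [ha1]; ring]
    gcongr
  have hy : 0 < 1 - t := by linarith
  have h6 : (1 - t) ^ 2 * (1 - t) ^ 2 ≤ (5 / 4 * u) ^ 2 * (5 / 4 * u) ^ 2 := by
    gcongr <;> linarith
  have h7 : u ^ 3 * (1 + u - 625 / 256 * u) ≤ 0 := by nlinarith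
  have h8 : 0 < u ^ 3 * (1 + u - 625 / 256 * u) := mul_pos (by positivity) (by linarith)
  linarith

namespace SonicOrbit

theorem t_lt_one (h : SonicOrbit m γ t Y) (hγ : 1 < γ) : t < 1 :=
  h.t_lt.trans (two_div_lt_one hγ)

theorem continuousOn (h : SonicOrbit m γ t Y) : ContinuousOn Y (Ioc 0 (2 / (γ + 1))) :=
  fun a ha => (h.diff a ha).continuousAt.continuousWithinAt

theorem a₁_mem (h : SonicOrbit m γ t Y) : 2 / (γ + 1) ∈ Ioc 0 (2 / (γ + 1)) :=
  ⟨h.t_pos.trans h.t_lt, le_rfl⟩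

theorem one_sub_sq_lt (h : SonicOrbit m γ t Y) (hγ : 1 < γ) :
    (1 - t) ^ 2 < (γ - 1) / (γ + 1) * (1 + (γ - 1) / (γ + 1)) := by
  rw [← start_eq hγ, ← h.start, ← h.at_t]
  exact h.mono ⟨h.t_pos, h.t_lt.le⟩ h.a₁_mem h.t_lt

theorem ratio_left_pos (h : SonicOrbit m γ t Y) (ha : a ∈ Ioc t (2 / (γ + 1))) :
    0 < ((1 - a) ^ 2 - Y a) / GT m γ t a (Y a) :=
  div_pos_of_neg_of_neg (sub_neg.2 (h.sonic_left a ha)) (h.G_left a ha)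

/-- Otherwise `end_lt_of_theta_nonpos` contradicts the starting value. -/
theorem theta_pos (h : SonicOrbit m γ t Y) (hm : m = 1 ∨ m = 2) (hγ : 1 < γ) (hγ3 : γ ≤ 3) :
    0 < lT m γ t - BT m γ * t := by
  by_contra hcon
  have hsub : ∀ a ∈ Ioo t (2 / (γ + 1)), a ∈ Ioc t (2 / (γ + 1)) := fun a ha => ⟨ha.1, ha.2.le⟩
  have := end_lt_of_theta_nonpos hm hγ hγ3 h.t_pos h.t_lt (not_lt.1 hcon) h.at_t
    (h.continuousOn.mono fun a ha => ⟨h.t_pos.trans_le ha.1, ha.2⟩)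
    (fun a ha => h.ode a ⟨h.t_pos.trans ha.1, ha.2.le⟩ ha.1.ne')
    (fun a ha => h.sonic_left a (hsub a ha)) (fun a ha => h.G_left a (hsub a ha))
  exact this.ne h.start

/-- Here γ ≥ 2, so Y(1-a) is nondecreasing as long as λ - B a ≥ 0. From t to s = 1/B this gives
(1-t)³ ≤ Y(s)(1-s) ≤ 9/16, just below 0.827³. -/
theorem barrier_corner (h : SonicOrbit 2 γ t Y) (hγ : 1 < γ) (hγ3 : γ ≤ 3)
    (hu : 9 / 20 < (γ - 1) / (γ + 1)) : 1 - t ≤ 827 / 1000 := by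
  obtain ⟨hu0, hu1⟩ := u_mem hγ hγ3
  have hγu := gamma_eq_of_u hγ
  have ha1 := one_sub_u hγ
  have hst := start_eq hγ
  have ht1 := h.t_lt_one hγ
  have hγ2 : 2 ≤ γ := by
    rw [lt_div_iff₀ (by linarith)] at hu; linarith
  have hl := one_lt_lT two_pos hγ h.t_pos ht1
  set u := (γ - 1) / (γ + 1) with hu'
  have h1u : 0 < 1 - u := by linarith
  have hB : BT 2 γ = (1 + 2 * u) / (1 - u) := by rw [BT, hγu]; field_simp; ring
  by_contra hcon
  push Not at hcon
  -- s = 1/B, so that λ - B a ≥ λ - 1 > 0 up to s.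
  set s := (1 - u) / (1 + 2 * u) with hs
  have hs1 : s < 2 / (γ + 1) := by
    rw [ha1, hs]; exact div_lt_self h1u (by linarith)
  have hts : t < s := by
    rw [hs, lt_div_iff₀ (by linarith)]; nlinarith
  have hsub : Icc t s ⊆ Ioc 0 (2 / (γ + 1)) :=
    fun a ha => ⟨h.t_pos.trans_le ha.1, ha.2.trans hs1.le⟩
  have hmono : MonotoneOn (fun a => Y a * (1 - a)) (Icc t s) := by
    refine monotoneOn_of_hasDerivWithinAt_nonneg (convex_Icc _ _)
      (f' := fun a => slopeT 2 γ t a (Y a) * (1 - a) + Y a * (-1)) ?_ ?_ ?_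
    · exact (h.continuousOn.mono hsub).mul (by fun_prop)
    · intro a ha
      rw [interior_Icc] at ha
      exact ((h.ode a (hsub (Ioo_subset_Icc_self ha)) ha.1.ne').mul
        (by simpa using (hasDerivAt_id a).const_sub 1)).hasDerivWithinAt
    · intro a ha
      rw [interior_Icc] at ha
      have hr := h.ratio_left_pos ⟨ha.1, ha.2.le.trans hs1.le⟩
      have hY := h.pos a (hsub (Ioo_subset_Icc_self ha))
      have h1a : 0 < 1 - a := by linarith [ha.2, two_div_lt_one hγ]
      have e : slopeT 2 γ t a (Y a) * (1 - a) + Y a * (-1) =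
          Y a * (γ - 2 + 2 * ((lT 2 γ t - BT 2 γ * a) *
            (((1 - a) ^ 2 - Y a) / GT 2 γ t a (Y a)))) := by
        rw [slopeT]; field_simp; ring
      rw [e]
      have h3 : 0 ≤ lT 2 γ t - BT 2 γ * a := by
        have : BT 2 γ * a ≤ BT 2 γ * s := by
          have : 0 < BT 2 γ := by rw [BT]; linarith
          exact mul_le_mul_of_nonneg_left ha.2.le this.le
        have h4 : BT 2 γ * s = 1 := by
          rw [hB, hs]; field_simp
        linarith
      have h4 := mul_nonneg h3 hr.le
      exact mul_nonneg hY.le (by linarith)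
  have h5 := hmono ⟨le_rfl, hts.le⟩ ⟨hts.le, le_rfl⟩ hts.le
  have h6 : Y s < u * (1 + u) := by
    rw [← hst, ← h.start]
    exact h.mono (hsub ⟨hts.le, le_rfl⟩) h.a₁_mem hs1
  simp only [h.at_t] at h5
  have h7 : 1 - s = 3 * u / (1 + 2 * u) := by rw [hs]; field_simp; ring
  have h8 : 1 - s ≤ 3 / 4 := by
    rw [h7, div_le_iff₀ (by linarith)]; linarith
  have h8' : 0 < 1 - s := by rw [h7]; positivity
  have h9 : (827 / 1000) ^ 2 * (827 / 1000) ≤ (1 - t) ^ 2 * (1 - t) := by gcongr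
  have h10 : Y s * (1 - s) ≤ (3 / 4) * (3 / 4) := by
    apply mul_le_mul _ h8 h8'.le (by norm_num)
    nlinarith
  norm_num at h9 h10
  linarith

/-- The a priori bounds on t: the lower bound for 1 - t comes from λ > B t, the upper one from the
monotonicity of Y and, near γ = 3, from `barrier_corner`. -/
theorem eT_pos (h : SonicOrbit m γ t Y) (hm : m = 1 ∨ m = 2) (hγ : 1 < γ) (hγ3 : γ ≤ 3)
    (ha0 : 0 ≤ a) (ha1 : a ≤ 2 / (γ + 1)) : 0 < eT m γ t a := by
  obtain ⟨hu0, hu1⟩ := u_mem hγ hγ3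
  have ht1 := h.t_lt_one hγ
  have ha2 := ha1.trans_lt (two_div_lt_one hγ)
  have hθ := h.theta_pos hm hγ hγ3
  have key : ∀ x ≤ 2 / (γ + 1), γ - 1 ≤ (γ + 1) * (1 - x) := by
    intro x hx
    rw [le_div_iff₀ (by linarith)] at hx; linarith
  rcases hm with rfl | rfl
  · exact eT_one_pos hγ h.t_pos ht1 ha0 ha2 (key _ ha1) (key _ h.t_lt.le)
  · refine eT_two_pos hu0 hu1 (gamma_eq_of_u hγ) h.t_pos ht1 ha2 ?_ (h.one_sub_sq_lt hγ).le ?_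
    · by_contra hcon
      have := theta_neg_two hu0 hu1 (gamma_eq_of_u hγ) h.t_pos ht1 (not_le.1 hcon)
      linarith
    · rcases le_or_gt ((γ - 1) / (γ + 1)) (9 / 20) with h' | h'
      · exact Or.inl h'
      · exact Or.inr (h.barrier_corner hγ hγ3 h')

end SonicOrbit

end ShockODE

namespace ShockODE

variable {m γ t a : ℝ} {Y : ℝ → ℝ}

/-! ### Barriers -/

/-- The quadratic in η is convex and negative at 0. For η ≤ 0 it remains negative as long as both
affine factors are positive, so a root with these signs is positive. The identity proving this
depends on which factor vanishes first. -/
theorem root_pos_of_convex_quadratic {α β c k c₀ c₁ t η : ℝ} (ht : 0 < t) (hc : 0 < c) (hk : 0 < k)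
    (hc₁ : 0 < c₁) (hα : 0 < α) (hβ : 0 < β) (hn : 0 < α + t * η) (hp : 0 < β + c * η)
    (hroot : η * (β + c * η) = k * (c₀ * (β + c * η) + c₁ * (α + t * η)))
    (h0 : 0 < c₀ * β + c₁ * α) (h1 : 0 < α + t * (k * c₀)) : 0 < η := by
  by_contra hη
  push Not at hη
  rcases le_or_gt (α * c) (t * β) with h | h
  · have e : α * (η * (β + c * η) - k * (c₀ * (β + c * η) + c₁ * (α + t * η))) * t =
        -(α + t * η) * t * (k * (c₀ * β + c₁ * α))
        - (-η) * ((α + t * (k * c₀)) * (t * β - α * c)) - c * (-η) * (α + t * η) * α := by ring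
    have h2 : 0 < (α + t * η) * t * (k * (c₀ * β + c₁ * α)) := by positivity
    have h3 : 0 ≤ (-η) * ((α + t * (k * c₀)) * (t * β - α * c)) :=
      mul_nonneg (by linarith) (mul_nonneg h1.le (by linarith))
    have h4 : 0 ≤ c * (-η) * (α + t * η) * α :=
      mul_nonneg (mul_nonneg (mul_nonneg hc.le (by linarith)) hn.le) hα.le
    rw [hroot, sub_self, mul_zero, zero_mul] at e
    linarith
  · have e : β * (η * (β + c * η) - k * (c₀ * (β + c * η) + c₁ * (α + t * η))) =
        -(β + c * η) * (k * (c₀ * β + c₁ * α))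
        - (-η) * (k * c₁ * (α * c - t * β)) - β * (-η) * (β + c * η) := by ring
    have h2 : 0 < (β + c * η) * (k * (c₀ * β + c₁ * α)) := by positivity
    have h3 : 0 ≤ (-η) * (k * c₁ * (α * c - t * β)) :=
      mul_nonneg (by linarith) (mul_nonneg (by positivity) (by linarith))
    have h4 : 0 ≤ β * (-η) * (β + c * η) :=
      mul_nonneg (mul_nonneg hβ.le (by linarith)) hp.le
    rw [hroot, sub_self, mul_zero] at e
    linarith

/-- The triple point lies on `G = 0`. -/
theorem one_sub_mul_cT (hγ : 1 < γ) (ht : 0 < t) (ht1 : t < 1) :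
    (1 - t) * cT m γ t t = t * (lT m γ t - t) := by
  have hd := (dT_pos hγ ht ht1).ne'
  have hz : zT γ t * (2 - (2 - γ) * t) = t * (1 - t) := div_mul_cancel₀ _ hd
  rw [cT, lT]; linear_combination (-m) * hz

theorem GT_at (hγ : 1 < γ) (ht : 0 < t) (ht1 : t < 1) : GT m γ t t ((1 - t) ^ 2) = 0 := by
  have := one_sub_mul_cT (m := m) hγ ht ht1
  rw [cT] at this
  rw [GT]; linear_combination (-(1 - t)) * this

/-- `G` on the curve `κ = kT t + (a - t) η`. -/
theorem GT_eq (hγ : 1 < γ) (ht : 0 < t) (ht1 : t < 1) (a η : ℝ) :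
    GT m γ t a ((kT t + (a - t) * η) * a) = -(a * (a - t) * denT m γ t a η) := by
  have h1 := one_sub_mul_cT (m := m) hγ ht ht1
  have hk : kT t * t = (1 - t) ^ 2 := div_mul_cancel₀ _ ht.ne'
  have hb : bT m γ t * t = lT m γ t + 2 * kT t * m * zT γ t := div_mul_cancel₀ _ ht.ne'
  have h2 : t * (kT t * cT m γ t t) = t * ((1 - t) * (lT m γ t - t)) := by
    linear_combination (cT m γ t t) * hk + (1 - t) * h1
  have h3 := mul_left_cancel₀ ht.ne' h2
  rw [cT] at h3
  have h4 : bT m γ t = (m + 1) * kT t + 1 + lT m γ t - t := by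
    apply mul_left_cancel₀ ht.ne'
    linear_combination hb - h3
  rw [GT, denT, cT]
  linear_combination (-a) * hb + a ^ 2 * h4

theorem sonic_eq (ht : 0 < t) (a η : ℝ) :
    (1 - a) ^ 2 - (kT t + (a - t) * η) * a = -((a - t) * numT t a η) := by
  rw [kT, numT]; field_simp; ring

/-- The factor a - t common to D and G on the line cancels, which leaves an expression with the sign
of `eT`. -/
theorem slopeT_sub_kT (hm : 0 < m) (hγ : 1 < γ) (ht : 0 < t) (ht1 : t < 1) (ha : 0 < a) (ha1 : a < 1)
    (hat : a ≠ t) : slopeT m γ t a (kT t * a) - kT t =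
      kT t * eT m γ t a / ((1 - a) * (bT m γ t - a)) := by
  have h1 := GT_eq (m := m) hγ ht ht1 a 0
  have h2 := sonic_eq ht a 0
  rw [mul_zero, add_zero] at h1 h2
  have hb : 0 < bT m γ t - a := by
    have := one_div_lt_bT hm hγ ht ht1
    have := one_lt_one_div ht ht1
    linarith
  have hat' : a - t ≠ 0 := sub_ne_zero.2 hat
  have h1a : 1 - a ≠ 0 := by linarith
  rw [slopeT, h1, h2, denT, zero_mul, add_zero, numT, mul_zero, add_zero, eT]
  generalize 1 / t = i
  have hb' := hb.ne'
  have hane := ha.ne'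
  have : (lT m γ t - BT m γ * a) * -((a - t) * (i - a)) / -(a * (a - t) * (bT m γ t - a)) =
      (lT m γ t - BT m γ * a) * (i - a) / (a * (bT m γ t - a)) := by
    rw [div_eq_div_iff (by simp [hane, hat', hb']) (by positivity)]; ring
  rw [this]
  generalize bT m γ t - a = b at *
  generalize lT m γ t - BT m γ * a = l at *
  field_simp
  ring

namespace SonicOrbit

theorem deriv_nonneg (h : SonicOrbit m γ t Y) : 0 ≤ deriv Y t := by
  have hd := (h.diff t ⟨h.t_pos, h.t_lt.le⟩).hasDerivAt.tendsto_slope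
  have hd' := hd.mono_left (nhdsWithin_mono _ (fun y (hy : y ∈ Ioi t) => ne_of_gt hy))
  refine ge_of_tendsto hd' ?_
  filter_upwards [Ioc_mem_nhdsGT h.t_lt] with a ha
  rw [slope_def_field]
  exact div_nonneg (sub_nonneg.2 (h.mono ⟨h.t_pos, h.t_lt.le⟩ ⟨h.t_pos.trans ha.1, ha.2⟩ ha.1).le)
    (sub_nonneg.2 ha.1.le)

theorem hasDerivAt_GT (h : SonicOrbit m γ t Y) (hγ : 1 < γ) :
    HasDerivAt (fun a => GT m γ t a (Y a))
      (-(t * (bT m γ t - t) + (deriv Y t - kT t) * cT m γ t t)) t := by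
  have ht := h.t_pos
  have hY := (h.diff t ⟨h.t_pos, h.t_lt.le⟩).hasDerivAt
  have h1 : HasDerivAt (fun a => GT m γ t a (Y a))
      (deriv Y t * (2 * m * zT γ t - (m + 1) * t) + Y t * (-(m + 1))
        + (((1 - t) + t * (-1)) * (lT m γ t - t) + t * (1 - t) * (-1))) t := by
    have e1 : HasDerivAt (fun a : ℝ => 2 * m * zT γ t - (m + 1) * a) (-(m + 1)) t := by
      simpa using ((hasDerivAt_id' t).const_mul (m + 1)).const_sub (2 * m * zT γ t)
    have e2 : HasDerivAt (fun a : ℝ => a * (1 - a)) ((1 - t) + t * (-1)) t := by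
      simpa using (hasDerivAt_id' t).fun_mul ((hasDerivAt_id' t).const_sub 1)
    have e3 : HasDerivAt (fun a : ℝ => lT m γ t - a) (-1) t := by
      simpa using (hasDerivAt_id' t).const_sub (lT m γ t)
    exact (hY.mul e1).add (e2.mul e3)
  convert h1 using 1
  have h2 := one_sub_mul_cT (m := m) hγ ht (h.t_lt_one hγ)
  have hk : kT t * t = (1 - t) ^ 2 := div_mul_cancel₀ _ ht.ne'
  have hb : bT m γ t * t = lT m γ t + 2 * kT t * m * zT γ t := div_mul_cancel₀ _ ht.ne'
  have h3 : t * (kT t * cT m γ t t) = t * ((1 - t) * (lT m γ t - t)) := by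
    linear_combination (cT m γ t t) * hk + (1 - t) * h2
  have h4 := mul_left_cancel₀ ht.ne' h3
  rw [h.at_t]
  rw [cT] at h4 ⊢
  linear_combination (-1) * hb + 2 * h4 - (m + 1) * hk

/-- The slopes possible at the triple point solve a quadratic. The signs of D and G along the orbit
make numerator and denominator positive, and `root_pos_of_convex_quadratic` then excludes the root
below the barrier slope. -/
theorem kT_lt_deriv (h : SonicOrbit m γ t Y) (hm : m = 1 ∨ m = 2) (hγ : 1 < γ) (hγ3 : γ ≤ 3) :
    kT t < deriv Y t := by
  have ht := h.t_pos
  have ht1 := h.t_lt_one hγ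
  have hm0 : 0 < m := by rcases hm with rfl | rfl <;> norm_num
  have hθ := h.theta_pos hm hγ hγ3
  have hs := h.deriv_nonneg
  have hG := h.hasDerivAt_GT hγ
  have hk := kT_pos ht ht1
  have hc := cT_pos hm0 hγ ht ht1 le_rfl
  have hb := one_div_lt_bT hm0 hγ ht ht1
  have hti := one_lt_one_div ht ht1
  have hE := h.eT_pos hm hγ hγ3 ht.le h.t_lt.le
  have hY := (h.diff t ⟨h.t_pos, h.t_lt.le⟩).hasDerivAt
  set s := deriv Y t with hs'
  set g := -(t * (bT m γ t - t) + (s - kT t) * cT m γ t t) with hg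
  have hy : 0 < 1 - t := by linarith
  have hg0 : g ≤ 0 := by
    refine le_of_tendsto (hG.tendsto_slope.mono_left
      (nhdsWithin_mono _ (fun y (hy : y ∈ Ioi t) => ne_of_gt hy))) ?_
    filter_upwards [Ioc_mem_nhdsGT h.t_lt] with a ha
    rw [slope_def_field, h.at_t, GT_at hγ ht ht1, sub_zero]
    exact div_nonpos_of_nonpos_of_nonneg (h.G_left a ha).le (sub_nonneg.2 ha.1.le)
  have hD : HasDerivAt (fun a => (1 - a) ^ 2 - Y a) (2 * (1 - t) * (-1) - s) t := by
    have : HasDerivAt (fun a : ℝ => (1 - a) ^ 2) (2 * (1 - t) * (-1)) t := by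
      simpa using (((hasDerivAt_id' t).const_sub 1).fun_pow 2)
    exact this.sub hY
  -- L'Hôpital at the triple point: the equation times G, divided by a - t, in the limit a → t.
  have hlim : (1 - t) * s * g = 2 * (1 - t) ^ 2 * ((γ - 1) / 2 * g
      + (lT m γ t - BT m γ * t) * (2 * (1 - t) * (-1) - s)) := by
    have t0 : Tendsto (fun a : ℝ => a) (𝓝[≠] t) (𝓝 t) := tendsto_id.mono_left nhdsWithin_le_nhds
    have t1 : Tendsto (fun a : ℝ => 1 - a) (𝓝[≠] t) (𝓝 (1 - t)) := t0.const_sub 1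
    have t2 : Tendsto (deriv Y) (𝓝[≠] t) (𝓝 s) := h.cont_deriv.tendsto.mono_left nhdsWithin_le_nhds
    have t3 : Tendsto Y (𝓝[≠] t) (𝓝 ((1 - t) ^ 2)) := by
      rw [← h.at_t]; exact hY.continuousAt.tendsto.mono_left nhdsWithin_le_nhds
    have t4 := hG.tendsto_slope
    have t5 := hD.tendsto_slope
    have t6 : Tendsto (fun a => lT m γ t - BT m γ * a) (𝓝[≠] t) (𝓝 (lT m γ t - BT m γ * t)) :=
      (t0.const_mul _).const_sub _
    have L := (t1.mul t2).mul t4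
    have R := (t3.const_mul 2).mul ((t4.const_mul ((γ - 1) / 2)).add (t6.mul t5))
    refine tendsto_nhds_unique L (R.congr' ?_)
    have hnear : ∀ᶠ a in 𝓝[≠] t, a ∈ Ioo 0 (2 / (γ + 1)) :=
      nhdsWithin_le_nhds (Ioo_mem_nhds ht h.t_lt)
    filter_upwards [hnear, self_mem_nhdsWithin] with a ha hat
    have hat' : a ≠ t := hat
    have hat2 : a - t ≠ 0 := sub_ne_zero.2 hat'
    have hGne : GT m γ t a (Y a) ≠ 0 := by
      rcases lt_or_gt_of_ne hat' with h' | h'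
      · exact (h.G_right a ⟨ha.1, h'⟩).ne'
      · exact (h.G_left a ⟨h', ha.2.le⟩).ne
    have h1a : 1 - a ≠ 0 := by linarith [ha.2, two_div_lt_one hγ]
    rw [(h.ode a ⟨ha.1, ha.2.le⟩ hat').deriv, slope_def_field, slope_def_field, h.at_t,
      GT_at hγ ht ht1, slopeT]
    generalize GT m γ t a (Y a) = GG at *
    field_simp
    ring
  -- If g = 0, the limit relation would make a product of positive quantities vanish, because λ - B
  -- t > 0.
  have hg1 : g < 0 := by
    refine lt_of_le_of_ne hg0 fun h0 => ?_
    rw [h0] at hlim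
    have : 0 < 2 * (1 - t) ^ 2 * ((lT m γ t - BT m γ * t) * (2 * (1 - t) + s)) := by positivity
    linarith
  have key := root_pos_of_convex_quadratic (α := 1 / t - t) (β := bT m γ t - t) (c := cT m γ t t)
    (k := kT t) (c₀ := -1 / t + (γ - 1) / (1 - t)) (c₁ := 2 * (lT m γ t - BT m γ * t) / ((1 - t) * t))
    (t := t) (η := (s - kT t) / t) ht hc hk (by positivity) (by linarith) (by linarith) ?_ ?_ ?_ ?_ ?_
  · have := mul_pos key ht
    rw [div_mul_cancel₀ _ ht.ne'] at this; linarith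
  · have : 1 / t - t + t * ((s - kT t) / t) = 2 * (1 - t) + s := by
      rw [kT]; field_simp; ring
    rw [this]; linarith
  · have : bT m γ t - t + cT m γ t t * ((s - kT t) / t) = -g / t := by
      rw [hg]; field_simp
    rw [this]; exact div_pos (by linarith) ht
  · have hp : bT m γ t - t + cT m γ t t * ((s - kT t) / t) = -g / t := by
      rw [hg]; field_simp
    have hn : 1 / t - t + t * ((s - kT t) / t) = 2 * (1 - t) + s := by
      rw [kT]; field_simp; ring
    rw [hp, hn, kT]
    field_simp
    have hlim' : s * g = 2 * (1 - t) * ((γ - 1) / 2 * g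
      + (lT m γ t - BT m γ * t) * (2 * (1 - t) * (-1) - s)) := by
      apply mul_left_cancel₀ hy.ne'; linear_combination hlim
    linear_combination (-t) * hlim'
  · have : (-1 / t + (γ - 1) / (1 - t)) * (bT m γ t - t)
        + 2 * (lT m γ t - BT m γ * t) / ((1 - t) * t) * (1 / t - t) =
        eT m γ t t / (t * (1 - t)) := by
      rw [eT]; field_simp; ring
    rw [this]; positivity
  · have : 1 / t - t + t * (kT t * (-1 / t + (γ - 1) / (1 - t))) = (γ + 1) * (1 - t) := by
      rw [kT]; field_simp; ring
    rw [this]; exact mul_pos (by linarith) hy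

/-- Every contact with the barrier is an upward crossing, so there is only one, at t. -/
theorem barrier_deriv (h : SonicOrbit m γ t Y) (hm : m = 1 ∨ m = 2) (hγ : 1 < γ) (hγ3 : γ ≤ 3)
    (ha : a ∈ Ioc 0 (2 / (γ + 1))) (hY : Y a - kT t * a = 0) : 0 < deriv Y a - kT t := by
  rcases eq_or_ne a t with rfl | hat
  · exact sub_pos.2 (h.kT_lt_deriv hm hγ hγ3)
  · have hm0 : 0 < m := by rcases hm with rfl | rfl <;> norm_num
    have ht := h.t_pos
    have ht1 := h.t_lt_one hγ
    have ha1 : a < 1 := ha.2.trans_lt (two_div_lt_one hγ)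
    rw [(h.ode a ha hat).deriv, sub_eq_zero.1 hY, slopeT_sub_kT hm0 hγ ht ht1 ha.1 ha1 hat]
    have hb : 0 < bT m γ t - a := by
      have := one_div_lt_bT hm0 hγ ht ht1
      have := one_lt_one_div ht ht1
      linarith
    have := h.eT_pos hm hγ hγ3 ha.1.le ha.2
    have := kT_pos ht ht1
    have : 0 < 1 - a := by linarith
    positivity

theorem hasDerivAt_sub (h : SonicOrbit m γ t Y) (ha : a ∈ Ioc 0 (2 / (γ + 1))) :
    HasDerivAt (fun a => Y a - kT t * a) (deriv Y a - kT t) a := by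
  simpa using (h.diff a ha).hasDerivAt.fun_sub ((hasDerivAt_id' a).const_mul (kT t))

theorem kT_mul_self (ht : 0 < t) : kT t * t = (1 - t) ^ 2 := div_mul_cancel₀ _ ht.ne'

theorem barrier_left (h : SonicOrbit m γ t Y) (hm : m = 1 ∨ m = 2) (hγ : 1 < γ) (hγ3 : γ ≤ 3)
    (ha : a ∈ Ioc t (2 / (γ + 1))) : kT t * a < Y a := by
  refine sub_pos.1 (pos_of_deriv_pos_of_eq_zero (f := fun a => Y a - kT t * a)
    (f' := fun a => deriv Y a - kT t) (fun x hx => h.hasDerivAt_sub ⟨h.t_pos.trans_le hx.1, hx.2⟩)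
    ?_ (fun x hx => h.barrier_deriv hm hγ hγ3 ⟨h.t_pos.trans_le hx.1, hx.2⟩) a ha)
  rw [h.at_t, kT_mul_self h.t_pos, sub_self]

theorem barrier_right (h : SonicOrbit m γ t Y) (hm : m = 1 ∨ m = 2) (hγ : 1 < γ) (hγ3 : γ ≤ 3)
    (ha : a ∈ Ioo 0 t) : Y a < kT t * a := by
  refine sub_neg.1 (neg_of_deriv_pos_of_eq_zero (f := fun a => Y a - kT t * a) (a := a) (b := t)
    (f' := fun a => deriv Y a - kT t)
    (fun x hx => h.hasDerivAt_sub ⟨ha.1.trans_le hx.1, hx.2.trans h.t_lt.le⟩)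
    ?_ (fun x hx => h.barrier_deriv hm hγ hγ3 ⟨ha.1.trans_le hx.1, hx.2.trans h.t_lt.le⟩) a
      ⟨le_rfl, ha.2⟩)
  rw [h.at_t, kT_mul_self h.t_pos, sub_self]

/-- The barrier evaluated at the post-shock point. All bounds involving γ⋆, z₁ and z₂ descend from
this inequality. -/
theorem kT_lt (h : SonicOrbit m γ t Y) (hm : m = 1 ∨ m = 2) (hγ : 1 < γ) (hγ3 : γ ≤ 3) :
    kT t < γ * (γ - 1) / (γ + 1) := by
  have h1 := h.barrier_left hm hγ hγ3 ⟨h.t_lt, le_rfl⟩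
  rw [h.start] at h1
  exact lt_of_mul_lt_mul_right h1 h.a₁_mem.1.le

end SonicOrbit

end ShockODE

namespace ShockODE

variable {m γ t t' a : ℝ} {Y Y' : ℝ → ℝ}

/-! ### Location of the triple point and uniqueness -/

theorem two_div_add_one_pos (hγ : 1 < γ) : 0 < 2 / (γ + 1) := by
  have : 0 < γ + 1 := by linarith
  positivity

theorem slopeT_line (hg : GT m γ t a (γ / 2 * a ^ 2) ≠ 0) (ha1 : 1 - a ≠ 0) :
    slopeT m γ t a (γ / 2 * a ^ 2) - γ * a = γ * a ^ 2 * (m * a / 2 *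
      ((1 - a) * ((2 * γ - 1) * a - (γ - 1)) - γ * zT γ t * ((3 - γ) + (γ - 2) * a)))
        / ((1 - a) * GT m γ t a (γ / 2 * a ^ 2)) := by
  obtain ⟨g, hg'⟩ : ∃ g, g = GT m γ t a (γ / 2 * a ^ 2) := ⟨_, rfl⟩
  rw [slopeT, eq_div_iff (mul_ne_zero ha1 hg), ← hg']
  rw [← hg'] at hg
  field_simp
  rw [hg', GT, lT, BT]
  ring

/-- The curve `C² = (γ / 2) V²` is a barrier. -/
theorem SonicOrbit.gamma_mul_sq_le (h : SonicOrbit m γ t Y) (hm : m = 1 ∨ m = 2) (hγ : 2 ≤ γ)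
    (hγ3 : γ ≤ 3) : γ * t ^ 2 ≤ 2 * (1 - t) ^ 2 := by
  have hγ1 : 1 < γ := by linarith
  have ht := h.t_pos
  have ht1 := h.t_lt_one hγ1
  have hm0 : 0 < m := by rcases hm with rfl | rfl <;> norm_num
  have ha1 := two_div_lt_one hγ1
  by_contra hcon
  push Not at hcon
  have hd := dT_pos hγ1 ht ht1
  have hz : zT γ t * (2 - (2 - γ) * t) = t * (1 - t) := div_mul_cancel₀ _ hd.ne'
  -- The factor from `slopeT_line` is concave in a. At a = t its positivity is the assumption to be
  -- refuted; at the shock it factors.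
  have hn : ∀ a ∈ Icc t (2 / (γ + 1)), 0 < (1 - a) * ((2 * γ - 1) * a - (γ - 1))
      - γ * zT γ t * ((3 - γ) + (γ - 2) * a) := by
    intro a ha
    have e : ∀ a, (1 - a) * ((2 * γ - 1) * a - (γ - 1)) - γ * zT γ t * ((3 - γ) + (γ - 2) * a) =
        -(2 * γ - 1) * a ^ 2 + (3 * γ - 2 - γ * zT γ t * (γ - 2)) * a
          + (-(γ - 1) - γ * zT γ t * (3 - γ)) := by intro a; ring
    rw [e]
    refine concave_quadratic_pos (by linarith) ?_ ?_ ha.1 ha.2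
    · rw [← e]
      refine pos_of_mul_pos_left (b := 2 - (2 - γ) * t) ?_ hd.le
      have : ((1 - t) * ((2 * γ - 1) * t - (γ - 1)) - γ * zT γ t * ((3 - γ) + (γ - 2) * t))
          * (2 - (2 - γ) * t) = (γ - 1) * (1 - t) * (γ * t ^ 2 - 2 * (1 - t) ^ 2) := by
        linear_combination (-γ * ((3 - γ) + (γ - 2) * t)) * hz
      rw [this]
      exact mul_pos (mul_pos (by linarith) (by linarith)) (by linarith)
    · rw [← e]
      have hg1 : γ + 1 ≠ 0 := by linarith
      have : (1 - 2 / (γ + 1)) * ((2 * γ - 1) * (2 / (γ + 1)) - (γ - 1))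
          - γ * zT γ t * ((3 - γ) + (γ - 2) * (2 / (γ + 1))) =
          (4 * γ - 1 - γ ^ 2) / (γ + 1) * ((γ - 1) / (γ + 1) - γ * zT γ t) := by
        field_simp; ring
      rw [this]
      refine mul_pos (div_pos (by nlinarith) (by linarith)) (sub_pos.2 ?_)
      rw [lt_div_iff₀ (by linarith), zT, ← mul_div_assoc, div_mul_eq_mul_div, div_lt_iff₀ hd]
      nlinarith [sq_nonneg (2 * t - 1), sq_nonneg (3 * t - 2), sq_nonneg (5 * t - 2),
        mul_nonneg (sub_nonneg.2 hγ) (sub_nonneg.2 hγ3), mul_pos ht (sub_pos.2 ht1),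
        mul_nonneg (sub_nonneg.2 hγ) ht.le, mul_nonneg (mul_nonneg (sub_nonneg.2 hγ) (sub_nonneg.2 hγ3)) (mul_pos ht (sub_pos.2 ht1)).le]
  -- An orbit starting below the parabola at t stays below it, whereas for γ ≥ 2 the post-shock
  -- point is on or above the parabola.
  have key := pos_of_deriv_pos_of_eq_zero (f := fun a => γ / 2 * a ^ 2 - Y a)
    (f' := fun a => γ * a - deriv Y a) (a := t) (b := 2 / (γ + 1)) ?_ ?_ ?_ (2 / (γ + 1))
      ⟨h.t_lt, le_rfl⟩
  · beta_reduce at key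
    rw [h.start] at key
    have hg1 : 0 < γ + 1 := by linarith
    have : γ / 2 * (2 / (γ + 1)) ^ 2 - γ * (γ - 1) / (γ + 1) * (2 / (γ + 1)) =
        -(2 * γ * (γ - 2) / (γ + 1) ^ 2) := by field_simp; ring
    rw [this] at key
    have : 0 ≤ 2 * γ * (γ - 2) / (γ + 1) ^ 2 := by
      have : 0 ≤ γ - 2 := by linarith
      positivity
    linarith
  · intro x hx
    have h1 := (h.diff x ⟨ht.trans_le hx.1, hx.2⟩).hasDerivAt
    have h2 : HasDerivAt (fun a : ℝ => γ / 2 * a ^ 2) (γ * x) x := by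
      have : HasDerivAt (fun a : ℝ => a ^ 2) (2 * x) x := by
        simpa using (hasDerivAt_id' x).fun_pow 2
      have := this.const_mul (γ / 2)
      rwa [show γ / 2 * (2 * x) = γ * x by ring] at this
    exact h2.sub h1
  · rw [h.at_t]; linarith
  · intro x hx h0
    have hxt : x ≠ t := by
      rintro rfl
      rw [h.at_t] at h0; linarith
    have hxt' : t < x := lt_of_le_of_ne hx.1 hxt.symm
    have hY : Y x = γ / 2 * x ^ 2 := by linarith
    have hG := h.G_left x ⟨hxt', hx.2⟩
    have hx1 : 0 < 1 - x := by linarith [hx.2]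
    have hx0 := ht.trans_le hx.1
    rw [(h.ode x ⟨hx0, hx.2⟩ hxt).deriv, hY]
    rw [hY] at hG
    have e := slopeT_line hG.ne hx1.ne'
    have hp := hn x hx
    have : slopeT m γ t x (γ / 2 * x ^ 2) - γ * x < 0 := by
      rw [e]
      refine div_neg_of_pos_of_neg (by positivity) (mul_neg_of_pos_of_neg hx1 hG)
    linarith

/-- After cross-multiplication the difference has the factor γ t t' - 2(1-t)(1-t'), so `zT`
decreases on the P₆ branch and, by `zT_lt_zT_of_flat`, increases on the P₈ branch. -/
theorem zT_lt_zT (hγ : 1 < γ) (ht : 0 < t) (ht1 : t' < 1) (htt : t < t')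
    (hP : 2 * (1 - t) ^ 2 ≤ γ * t ^ 2) : zT γ t' < zT γ t := by
  have ht' : 0 < t' := ht.trans htt
  have hd := dT_pos hγ ht (htt.trans ht1)
  have hd' := dT_pos hγ ht' ht1
  rw [zT, zT, div_lt_div_iff₀ hd' hd]
  have h2 : 2 * (1 - t') ^ 2 < γ * t' ^ 2 := by nlinarith
  have h3 : 2 * ((1 - t) * (1 - t')) < γ * (t * t') := by
    have h1t : 0 < 1 - t := by linarith
    refine lt_of_pow_lt_pow_left₀ 2 (by positivity) ?_
    calc (2 * ((1 - t) * (1 - t'))) ^ 2 = (2 * (1 - t) ^ 2) * (2 * (1 - t') ^ 2) := by ring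
      _ ≤ γ * t ^ 2 * (2 * (1 - t') ^ 2) := by gcongr
      _ < γ * t ^ 2 * (γ * t' ^ 2) := by gcongr
      _ = _ := by ring
  have h4 : 0 < (t' - t) * (γ * (t * t') - 2 * ((1 - t) * (1 - t'))) :=
    mul_pos (by linarith) (by linarith)
  nlinarith

/-- On the part of the orbit where `λ < B a`, the quotient `C² / V²` is monotone. -/
theorem SonicOrbit.quotient_sq_ge (h : SonicOrbit m γ t Y) (hm : 0 < m) (hγ : 1 < γ)
    (ha : a ∈ Ioc t (2 / (γ + 1))) (hl : lT m γ t - BT m γ * a ≤ 0) :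
    γ * (γ - 1) / 2 * a ^ 2 ≤ Y a := by
  have ht := h.t_pos
  have ha0 : 0 < a := ht.trans ha.1
  have hB : 0 < BT m γ := by
    have : 0 < m * (γ - 1) := mul_pos hm (by linarith)
    rw [BT]; linarith
  have hsub : Icc a (2 / (γ + 1)) ⊆ Ioc 0 (2 / (γ + 1)) := fun x hx => ⟨ha0.trans_le hx.1, hx.2⟩
  have hanti : AntitoneOn (fun x => Y x * (x ^ 2)⁻¹) (Icc a (2 / (γ + 1))) := by
    refine antitoneOn_of_hasDerivWithinAt_nonpos (convex_Icc _ _)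
      (f' := fun x => slopeT m γ t x (Y x) * (x ^ 2)⁻¹ + Y x * (-(2 * x) / (x ^ 2) ^ 2)) ?_ ?_ ?_
    · refine (h.continuousOn.mono hsub).mul (ContinuousOn.inv₀ (by fun_prop) fun x hx => ?_)
      have := (hsub hx).1
      positivity
    · intro x hx
      rw [interior_Icc] at hx
      have hx0 := (hsub (Ioo_subset_Icc_self hx)).1
      have h1 := h.ode x (hsub (Ioo_subset_Icc_self hx)) (ha.1.trans hx.1).ne'
      have h2 : HasDerivAt (fun a : ℝ => a ^ 2) (2 * x) x := by
        simpa using (hasDerivAt_id' x).fun_pow 2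
      exact (h1.mul (h2.fun_inv (by positivity))).hasDerivWithinAt
    · intro x hx
      rw [interior_Icc] at hx
      have hx0 := (hsub (Ioo_subset_Icc_self hx)).1
      have hxm : x ∈ Ioc t (2 / (γ + 1)) := ⟨ha.1.trans hx.1, hx.2.le⟩
      have hr := h.ratio_left_pos hxm
      have hY := h.pos x (hsub (Ioo_subset_Icc_self hx))
      have h1a : 0 < 1 - x := by linarith [hx.2, two_div_lt_one hγ]
      have e : slopeT m γ t x (Y x) * (x ^ 2)⁻¹ + Y x * (-(2 * x) / (x ^ 2) ^ 2) =
          2 * Y x / (x ^ 3 * (1 - x)) * (x * ((lT m γ t - BT m γ * x) *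
            (((1 - x) ^ 2 - Y x) / GT m γ t x (Y x))) - (1 - (γ + 1) / 2 * x)) := by
        rw [slopeT]; field_simp; ring
      rw [e]
      have h3 : lT m γ t - BT m γ * x ≤ 0 := by nlinarith [hx.1]
      have h4 := mul_nonpos_of_nonpos_of_nonneg h3 hr.le
      have h5 := mul_nonpos_of_nonneg_of_nonpos hx0.le h4
      have h6 : (γ + 1) / 2 * x ≤ 1 := by
        have := hx.2.le
        rw [le_div_iff₀ (by linarith)] at this; linarith
      exact mul_nonpos_of_nonneg_of_nonpos (by positivity) (by linarith)
  have h5 := hanti ⟨le_rfl, ha.2⟩ ⟨ha.2, le_rfl⟩ ha.2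
  beta_reduce at h5
  rw [h.start] at h5
  have h6 : γ * (γ - 1) / (γ + 1) * (2 / (γ + 1)) * ((2 / (γ + 1)) ^ 2)⁻¹ = γ * (γ - 1) / 2 := by
    have : γ + 1 ≠ 0 := by linarith
    field_simp
  rw [h6, ← div_eq_mul_inv, le_div_iff₀ (by positivity)] at h5
  exact h5

/-- The slope of the orbits increases with the parameter `z` where the flow is subsonic. -/
theorem SonicOrbit.slope_discriminant_neg (h : SonicOrbit m γ t Y) (hm : m = 1 ∨ m = 2)
    (hγ : 1 < γ) (ha : a ∈ Ioc t (2 / (γ + 1))) (ha2 : 1 / 2 < a) :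
    γ * (BT m γ - 1) * a ^ 2 * (1 - a) < Y a * (2 + (m - 1) * a) := by
  have hm0 : 0 < m := by rcases hm with rfl | rfl <;> norm_num
  have ht := h.t_pos
  have ha0 : 0 < a := ht.trans ha.1
  have ha1 : a < 1 := ha.2.trans_lt (two_div_lt_one hγ)
  have hY := h.pos a ⟨ha0, ha.2⟩
  -- For λ ≤ B a the bound comes from the monotone quotient Y / a², for λ > B a from G < 0.
  rcases le_or_gt (lT m γ t - BT m γ * a) 0 with hl | hl
  · have h1 := h.quotient_sq_ge hm0 hγ ha hl
    have h2 : 0 < 2 + (m - 1) * a := by rcases hm with rfl | rfl <;> linarith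
    refine lt_of_lt_of_le ?_ (mul_le_mul_of_nonneg_right h1 h2.le)
    have e : BT m γ - 1 = (γ - 1) / 2 * (m + 1) := by rw [BT]; ring
    rw [e]
    have h3 : (m + 1) * (1 - a) < 2 + (m - 1) * a := by rcases hm with rfl | rfl <;> linarith
    have h4 : 0 < γ * (γ - 1) / 2 * a ^ 2 := by
      have : 0 < γ - 1 := by linarith
      positivity
    have := mul_lt_mul_of_pos_left h3 h4
    linarith
  · have hG := h.G_left a ha
    have e : m * (γ * (BT m γ - 1) * a ^ 2 * (1 - a) - Y a * (2 + (m - 1) * a)) =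
        m * γ * GT m γ t a (Y a) - (lT m γ t - BT m γ * a) * (2 * m * Y a + m * γ * (a * (1 - a))) := by
      rw [GT, lT, BT]; ring
    have h1 : m * γ * GT m γ t a (Y a) < 0 := mul_neg_of_pos_of_neg (by positivity) hG
    have h2 : 0 < 2 * m * Y a + m * γ * (a * (1 - a)) := by
      have : 0 < 1 - a := by linarith
      positivity
    have h3 := mul_pos hl h2
    have h4 : m * (γ * (BT m γ - 1) * a ^ 2 * (1 - a) - Y a * (2 + (m - 1) * a)) < 0 := by linarith
    have := neg_of_mul_neg_right h4 hm0.le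
    linarith

/-- If t < t', then z > z', and the orbit of z is steeper wherever the two meet. Traced back from
the common post-shock point it lies below the other, so Y(t') ≤ (1-t')²; but Y is still above the
sonic line at t' > t. -/
theorem SonicOrbit.not_lt_of_steep (h : SonicOrbit m γ t Y) (h' : SonicOrbit m γ t' Y')
    (hm : m = 1 ∨ m = 2) (hγ : 1 < γ) (hγ2 : γ < 2) (hP : 2 * (1 - t) ^ 2 ≤ γ * t ^ 2) :
    ¬ t < t' := by
  intro htt
  have hm0 : 0 < m := by rcases hm with rfl | rfl <;> norm_num
  have ht := h.t_pos
  have ht'1 := h'.t_lt_one hγ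
  have hz := zT_lt_zT hγ ht ht'1 htt hP
  -- For γ < 2 the P₆ condition gives (1-t)² < t².
  have ht2 : 1 / 2 < t := by
    have h1 : γ * t ^ 2 < 2 * t ^ 2 := mul_lt_mul_of_pos_right hγ2 (by positivity)
    nlinarith
  have hlt : ∀ x ∈ Ioo t' (2 / (γ + 1)), Y x < Y' x := by
    intro x hx
    have hsub : ∀ b ∈ Icc x (2 / (γ + 1)), b ∈ Ioc 0 (2 / (γ + 1)) :=
      fun b hb => ⟨(ht.trans (htt.trans hx.1)).trans_le hb.1, hb.2⟩
    refine sub_neg.1 (neg_of_deriv_pos_of_eq_zero (f := fun b => Y b - Y' b)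
      (f' := fun b => deriv Y b - deriv Y' b) (a := x) (b := 2 / (γ + 1)) ?_ ?_ ?_ x ⟨le_rfl, hx.2⟩)
    · exact fun b hb => (h.diff b (hsub b hb)).hasDerivAt.sub (h'.diff b (hsub b hb)).hasDerivAt
    · rw [h.start, h'.start, sub_self]
    · intro b hb h0
      have hYY : Y' b = Y b := by linarith
      have hb' : b ∈ Ioc t' (2 / (γ + 1)) := ⟨hx.1.trans_le hb.1, hb.2⟩
      have hbt : b ∈ Ioc t (2 / (γ + 1)) := ⟨htt.trans hb'.1, hb.2⟩
      have hG := h.G_left b hbt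
      have hG' := h'.G_left b hb'
      have hD := h.sonic_left b hbt
      have hdisc := h.slope_discriminant_neg hm hγ hbt (ht2.trans hbt.1)
      have hY := h.pos b (hsub b hb)
      have hb1 : 0 < 1 - b := by linarith [hb.2, two_div_lt_one hγ]
      rw [(h.ode b (hsub b hb) hbt.1.ne').deriv, (h'.ode b (hsub b hb) hb'.1.ne').deriv, hYY]
      rw [hYY] at hG'
      -- λ and G are affine in z, so the cross difference of numerators and denominators is linear
      -- in z - z', with the discriminant of `slope_discriminant_neg` as coefficient.
      have e : slopeT m γ t b (Y b) - slopeT m γ t' b (Y b) = 2 * Y b / (1 - b) * (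
          (Y b - (1 - b) ^ 2) * ((zT γ t - zT γ t') * (m * (Y b * (2 + (m - 1) * b) -
            γ * (BT m γ - 1) * b ^ 2 * (1 - b))))
            / (GT m γ t b (Y b) * GT m γ t' b (Y b))) := by
        have hGn := hG.ne
        have hGn' := hG'.ne
        have hb1' := hb1.ne'
        have : (Y b - (1 - b) ^ 2) * ((zT γ t - zT γ t') * (m * (Y b * (2 + (m - 1) * b) -
            γ * (BT m γ - 1) * b ^ 2 * (1 - b)))) =
            (lT m γ t - BT m γ * b) * ((1 - b) ^ 2 - Y b) * GT m γ t' b (Y b) -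
            (lT m γ t' - BT m γ * b) * ((1 - b) ^ 2 - Y b) * GT m γ t b (Y b) := by
          rw [GT, GT, lT, lT, BT]; ring
        rw [this, slopeT, slopeT]
        generalize GT m γ t b (Y b) = g1 at *
        generalize GT m γ t' b (Y b) = g2 at *
        field_simp
        ring
      rw [e]
      refine mul_pos (by positivity) (div_pos (mul_pos (by linarith) (mul_pos (by linarith)
        (mul_pos hm0 (by linarith)))) (mul_pos_of_neg_of_neg hG hG'))
  have hc1 := (h.diff t' ⟨h'.t_pos, h'.t_lt.le⟩).continuousAt.tendsto.mono_left
    (nhdsWithin_le_nhds (s := Ioi t'))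
  have hc2 := (h'.diff t' ⟨h'.t_pos, h'.t_lt.le⟩).continuousAt.tendsto.mono_left
    (nhdsWithin_le_nhds (s := Ioi t'))
  have hle : Y t' ≤ Y' t' := by
    refine le_of_tendsto_of_tendsto hc1 hc2 ?_
    filter_upwards [Ioo_mem_nhdsGT h'.t_lt] with x hx using (hlt x hx).le
  have := h.sonic_left t' ⟨htt, h'.t_lt.le⟩
  rw [h'.at_t] at hle
  linarith

theorem SonicOrbit.eq_of_steep (h : SonicOrbit m γ t Y) (h' : SonicOrbit m γ t' Y')
    (hm : m = 1 ∨ m = 2) (hγ : 1 < γ) (hγ2 : γ < 2) (hP : 2 * (1 - t) ^ 2 ≤ γ * t ^ 2)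
    (hP' : 2 * (1 - t') ^ 2 ≤ γ * t' ^ 2) : t = t' :=
  le_antisymm (not_lt.1 (h'.not_lt_of_steep h hm hγ hγ2 hP'))
    (not_lt.1 (h.not_lt_of_steep h' hm hγ hγ2 hP))

end ShockODE

namespace ShockODE

/-! ### Connections are sonic orbits -/

variable {m : ℕ} {γ z t a : ℝ} {C : ℝ → ℝ}

theorem V₁_eq (γ : ℝ) : V₁ γ = -(2 / (γ + 1)) := by rw [V₁, neg_div]

theorem C₁_sq (hγ : 1 < γ) : C₁ γ ^ 2 = γ * (γ - 1) / (γ + 1) * (2 / (γ + 1)) := by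
  have h : 0 ≤ 2 * γ * (γ - 1) := mul_nonneg (by linarith) (by linarith)
  rw [C₁, div_pow, Real.sq_sqrt h]
  have : γ + 1 ≠ 0 := by linarith
  field_simp

theorem C₁_pos (hγ : 1 < γ) : 0 < C₁ γ :=
  div_pos (Real.sqrt_pos.2 (mul_pos (by linarith) (by linarith))) (by linarith)

theorem G_neg_eq (m : ℕ) (γ t a c : ℝ) : G m γ (zT γ t) (-a) c = GT m γ t a (c ^ 2) := by
  rw [G, GT, lam, lT]; ring

/-- F is a combination of G and D, so on the sonic line G = 0 entails F = 0. -/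
theorem F_neg_eq (m : ℕ) (γ t c : ℝ) (ha : 1 - a ≠ 0) : F m γ (zT γ t) (-a) c =
    -(c / (1 - a)) * ((γ - 1) / 2 * GT m γ t a (c ^ 2)
      + ((1 - a) ^ 2 - c ^ 2) * (lT (m : ℝ) γ t - BT (m : ℝ) γ * a)) := by
  rw [F, GT, lT, BT, a₁, a₂, a₃]
  generalize zT γ t = z
  have : (1 : ℝ) + -a ≠ 0 := ha
  field_simp
  ring

theorem D_neg_eq (a c : ℝ) : D (-a) c = (1 - a) ^ 2 - c ^ 2 := by rw [D]; ring

/-- The equation for `C²` as a function of `-V`. -/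
theorem two_mul_slope (m : ℕ) (γ t c : ℝ) (ha : 1 - a ≠ 0) (hG : GT m γ t a (c ^ 2) ≠ 0) :
    2 * c * -(F m γ (zT γ t) (-a) c / G m γ (zT γ t) (-a) c) = slopeT m γ t a (c ^ 2) := by
  rw [F_neg_eq m γ t c ha, G_neg_eq, slopeT]
  generalize GT m γ t a (c ^ 2) = g at *
  field_simp

/-- Anchors the sign of G between the shock and the triple point. -/
theorem GT_start_neg (hm : m = 1 ∨ m = 2) (hγ : 1 < γ) (hγ3 : γ ≤ 3) (ht : 0 < t) (ht1 : t < 1) :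
    GT m γ t (2 / (γ + 1)) (γ * (γ - 1) / (γ + 1) * (2 / (γ + 1))) < 0 := by
  have hg : 0 < γ + 1 := by linarith
  have hz := gamma_zT_le hγ hγ3 ht ht1
  have e : GT m γ t (2 / (γ + 1)) (γ * (γ - 1) / (γ + 1) * (2 / (γ + 1))) =
      -(2 * (γ - 1) / (γ + 1) ^ 3 * (2 * (γ * (m + 1) + 1) - (γ + 1) * (3 * m * (γ * zT γ t) + 1))) := by
    rw [GT, lT]
    generalize zT γ t = z
    field_simp
    ring
  rw [e, neg_lt_zero]
  have : 0 < γ - 1 := by linarith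
  refine mul_pos (by positivity) (sub_pos.2 ?_)
  rcases hm with rfl | rfl <;> push_cast <;> nlinarith

namespace IsConnection

theorem neg_mem (ha : a ∈ Ioc 0 (2 / (γ + 1))) : -a ∈ Ico (V₁ γ) 0 := by
  rw [V₁_eq]; exact ⟨neg_le_neg ha.2, neg_lt_zero.2 ha.1⟩

theorem analyticAt_neg (h : IsConnection m γ z C) (ha : a ∈ Ioc 0 (2 / (γ + 1))) :
    AnalyticAt ℝ (fun a => C (-a)) a :=
  (h.analytic (-a) (neg_mem ha)).comp_of_eq (analyticAt_id.neg) rfl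

theorem strictMonoOn_neg (h : IsConnection m γ z C) :
    StrictMonoOn (fun a => C (-a)) (Ioc 0 (2 / (γ + 1))) :=
  fun _ ha _ hb hab => h.decreasing (neg_mem hb) (neg_mem ha) (neg_lt_neg hab)

theorem tendsto_neg (h : IsConnection m γ z C) : Tendsto (fun a => C (-a)) (𝓝[>] 0) (𝓝 0) := by
  refine h.origin.comp ?_
  have := tendsto_neg_nhdsGT (a := (0 : ℝ))
  simpa using this

/-- Off its single sonic point the connection has G ≠ 0, so G keeps one sign on each side; the signs
are read off at the shock and near the origin. -/
theorem exists_orbit (h : IsConnection m γ z C) (hm : m = 1 ∨ m = 2) (hγ : 1 < γ) (hγ3 : γ ≤ 3) :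
    ∃ t, z = zT γ t ∧ C (-t) = 1 - t ∧ SonicOrbit m γ t (fun a => C (-a) ^ 2) := by
  have ha10 := two_div_add_one_pos hγ
  have ha11 := two_div_lt_one hγ
  have hC1 := C₁_pos hγ
  have hC1' : (γ - 1) / (γ + 1) < C₁ γ := by
    refine lt_of_pow_lt_pow_left₀ 2 hC1.le ?_
    rw [C₁_sq hγ, start_eq hγ]
    have := (u_mem hγ hγ3).1
    nlinarith
  have hstart : C (-(2 / (γ + 1))) = C₁ γ := by rw [← V₁_eq]; exact h.start
  set c : ℝ → ℝ := fun a => C (-a) with hc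
  have hcont : ContinuousOn c (Ioc 0 (2 / (γ + 1))) :=
    fun a ha => (h.analyticAt_neg ha).continuousAt.continuousWithinAt
  have hmono := h.strictMonoOn_neg
  have hpos : ∀ a ∈ Ioc 0 (2 / (γ + 1)), 0 < c a := fun a ha => h.pos _ (neg_mem ha)
  obtain ⟨t, ht, htc⟩ : ∃ t ∈ Ioo 0 (2 / (γ + 1)), c t - (1 - t) = 0 := by
    have h1 : ∀ᶠ a in 𝓝[>] (0 : ℝ), c a - (1 - a) < 0 := by
      have : Tendsto (fun a => c a - (1 - a)) (𝓝[>] 0) (𝓝 (0 - (1 - 0))) :=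
        h.tendsto_neg.sub ((tendsto_id.mono_left nhdsWithin_le_nhds).const_sub 1)
      exact this.eventually (gt_mem_nhds (by norm_num))
    obtain ⟨b, hb1, hb2⟩ := (h1.and (Ioo_mem_nhdsGT ha10)).exists
    have h2 : 0 < c (2 / (γ + 1)) - (1 - 2 / (γ + 1)) := by
      rw [hc]; beta_reduce; rw [hstart, one_sub_u hγ]; linarith
    obtain ⟨t, ht, h3⟩ := intermediate_value_Ioo hb2.2.le
      (f := fun a => c a - (1 - a))
      ((hcont.mono fun x hx => ⟨hb2.1.trans_le hx.1, hx.2⟩).sub (by fun_prop)) ⟨hb1, h2⟩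
    exact ⟨t, ⟨hb2.1.trans ht.1, ht.2⟩, h3⟩
  have htm : t ∈ Ioc 0 (2 / (γ + 1)) := ⟨ht.1, ht.2.le⟩
  have ht1 : t < 1 := ht.2.trans ha11
  have htc' : c t = 1 - t := by linarith
  -- At (-t, 1-t), G factors as m(1-t)(z(2-(2-γ)t) - t(1-t)).
  have hz : z = zT γ t := by
    have h1 := (h.sonic (-t) (neg_mem htm) (by
      rw [D_neg_eq]; change (1 - t) ^ 2 - c t ^ 2 = 0; rw [htc', sub_self])).2
    change G m γ z (-t) (c t) = 0 at h1
    rw [htc', G, lam] at h1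
    have h2 : m * (1 - t) * (z * (2 - (2 - γ) * t) - t * (1 - t)) = 0 := by linear_combination h1
    have hm0 : (m : ℝ) ≠ 0 := by rcases hm with rfl | rfl <;> norm_num
    have h3 := (mul_eq_zero.1 h2).resolve_left (mul_ne_zero hm0 (by linarith))
    rw [zT, eq_div_iff (dT_pos hγ ht.1 ht1).ne']
    linarith
  have hm0 : (0 : ℝ) < m := by rcases hm with rfl | rfl <;> norm_num
  have hleft : ∀ a ∈ Ioc t (2 / (γ + 1)), 1 - a < c a := fun a ha => by
    have := hmono htm ⟨ht.1.trans ha.1, ha.2⟩ ha.1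
    change c t < c a at this
    linarith [ha.1]
  have hright : ∀ a ∈ Ioo 0 t, c a < 1 - a := fun a ha => by
    have := hmono ⟨ha.1, ha.2.le.trans htm.2⟩ htm ha.2
    change c a < c t at this
    linarith [ha.2]
  have hDl : ∀ a ∈ Ioc t (2 / (γ + 1)), (1 - a) ^ 2 < c a ^ 2 := fun a ha =>
    pow_lt_pow_left₀ (hleft a ha) (by linarith [ha.2]) two_ne_zero
  have hDr : ∀ a ∈ Ioo 0 t, c a ^ 2 < (1 - a) ^ 2 := fun a ha =>
    pow_lt_pow_left₀ (hright a ha) (hpos a ⟨ha.1, ha.2.le.trans htm.2⟩).le two_ne_zero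
  have hDne : ∀ a ∈ Ioc 0 (2 / (γ + 1)), a ≠ t → D (-a) (C (-a)) ≠ 0 := by
    intro a ha hat
    rw [D_neg_eq]
    rcases lt_or_gt_of_ne hat with h' | h'
    · exact (sub_pos.2 (hDr a ⟨ha.1, h'⟩)).ne'
    · exact (sub_neg.2 (hDl a ⟨h', ha.2⟩)).ne
  subst hz
  have hGne : ∀ a ∈ Ioc 0 (2 / (γ + 1)), a ≠ t → GT m γ t a (c a ^ 2) ≠ 0 := by
    intro a ha hat
    rw [← G_neg_eq]
    exact (h.ode (-a) (neg_mem ha) (hDne a ha hat)).1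
  have hGcont : ContinuousOn (fun a => GT m γ t a (c a ^ 2)) (Ioc 0 (2 / (γ + 1))) := by
    unfold GT
    exact ((hcont.pow 2).mul (by fun_prop)).add (by fun_prop)
  have hst2 : c (2 / (γ + 1)) ^ 2 = γ * (γ - 1) / (γ + 1) * (2 / (γ + 1)) := by
    rw [← C₁_sq hγ, ← hstart]
  refine ⟨t, rfl, htc', ht.1, ht.2, fun a ha => pow_pos (hpos a ha) 2, ?_, ?_, ?_, ?_, hst2, hDl, hDr,
    ?_, ?_, ?_⟩
  · exact fun a ha b hb hab => pow_lt_pow_left₀ (hmono ha hb hab) (hpos a ha).le two_ne_zero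
  · exact fun a ha => ((h.analyticAt_neg ha).pow 2).differentiableAt
  · exact ((h.analyticAt_neg htm).pow 2).deriv.continuousAt
  · change c t ^ 2 = _; rw [htc']
  · intro a ha
    have hs := GT_start_neg hm hγ hγ3 ht.1 ht1
    rw [← hst2] at hs
    by_contra hcon
    push Not at hcon
    obtain ⟨b, hb, hb0⟩ := intermediate_value_Icc' ha.2 (hGcont.mono
      fun x hx => ⟨(ht.1.trans ha.1).trans_le hx.1, hx.2⟩) ⟨hs.le, hcon⟩
    exact hGne b ⟨(ht.1.trans ha.1).trans_le hb.1, hb.2⟩ (ha.1.trans_le hb.1).ne' hb0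
  · intro a ha
    by_contra hcon
    push Not at hcon
    -- Up to 2mz/(m+1) the coefficient of C² in G is nonnegative, hence G > 0 at b; a value G ≤ 0 at
    -- a would then produce a forbidden zero.
    set b := min a (2 * m * zT γ t / (m + 1)) with hb
    have hzp := zT_pos hγ ht.1 ht1
    have hb0 : 0 < b := lt_min ha.1 (by positivity)
    have hba : b ≤ a := min_le_left _ _
    have hb2 : (m + 1) * b ≤ 2 * m * zT γ t := by
      have := min_le_right a (2 * m * zT γ t / (m + 1))
      rw [← hb, le_div_iff₀ (by positivity)] at this
      linarith
    have hs : 0 < GT m γ t b (c b ^ 2) := by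
      have h1 := one_lt_lT hm0 hγ ht.1 ht1
      have h2 : 0 < b * (1 - b) * (lT (m : ℝ) γ t - b) :=
        mul_pos (mul_pos hb0 (by linarith [ha.2])) (by linarith [ha.2])
      have h3 : 0 ≤ c b ^ 2 * (2 * m * zT γ t - (m + 1) * b) :=
        mul_nonneg (sq_nonneg _) (by linarith)
      rw [GT]; linarith
    obtain ⟨x, hx, hx0⟩ := intermediate_value_Icc' hba (hGcont.mono
      fun x hx => ⟨hb0.trans_le hx.1, hx.2.trans (ha.2.le.trans htm.2)⟩) ⟨hcon, hs.le⟩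
    exact hGne x ⟨hb0.trans_le hx.1, hx.2.trans (ha.2.le.trans htm.2)⟩ (hx.2.trans_lt ha.2).ne hx0
  · intro a ha hat
    have h1 := (h.ode (-a) (neg_mem ha) (hDne a ha hat)).2
    have h2 := h1.comp a (hasDerivAt_neg a)
    have h3 := h2.fun_pow 2
    rw [← two_mul_slope m γ t (c a) (by linarith [ha.2]) (hGne a ha hat)]
    refine h3.congr_deriv ?_
    simp [hc]

end IsConnection

end ShockODE

namespace ShockODE

/-! ### Distinguished parameter values -/

variable {m : ℕ} {γ z t t' : ℝ} {C : ℝ → ℝ}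

theorem zT_mul (hγ : 1 < γ) (ht : 0 < t) (ht1 : t < 1) :
    zT γ t * (2 - (2 - γ) * t) = t * (1 - t) := div_mul_cancel₀ _ (dT_pos hγ ht ht1).ne'

theorem zT_le_zM (hγ : 1 < γ) (ht : 0 < t) (ht1 : t < 1) : zT γ t ≤ zM γ := by
  have hp : √γ ^ 2 = γ := Real.sq_sqrt (by linarith)
  have hq : √2 ^ 2 = (2 : ℝ) := Real.sq_sqrt (by norm_num)
  have hd := dT_pos hγ ht ht1
  have : 0 < (√γ + √2) ^ 2 := by positivity
  rw [zM, zT, div_le_div_iff₀ hd this]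
  have : 0 ≤ (√2 * (1 - t) - √γ * t) ^ 2 := sq_nonneg _
  nlinarith

/-- For z = `zT γ t` the two triple points are at a = t and a = 2z/t, and w is their distance. Hence
t belongs to P₆ or P₈ according as it is the larger or the smaller of the two. -/
theorem w_zT (hγ : 1 < γ) (ht : 0 < t) (ht1 : t < 1) : w γ (zT γ t) = |t - 2 * zT γ t / t| := by
  have hz := zT_mul hγ ht ht1
  rw [w, ← Real.sqrt_sq_eq_abs]
  congr 1
  have h1 : 1 + (2 - γ) * zT γ t = t + 2 * zT γ t / t := by
    field_simp; linear_combination -hz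
  have h2 : t * (2 * zT γ t / t) = 2 * zT γ t := by field_simp
  linear_combination (1 + (2 - γ) * zT γ t + t + 2 * zT γ t / t) * h1 + 4 * h2

theorem t_sub_eq (hγ : 1 < γ) (ht : 0 < t) (ht1 : t < 1) :
    t - 2 * zT γ t / t = (γ * t ^ 2 - 2 * (1 - t) ^ 2) / (2 - (2 - γ) * t) := by
  have hd := (dT_pos hγ ht ht1).ne'
  have hz := zT_mul hγ ht ht1
  rw [eq_div_iff hd]
  have h2 : 2 * zT γ t / t * (2 - (2 - γ) * t) = 2 * (1 - t) := by
    field_simp; linear_combination hz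
  linear_combination -h2

theorem sum_roots (hγ : 1 < γ) (ht : 0 < t) (ht1 : t < 1) :
    -1 + (γ - 2) * zT γ t = -t - 2 * zT γ t / t := by
  have hz := zT_mul hγ ht ht1
  field_simp; linear_combination hz

theorem V₆_zT (hγ : 1 < γ) (ht : 0 < t) (ht1 : t < 1) (h : 2 * (1 - t) ^ 2 ≤ γ * t ^ 2) :
    V₆ γ (zT γ t) = -t := by
  have h1 : 0 ≤ t - 2 * zT γ t / t := by
    rw [t_sub_eq hγ ht ht1]
    exact div_nonneg (by linarith) (dT_pos hγ ht ht1).le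
  rw [V₆, w_zT hγ ht ht1, abs_of_nonneg h1, sum_roots hγ ht ht1]; ring

theorem V₈_zT (hγ : 1 < γ) (ht : 0 < t) (ht1 : t < 1) (h : γ * t ^ 2 ≤ 2 * (1 - t) ^ 2) :
    V₈ γ (zT γ t) = -t := by
  have h1 : t - 2 * zT γ t / t ≤ 0 := by
    rw [t_sub_eq hγ ht ht1]
    exact div_nonpos_of_nonpos_of_nonneg (by linarith) (dT_pos hγ ht ht1).le
  rw [V₈, w_zT hγ ht ht1, abs_of_nonpos h1, sum_roots hγ ht ht1]; ring

theorem w_zT_pos (hγ : 1 < γ) (ht : 0 < t) (ht1 : t < 1) (h : γ * t ^ 2 ≠ 2 * (1 - t) ^ 2) :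
    0 < w γ (zT γ t) := by
  rw [w_zT hγ ht ht1, abs_pos, t_sub_eq hγ ht ht1]
  exact div_ne_zero (sub_ne_zero.2 h) (dT_pos hγ ht ht1).ne'

theorem zT_lt_zT_of_flat (hγ : 1 < γ) (ht : 0 < t) (ht1 : t' < 1) (htt : t < t')
    (hP : γ * t' ^ 2 ≤ 2 * (1 - t') ^ 2) : zT γ t < zT γ t' := by
  have ht' : 0 < t' := ht.trans htt
  have hd := dT_pos hγ ht (htt.trans ht1)
  have hd' := dT_pos hγ ht' ht1
  rw [zT, zT, div_lt_div_iff₀ hd hd']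
  have h1t : 0 < 1 - t := by linarith
  have h2 : γ * t ^ 2 < 2 * (1 - t) ^ 2 := by nlinarith
  have h3 : γ * (t * t') < 2 * ((1 - t) * (1 - t')) := by
    have h1t' : 0 < 1 - t' := by linarith
    refine lt_of_pow_lt_pow_left₀ 2 (by positivity) ?_
    calc (γ * (t * t')) ^ 2 = (γ * t ^ 2) * (γ * t' ^ 2) := by ring
      _ ≤ γ * t ^ 2 * (2 * (1 - t') ^ 2) := by gcongr
      _ < 2 * (1 - t) ^ 2 * (2 * (1 - t') ^ 2) := by gcongr
      _ = _ := by ring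
  have h4 : 0 < (t' - t) * (2 * ((1 - t) * (1 - t')) - γ * (t * t')) :=
    mul_pos (by linarith) (by linarith)
  nlinarith

/-- (1-t)² decreases in t while c·t does not. -/
theorem lt_of_sq_lt {s c : ℝ} (hs : s < 1) (hc : 0 ≤ c)
    (hs2 : (1 - s) ^ 2 = c * s) (h : (1 - t) ^ 2 < c * t) : s < t := by
  by_contra hcon
  push Not at hcon
  have h1 : (1 - s) ^ 2 ≤ (1 - t) ^ 2 := pow_le_pow_left₀ (by linarith) (by linarith) 2
  linarith [mul_le_mul_of_nonneg_left hcon hc]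

/-- z₁ is `zT` at s = (3-√5)/2, the solution of (1-s)² = s in (0, 1). From kT t < 1 follows s < t,
and `zT` increases on the P₈ branch. -/
theorem z₁_lt (hγ : 1 < γ) (ht : 0 < t) (ht1 : t < 1) (hP : γ * t ^ 2 ≤ 2 * (1 - t) ^ 2)
    (hk : kT t < 1) : z₁ γ < zT γ t := by
  have hs : √5 ^ 2 = (5 : ℝ) := Real.sq_sqrt (by norm_num)
  have hs3 : √5 < 3 := by rw [Real.sqrt_lt' (by norm_num)]; norm_num
  have hs1 : 1 < √5 := by rw [Real.lt_sqrt (by norm_num)]; norm_num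
  have e : z₁ γ = zT γ ((3 - √5) / 2) := by
    have hd := (dT_pos hγ (show 0 < (3 - √5) / 2 by linarith) (by linarith)).ne'
    rw [z₁, zT, div_eq_div_iff (by positivity) hd]
    linear_combination (√5 - 1) / 2 * hs
  rw [e]
  refine zT_lt_zT_of_flat hγ (by linarith) ht1 ?_ hP
  rw [kT, div_lt_one ht] at hk
  exact lt_of_sq_lt (c := 1) (by linarith) zero_le_one (by linear_combination hs / 4) (by linarith)

/-- As for `z₁_lt`, with s = (7-√33)/4 solving (1-s)² = (3/2)s. -/
theorem z₂_lt (hγ : 1 < γ) (ht : 0 < t) (ht1 : t < 1) (hP : γ * t ^ 2 ≤ 2 * (1 - t) ^ 2)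
    (hk : kT t < 3 / 2) : z₂ γ < zT γ t := by
  have hs : √33 ^ 2 = (33 : ℝ) := Real.sq_sqrt (by norm_num)
  have hs3 : √33 < 7 := by rw [Real.sqrt_lt' (by norm_num)]; norm_num
  have hs1 : 3 < √33 := by rw [Real.lt_sqrt (by norm_num)]; norm_num
  have e : z₂ γ = zT γ ((7 - √33) / 4) := by
    have hd := (dT_pos hγ (show 0 < (7 - √33) / 4 by linarith) (by linarith)).ne'
    rw [z₂, zT, div_eq_div_iff (by positivity) hd]
    linear_combination (√33 - 3) / 8 * hs
  rw [e]
  refine zT_lt_zT_of_flat hγ (by linarith) ht1 ?_ hP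
  rw [kT, div_lt_iff₀ ht] at hk
  exact lt_of_sq_lt (c := 3 / 2) (by linarith) (by norm_num) (by linear_combination hs / 16) hk

theorem quadratic_root_lt {A b e z : ℝ} (hA : 0 < A) (hb : 0 < b) (hz : 0 < z)
    (h : 0 < A * z ^ 2 + 2 * b * z - e) : (√(b ^ 2 + A * e) - b) / A < z := by
  rw [div_lt_iff₀ hA, sub_lt_iff_lt_add, Real.sqrt_lt' (by positivity)]
  nlinarith

theorem zg_lt (hm : m = 1 ∨ m = 2) (hγ : 1 < γ) (ht : 0 < t) (ht1 : t < 1)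
    (hP : 2 * (1 - t) ^ 2 ≤ γ * t ^ 2) (hθ : 0 < lT (m : ℝ) γ t - BT (m : ℝ) γ * t) :
    zg m γ < zT γ t := by
  have hz := zT_mul hγ ht ht1
  have hzp := zT_pos hγ ht ht1
  have hm0 : (0 : ℝ) < m := by rcases hm with rfl | rfl <;> norm_num
  have hroot : 2 * zT γ t / t ≤ t := by
    have : 0 ≤ t - 2 * zT γ t / t := by
      rw [t_sub_eq hγ ht ht1]
      exact div_nonneg (by linarith) (dT_pos hγ ht ht1).le
    linarith
  have hsum := sum_roots hγ ht ht1
  have hB : 0 < BT (m : ℝ) γ := by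
    have : 0 < m * (γ - 1) := mul_pos hm0 (by linarith)
    rw [BT]; linarith
  -- λ - B a is positive at t, hence also at the smaller root 2z/t. The product of the two values is
  -- symmetric in the roots, so it is a polynomial in z alone, with positive root z_g.
  have hH : 0 < lT (m : ℝ) γ t ^ 2 - (1 + (2 - γ) * zT γ t) * lT (m : ℝ) γ t * BT (m : ℝ) γ
      + 2 * zT γ t * BT (m : ℝ) γ ^ 2 := by
    have h2 : t * (2 * zT γ t / t) = 2 * zT γ t := by field_simp
    have e : lT (m : ℝ) γ t ^ 2 - (1 + (2 - γ) * zT γ t) * lT (m : ℝ) γ t * BT (m : ℝ) γ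
      + 2 * zT γ t * BT (m : ℝ) γ ^ 2 = (lT (m : ℝ) γ t - BT (m : ℝ) γ * t) *
        (lT (m : ℝ) γ t - BT (m : ℝ) γ * (2 * zT γ t / t)) := by
      linear_combination (lT (m : ℝ) γ t * BT (m : ℝ) γ) * hsum - BT (m : ℝ) γ ^ 2 * h2
    rw [e]
    refine mul_pos hθ ?_
    have := mul_le_mul_of_nonneg_left hroot hB.le
    linarith
  have hγ0 : 0 < γ - 1 := by linarith
  rcases hm with rfl | rfl
  · rw [zg, if_pos rfl]
    have := quadratic_root_lt (A := γ * (γ - 1)) (b := γ) (e := (γ - 1) / γ) (z := zT γ t)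
      (by positivity) (by positivity) hzp ?_
    · rwa [show γ ^ 2 + γ * (γ - 1) * ((γ - 1) / γ) = γ ^ 2 + (γ - 1) ^ 2 by field_simp] at this
    · rw [lT, BT] at hH
      push_cast at hH
      have e : γ * (γ - 1) * zT γ t ^ 2 + 2 * γ * zT γ t - (γ - 1) / γ =
        ((1 + 1 * γ * zT γ t) ^ 2 - (1 + (2 - γ) * zT γ t) * (1 + 1 * γ * zT γ t)
          * ((γ + 1 + 1 * (γ - 1)) / 2) + 2 * zT γ t * ((γ + 1 + 1 * (γ - 1)) / 2) ^ 2) / γ := by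
        field_simp; ring
      rw [e]; positivity
  · rw [zg, if_neg (by norm_num)]
    have := quadratic_root_lt (A := γ * (4 * γ * (γ - 1) + 8 / 3)) (b := 2 * γ ^ 2 - γ + 1)
      (e := 2 * (γ - 1)) (z := zT γ t) (by positivity) (by nlinarith) hzp ?_
    · rwa [show (2 * γ ^ 2 - γ + 1) ^ 2 + γ * (4 * γ * (γ - 1) + 8 / 3) * (2 * (γ - 1)) =
        (2 * γ ^ 2 - γ + 1) ^ 2 + 2 * γ * (γ - 1) * (4 * γ * (γ - 1) + 8 / 3) by ring] at this
    · rw [lT, BT] at hH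
      push_cast at hH
      linarith

/-! ### The threshold `γ⋆` -/

/-- The position of the triple point for `z = zM γ`. -/
noncomputable def aM (γ : ℝ) : ℝ := √2 / (√γ + √2)

theorem aM_pos (hγ : 1 < γ) : 0 < aM γ := by
  have : 0 < √γ := Real.sqrt_pos.2 (by linarith)
  rw [aM]; positivity

theorem one_sub_aM (hγ : 1 < γ) : 1 - aM γ = √γ / (√γ + √2) := by
  have : 0 < √γ := Real.sqrt_pos.2 (by linarith)
  have : √γ + √2 ≠ 0 := by positivity
  rw [aM]; field_simp; ring

theorem aM_lt_one (hγ : 1 < γ) : aM γ < 1 := by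
  have : 0 < √γ := Real.sqrt_pos.2 (by linarith)
  have h : 0 < 1 - aM γ := by rw [one_sub_aM hγ]; positivity
  linarith

theorem aM_balance (hγ : 1 < γ) : 2 * (1 - aM γ) ^ 2 = γ * aM γ ^ 2 := by
  have hp : √γ ^ 2 = γ := Real.sq_sqrt (by linarith)
  have hq : √2 ^ 2 = (2 : ℝ) := Real.sq_sqrt (by norm_num)
  rw [one_sub_aM hγ, aM, div_pow, div_pow, hp, hq]; ring

theorem zT_aM (hγ : 1 < γ) : zT γ (aM γ) = zM γ := by
  have hp : √γ ^ 2 = γ := Real.sq_sqrt (by linarith)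
  have hq : √2 ^ 2 = (2 : ℝ) := Real.sq_sqrt (by norm_num)
  have h0 : 0 < √γ := Real.sqrt_pos.2 (by linarith)
  have h2 : (0 : ℝ) < √2 := by positivity
  have hs : √γ + √2 ≠ 0 := by positivity
  have e : 2 - (2 - γ) * aM γ = √2 * √γ := by
    have : 2 - (2 - γ) * aM γ = 2 * (1 - aM γ) + γ * aM γ := by ring
    rw [this, one_sub_aM hγ, aM, ← mul_div_assoc, ← mul_div_assoc, ← add_div, div_eq_iff hs]
    linear_combination (-√2) * hp - √γ * hq
  rw [zT, e, one_sub_aM hγ, aM, zM]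
  field_simp

theorem kT_aM (hγ : 1 < γ) : kT (aM γ) = γ / (√(2 * γ) + 2) := by
  have hp : √γ ^ 2 = γ := Real.sq_sqrt (by linarith)
  have hq : √2 ^ 2 = (2 : ℝ) := Real.sq_sqrt (by norm_num)
  have h0 : 0 < √γ := Real.sqrt_pos.2 (by linarith)
  have h2 : (0 : ℝ) < √2 := by positivity
  have hs : √γ + √2 ≠ 0 := by positivity
  rw [kT, one_sub_aM hγ, aM, Real.sqrt_mul (by norm_num)]
  have : √2 * √γ + 2 = √2 * (√γ + √2) := by linear_combination -hq
  rw [this]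
  field_simp
  exact hp

theorem k_zM (hγ : 1 < γ) : k γ (zM γ) = kT (aM γ) := by
  rw [← zT_aM hγ, k, V₆_zT hγ (aM_pos hγ) (aM_lt_one hγ) (aM_balance hγ).le, kT, neg_div_neg_eq]
  ring_nf

/-- The sign of this function decides on which side of `γ⋆` the adiabatic index lies. -/
noncomputable def starFun (γ : ℝ) : ℝ := (γ - 1) * √(2 * γ) + γ - 3

theorem starFun_strictMonoOn : StrictMonoOn starFun (Ici 1) := by
  intro a ha b hb hab
  have ha' : (1 : ℝ) ≤ a := ha
  have h1 : √(2 * a) ≤ √(2 * b) := Real.sqrt_le_sqrt (by linarith)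
  have h2 : (a - 1) * √(2 * a) ≤ (b - 1) * √(2 * b) :=
    mul_le_mul (by linarith) h1 (Real.sqrt_nonneg _) (by linarith)
  simp only [starFun]; linarith

/-- Compares κ at the post-shock point with κ at the double triple point; a positive factor splits
off and leaves the increasing function `starFun`. -/
theorem kT_aM_sub (hγ : 1 < γ) : γ * (γ - 1) / (γ + 1) - kT (aM γ) =
    γ / ((γ + 1) * (√(2 * γ) + 2)) * starFun γ := by
  have h0 : 0 ≤ √(2 * γ) := Real.sqrt_nonneg _
  have h1 : √(2 * γ) + 2 ≠ 0 := by positivity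
  have h2 : γ + 1 ≠ 0 := by linarith
  rw [kT_aM hγ, starFun]
  field_simp
  ring

theorem isGammaStar_iff (hγ : 1 < γ) : IsGammaStar γ ↔ starFun γ = 0 := by
  have ha := two_div_add_one_pos hγ
  have h0 : 0 < γ / ((γ + 1) * (√(2 * γ) + 2)) := by positivity
  have e : IsGammaStar γ ↔ γ * (γ - 1) / (γ + 1) = kT (aM γ) := by
    rw [IsGammaStar, and_iff_right hγ, k_zM hγ, V₁_eq, neg_mul_neg]
    have hk := kT_pos (aM_pos hγ) (aM_lt_one hγ)
    constructor
    · intro h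
      have h1 := C₁_sq hγ
      rw [h, Real.sq_sqrt (by positivity)] at h1
      exact (mul_right_cancel₀ ha.ne' h1).symm
    · intro h
      rw [← h, ← C₁_sq hγ, Real.sqrt_sq (C₁_pos hγ).le]
  rw [e, ← sub_eq_zero, kT_aM_sub hγ, mul_eq_zero, or_iff_right h0.ne']

theorem exists_gammaStar : ∃ γs : ℝ, (∀ g : ℝ, IsGammaStar g ↔ g = γs) ∧ 5 / 3 < γs ∧ γs < 2 ∧
    starFun γs = 0 := by
  have hcont : ContinuousOn starFun (Icc (5 / 3) 2) := by unfold starFun; fun_prop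
  have h1 : starFun (5 / 3) < 0 := by
    have : √(2 * (5 / 3)) < (2 : ℝ) := by rw [Real.sqrt_lt' (by norm_num)]; norm_num
    rw [starFun]; linarith
  have h2 : 0 < starFun 2 := by
    have : (1 : ℝ) < √(2 * 2) := by rw [Real.lt_sqrt (by norm_num)]; norm_num
    rw [starFun]; linarith
  obtain ⟨γs, hs, h0⟩ := intermediate_value_Ioo (by norm_num) hcont ⟨h1, h2⟩
  refine ⟨γs, fun g => ⟨fun h => ?_, ?_⟩, hs.1, hs.2, h0⟩
  · have h3 := (isGammaStar_iff h.1).1 h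
    exact starFun_strictMonoOn.injOn h.1.le (show (1 : ℝ) ≤ γs by linarith [hs.1]) (h3.trans h0.symm)
  · rintro rfl
    exact (isGammaStar_iff (by linarith [hs.1])).2 h0

/-- `kT` is decreasing, and `starFun` ≤ 0 turns the barrier bound into kT t < kT (aM γ); so t > aM
γ, the place where P₆ and P₈ merge. -/
theorem steep_of_kT_lt (hγ : 1 < γ) (ht : 0 < t) (ht1 : t < 1) (hs : starFun γ ≤ 0)
    (hk : kT t < γ * (γ - 1) / (γ + 1)) : 2 * (1 - t) ^ 2 < γ * t ^ 2 := by
  have h0 : 0 < γ / ((γ + 1) * (√(2 * γ) + 2)) := by positivity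
  have h1 := kT_aM_sub hγ
  have h2 := mul_nonpos_of_nonneg_of_nonpos h0.le hs
  have h3 : kT t < kT (aM γ) := by linarith
  have h4 : aM γ < t := by
    by_contra hcon
    push Not at hcon
    have : kT (aM γ) ≤ kT t := by
      rw [kT, kT]
      have := aM_lt_one hγ
      gcongr
    linarith
  have h5 := aM_balance hγ
  have h6 : aM γ ^ 2 < t ^ 2 := pow_lt_pow_left₀ h4 (aM_pos hγ).le two_ne_zero
  have h7 : (1 - t) ^ 2 < (1 - aM γ) ^ 2 :=
    pow_lt_pow_left₀ (by linarith) (by linarith) two_ne_zero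
  nlinarith

/-! ### Location of the triple point of a connection -/

namespace IsConnection

theorem eq_t_of_sonic (h : IsConnection m γ z C)
    (ht : t ∈ Ioc 0 (2 / (γ + 1))) (hC : C (-t) = 1 - t) {P : ℝ} (hP : P ∈ Ico (V₁ γ) 0)
    (hCP : C P = 1 + P) : P = -t := by
  have ht' := neg_mem ht
  rcases lt_trichotomy P (-t) with h1 | h1 | h1
  · have := h.decreasing hP ht' h1
    linarith
  · exact h1
  · have := h.decreasing ht' hP h1
    linarith

/-- If t lay strictly on the P₈ side, then V₆ = V₈, against w > 0. -/
theorem passesThrough_six_iff (h : IsConnection m γ (zT γ t) C) (hγ : 1 < γ)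
    (ht : t ∈ Ioc 0 (2 / (γ + 1))) (hC : C (-t) = 1 - t) :
    PassesThrough γ C (P₆ γ (zT γ t)) ↔ 2 * (1 - t) ^ 2 ≤ γ * t ^ 2 := by
  have ht1 : t < 1 := ht.2.trans_lt (two_div_lt_one hγ)
  constructor
  · rintro ⟨h1, h2⟩
    have h3 := h.eq_t_of_sonic ht hC h1 h2
    change V₆ γ (zT γ t) = -t at h3
    by_contra hcon
    push Not at hcon
    have h4 := V₈_zT hγ ht.1 ht1 hcon.le
    have h5 := w_zT_pos hγ ht.1 ht1 hcon.ne
    rw [← h3, V₆, V₈] at h4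
    linarith
  · intro h1
    have h2 := V₆_zT hγ ht.1 ht1 h1
    rw [PassesThrough, P₆, h2]
    exact ⟨neg_mem ht, by rw [hC]; ring⟩

theorem passesThrough_eight_iff (h : IsConnection m γ (zT γ t) C) (hγ : 1 < γ)
    (ht : t ∈ Ioc 0 (2 / (γ + 1))) (hC : C (-t) = 1 - t) :
    PassesThrough γ C (P₈ γ (zT γ t)) ↔ γ * t ^ 2 ≤ 2 * (1 - t) ^ 2 := by
  have ht1 : t < 1 := ht.2.trans_lt (two_div_lt_one hγ)
  constructor
  · rintro ⟨h1, h2⟩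
    have h3 := h.eq_t_of_sonic ht hC h1 h2
    change V₈ γ (zT γ t) = -t at h3
    by_contra hcon
    push Not at hcon
    have h4 := V₆_zT hγ ht.1 ht1 hcon.le
    have h5 := w_zT_pos hγ ht.1 ht1 hcon.ne'
    rw [← h3, V₆, V₈] at h4
    linarith
  · intro h1
    have h2 := V₈_zT hγ ht.1 ht1 h1
    rw [PassesThrough, P₈, h2]
    exact ⟨neg_mem ht, by rw [hC]; ring⟩

end IsConnection

end ShockODE

namespace ShockODE

/-! ### The local analytic orbit through the triple point -/

/-- Briot-Bouquet equations with analytic right-hand side over a compact set of parameters. -/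
theorem exists_briotBouquet_of_isCompact {K : Set ℝ} (hK : IsCompact K) {h₀ : ℝ → ℝ}
    (hc : ContinuousOn h₀ K) {f : ℂ × ℂ × ℂ → ℂ} {W : Set (ℂ × ℂ × ℂ)} (hW : IsOpen W)
    (hWK : ∀ x ∈ K, ((x : ℂ), (0 : ℂ), (h₀ x : ℂ)) ∈ W)
    (han : ∀ p ∈ W, AnalyticAt ℂ f p)
    (hfix : ∀ x ∈ K, f (x, 0, h₀ x) = h₀ x)
    (hder : ∀ x ∈ K, ‖fderiv ℂ f (x, 0, h₀ x) (0, 0, 1)‖ < 1)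
    (hreal : ∀ x ξ η : ℝ, (f (x, ξ, η)).im = 0) :
    ∃ r > 0, ∃ H : ℝ → ℂ → ℂ, (∀ ξ ∈ Metric.ball (0 : ℂ) r, ContinuousOn (fun x => H x ξ) K) ∧
      (∀ x ∈ K, DifferentiableOn ℂ (H x) (Metric.ball 0 r)) ∧
      (∀ x ∈ K, ∀ ξ ∈ Metric.ball (0 : ℂ) r, ((x : ℂ), ξ, H x ξ) ∈ W) ∧
      (∀ x ∈ K, ∀ ξ : ℝ, |ξ| < r → (H x ξ).im = 0) ∧
      ∀ x ∈ K, ∀ ξ ∈ Metric.ball (0 : ℂ) r,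
        HasDerivAt (fun w => w * H x w) (f (x, ξ, H x ξ)) ξ := by
  rcases K.eq_empty_or_nonempty with rfl | hne
  · exact ⟨1, one_pos, fun _ _ => 0, by simp⟩
  set ι : ℝ → ℂ × ℂ × ℂ := fun x => ((x : ℂ), (0 : ℂ), (h₀ x : ℂ)) with hι
  have hιc : ContinuousOn ι K := by
    refine Complex.continuous_ofReal.continuousOn.prodMk (continuousOn_const.prodMk ?_)
    exact Complex.continuous_ofReal.comp_continuousOn hc
  have hΓ : IsCompact (ι '' K) := hK.image_of_continuousOn hιc
  have hdc : ContinuousOn (fun p => ‖fderiv ℂ f p (0, 0, 1)‖) W := fun p hp =>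
    (((han p hp).fderiv.continuousAt.clm_apply continuousAt_const).norm).continuousWithinAt
  obtain ⟨x₁, hx₁, hmax⟩ := hK.exists_isMaxOn hne (hdc.comp hιc hWK)
  set q₀ := ‖fderiv ℂ f (ι x₁) (0, 0, 1)‖ with hq₀
  have hq₀1 : q₀ < 1 := hder x₁ hx₁
  have hq₀0 : 0 ≤ q₀ := norm_nonneg _
  set q := (1 + q₀) / 2 with hq
  -- Compactness of the set of initial points gives one tube on which f is analytic and its
  -- η-derivative is below q, midway between the maximum q₀ and 1.
  obtain ⟨δ, hδ, hδW⟩ := hΓ.exists_thickening_subset_open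
    (hdc.isOpen_inter_preimage hW (isOpen_Iio (a := q))) (by
      rintro _ ⟨x, hx, rfl⟩
      refine ⟨hWK x hx, ?_⟩
      have : ‖fderiv ℂ f (ι x) (0, 0, 1)‖ ≤ q₀ := hmax hx
      change ‖fderiv ℂ f (ι x) (0, 0, 1)‖ < q
      rw [hq]; linarith)
  set ρ := δ / 2 with hρ
  have hsc : ContinuousOn (fun p : ℂ × ℂ × ℂ => ‖f p - p.2.2‖) W := fun p hp =>
    (((han p hp).continuousAt.sub (by fun_prop)).norm).continuousWithinAt
  have hqρ : 0 < (1 - q) * ρ := mul_pos (by rw [hq]; linarith) (by positivity)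
  -- A second tube, on which f moves η by less than (1-q)ρ, so that the iteration stays in its ball.
  obtain ⟨δ', hδ', hδW'⟩ := hΓ.exists_thickening_subset_open
    (hsc.isOpen_inter_preimage hW (isOpen_Iio (a := (1 - q) * ρ))) (by
      rintro _ ⟨x, hx, rfl⟩
      refine ⟨hWK x hx, ?_⟩
      change ‖f (ι x) - (h₀ x : ℂ)‖ < _
      rw [hfix x hx, sub_self, norm_zero]; exact hqρ)
  set r := min δ δ' with hr
  have hin : ∀ x ∈ K, ∀ ξ ∈ Metric.ball (0 : ℂ) r, ∀ η ∈ Metric.closedBall (h₀ x : ℂ) ρ,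
      ((x : ℂ), ξ, η) ∈ W ∧ ‖fderiv ℂ f (x, ξ, η) (0, 0, 1)‖ < q := by
    intro x hx ξ hξ η hη
    refine hδW (Metric.mem_thickening_iff.2 ⟨ι x, mem_image_of_mem _ hx, ?_⟩)
    rw [Metric.mem_ball] at hξ
    rw [Metric.mem_closedBall] at hη
    rw [Prod.dist_eq, Prod.dist_eq, dist_self]
    refine max_lt hδ (max_lt (hξ.trans_le (min_le_left _ _)) ?_)
    change dist η (h₀ x : ℂ) < δ
    linarith
  have hcurve : ∀ (x : ℝ) (ξ η : ℂ), ((x : ℂ), ξ, η) ∈ W →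
      HasDerivAt (fun e => f (x, ξ, e)) (fderiv ℂ f (x, ξ, η) (0, 0, 1)) η := by
    intro x ξ η h
    have h1 := (han _ h).differentiableAt.hasFDerivAt
    have h2 : HasDerivAt (fun e : ℂ => ((x : ℂ), ξ, e)) ((0 : ℂ), (0 : ℂ), (1 : ℂ)) η :=
      (hasDerivAt_const η (x : ℂ)).prodMk ((hasDerivAt_const η ξ).prodMk (hasDerivAt_id' η))
    exact h1.comp_hasDerivAt η h2
  obtain ⟨M, hM⟩ := hK.exists_bound_of_continuousOn hc
  have key := exists_briotBouquet (K := K) (h₀ := h₀)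
    (Ψ := fun x ξ η => f (x, ξ, η)) (r := r) (ρ := ρ) (q := q) (M := M) (by positivity)
    (by rw [hq]; linarith) (by rw [hq]; linarith) hc hM ?_ ?_ ?_ ?_ (fun x _ ξ η => hreal x ξ η)
  · obtain ⟨H, h1, h2, h3, h4, h5⟩ := key
    exact ⟨r, lt_min hδ hδ', H, h1, h2, fun x hx ξ hξ => (hin x hx ξ hξ _ (h3 x hx ξ hξ)).1, h4, h5⟩
  · intro x hx ξ hξ η hη
    have h1 := (han _ (hin x hx ξ hξ η hη).1).continuousAt
    refine ContinuousAt.continuousWithinAt ?_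
    refine ContinuousAt.comp (f := fun p : ℝ × ℂ => ((p.1 : ℂ), ξ, p.2)) (g := f) h1 ?_
    exact Continuous.continuousAt (by fun_prop)
  · intro x hx ξ hξ η hη η' hη'
    exact (convex_closedBall _ _).norm_image_sub_le_of_norm_hasDerivWithin_le
      (fun e he => (hcurve x ξ e (hin x hx ξ hξ e he).1).hasDerivWithinAt)
      (fun e he => (hin x hx ξ hξ e he).2.le) hη' hη
  · intro x hx ξ hξ
    have h6 : ((x : ℂ), ξ, (h₀ x : ℂ)) ∈ _ :=
      hδW' (Metric.mem_thickening_iff.2 ⟨ι x, mem_image_of_mem _ hx, by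
        rw [Metric.mem_ball] at hξ
        rw [Prod.dist_eq, Prod.dist_eq, dist_self]
        refine max_lt hδ' (max_lt (hξ.trans_le (min_le_right _ _)) ?_)
        change dist (h₀ x : ℂ) (h₀ x : ℂ) < δ'
        rw [dist_self]; exact hδ'⟩)
    exact (show ‖f (x, ξ, h₀ x) - (h₀ x : ℂ)‖ < _ from h6.2).le
  · intro x hx ξ hξ η hη
    have h1 := (han _ (hin x hx ξ hξ η hη).1).differentiableAt
    refine DifferentiableAt.comp (f := fun p : ℂ × ℂ => ((x : ℂ), p.1, p.2)) (g := f) (ξ, η) h1 ?_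
    exact Differentiable.differentiableAt (by fun_prop)

variable {m γ t : ℝ}

/-- The slope of the orbit at the triple point: the positive root of a quadratic equation. -/
noncomputable def etaT (m γ t : ℝ) : ℝ :=
  let c := cT m γ t t
  let p := bT m γ t - t - kT t * (-1 / t + (γ - 1) / (1 - t)) * c
    - kT t * (2 * (lT m γ t - BT m γ * t) / ((1 - t) * t)) * t
  let e := kT t * eT m γ t t / (t * (1 - t))
  (-p + √(p ^ 2 + 4 * c * e)) / (2 * c)

/-- Vieta: t and `bT` are the roots of G / a on the line κ = kT t. -/
theorem bT_eq (hγ : 1 < γ) (ht : 0 < t) (ht1 : t < 1) :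
    bT m γ t = (m + 1) * kT t + 1 + lT m γ t - t := by
  have h1 := one_sub_mul_cT (m := m) hγ ht ht1
  have hk : kT t * t = (1 - t) ^ 2 := div_mul_cancel₀ _ ht.ne'
  have hb : bT m γ t * t = lT m γ t + 2 * kT t * m * zT γ t := div_mul_cancel₀ _ ht.ne'
  have h2 : t * (kT t * cT m γ t t) = t * ((1 - t) * (lT m γ t - t)) := by
    linear_combination (cT m γ t t) * hk + (1 - t) * h1
  have h3 := mul_left_cancel₀ ht.ne' h2
  rw [cT] at h3
  apply mul_left_cancel₀ ht.ne'
  linear_combination hb - h3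

/-- The trace of the linearization at the triple point has a sign. -/
theorem trace_pos (hm : 0 < m) (hγ : 1 < γ) (ht : 0 < t) (ht1 : t < 1)
    (hθ : 0 ≤ lT m γ t - BT m γ * t) :
    0 < bT m γ t - t + kT t * (-1 / t + (γ - 1) / (1 - t)) * cT m γ t t
      + kT t * (2 * (lT m γ t - BT m γ * t) / ((1 - t) * t)) * t := by
  have hy : 0 < 1 - t := by linarith
  have hd := dT_pos hγ ht ht1
  have hk := kT_pos ht ht1
  have h1 : 0 ≤ kT t * (2 * (lT m γ t - BT m γ * t) / ((1 - t) * t)) * t := by positivity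
  have hc : cT m γ t t = t * (lT m γ t - t) / (1 - t) := by
    rw [eq_div_iff hy.ne', ← one_sub_mul_cT hγ ht ht1]; ring
  have hl : lT m γ t = 1 + m * γ * (t * (1 - t) / (2 - (2 - γ) * t)) := by rw [lT, zT]
  -- The part free of λ - B t is an explicit expression with positive terms only.
  have e : bT m γ t - t + kT t * (-1 / t + (γ - 1) / (1 - t)) * cT m γ t t =
      (1 - t) / (t * (2 - (2 - γ) * t)) *
        (2 * m * (1 - t) ^ 2 + (1 + γ) * t * (2 - (2 - γ) * t) + m * γ ^ 2 * t ^ 2) := by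
    rw [bT_eq hγ ht ht1, hc, hl, kT]
    set d := 2 - (2 - γ) * t with hd'
    have hd2 : 2 = d + (2 - γ) * t := by rw [hd']; ring
    have hy' := hy.ne'
    field_simp
    rw [hd']
    ring
  have h2 : 0 < 2 * m * (1 - t) ^ 2 + (1 + γ) * t * (2 - (2 - γ) * t) + m * γ ^ 2 * t ^ 2 := by
    have : 0 < 1 + γ := by linarith
    positivity
  have h3 : 0 < (1 - t) / (t * (2 - (2 - γ) * t)) := by positivity
  rw [e]
  have := mul_pos h3 h2
  linarith

/-- `eT` > 0 makes the product of the two roots negative, so the larger one is positive. -/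
theorem etaT_pos (hm : 0 < m) (hγ : 1 < γ) (ht : 0 < t) (ht1 : t < 1)
    (hE : 0 < eT m γ t t) : 0 < etaT m γ t := by
  have hc := cT_pos hm hγ ht ht1 le_rfl
  have hk := kT_pos ht ht1
  have hy : 0 < 1 - t := by linarith
  rw [etaT]
  refine div_pos ?_ (by positivity)
  set p := bT m γ t - t - kT t * (-1 / t + (γ - 1) / (1 - t)) * cT m γ t t
    - kT t * (2 * (lT m γ t - BT m γ * t) / ((1 - t) * t)) * t
  have : |p| < √(p ^ 2 + 4 * cT m γ t t * (kT t * eT m γ t t / (t * (1 - t)))) := by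
    rw [← Real.sqrt_sq_eq_abs]
    refine Real.sqrt_lt_sqrt (sq_nonneg _) ?_
    have : 0 < 4 * cT m γ t t * (kT t * eT m γ t t / (t * (1 - t))) := by positivity
    linarith
  have := le_abs_self p
  linarith

theorem denT_etaT_pos (hm : 0 < m) (hγ : 1 < γ) (ht : 0 < t) (ht1 : t < 1)
    (hE : 0 < eT m γ t t) : 0 < denT m γ t t (etaT m γ t) := by
  have h1 := etaT_pos hm hγ ht ht1 hE
  have hb := one_div_lt_bT hm hγ ht ht1
  have hti := one_lt_one_div ht ht1
  have hc := cT_pos hm hγ ht ht1 le_rfl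
  have := mul_pos h1 hc
  rw [denT]; linarith

theorem etaT_root (hm : 0 < m) (hγ : 1 < γ) (ht : 0 < t) (ht1 : t < 1)
    (hE : 0 < eT m γ t t) : etaT m γ t * denT m γ t t (etaT m γ t) =
    kT t * (-1 / t + (γ - 1) / (1 - t)) * denT m γ t t (etaT m γ t)
      + kT t * (2 * (lT m γ t - BT m γ * t) / ((1 - t) * t)) * numT t t (etaT m γ t) := by
  have hc := cT_pos hm hγ ht ht1 le_rfl
  have hk := kT_pos ht ht1
  have hy : 0 < 1 - t := by linarith
  have hE' : kT t * eT m γ t t / (t * (1 - t)) = kT t * (-1 / t + (γ - 1) / (1 - t)) * (bT m γ t - t)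
      + kT t * (2 * (lT m γ t - BT m γ * t) / ((1 - t) * t)) * (1 / t - t) := by
    rw [eT]; field_simp; ring
  set c₀ := kT t * (-1 / t + (γ - 1) / (1 - t)) with hc₀
  set c₁ := kT t * (2 * (lT m γ t - BT m γ * t) / ((1 - t) * t)) with hc₁
  set c := cT m γ t t with hcc
  have he : 0 < kT t * eT m γ t t / (t * (1 - t)) := by positivity
  set e := kT t * eT m γ t t / (t * (1 - t)) with hee
  set p := bT m γ t - t - c₀ * c - c₁ * t with hp
  have hη : etaT m γ t = (-p + √(p ^ 2 + 4 * c * e)) / (2 * c) := rfl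
  have hs : √(p ^ 2 + 4 * c * e) ^ 2 = p ^ 2 + 4 * c * e := Real.sq_sqrt (by positivity)
  have h2 : 2 * c * etaT m γ t + p = √(p ^ 2 + 4 * c * e) := by
    rw [hη]; field_simp; ring
  rw [← h2] at hs
  have h3 : c * (c * etaT m γ t ^ 2 + p * etaT m γ t - e) = c * 0 := by linear_combination hs / 4
  have h4 := mul_left_cancel₀ hc.ne' h3
  rw [denT, numT, ← hcc]
  rw [hp, hE'] at h4
  linear_combination h4

/-- The contraction condition of the Briot-Bouquet equation. The bound by 1 holds since `etaT` is
the larger root, where the quadratic has positive derivative; the bound by -1 is `trace_pos`. -/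
theorem abs_slope_lt_one (hm : 0 < m) (hγ : 1 < γ) (ht : 0 < t) (ht1 : t < 1)
    (hE : 0 < eT m γ t t) (hθ : 0 ≤ lT m γ t - BT m γ * t) :
    |kT t * (2 * (lT m γ t - BT m γ * t) / ((1 - t) * t)) *
      ((t * denT m γ t t (etaT m γ t) - numT t t (etaT m γ t) * cT m γ t t)
        / denT m γ t t (etaT m γ t) ^ 2)| < 1 := by
  have hc := cT_pos hm hγ ht ht1 le_rfl
  have hk := kT_pos ht ht1
  have hy : 0 < 1 - t := by linarith
  have hp := denT_etaT_pos hm hγ ht ht1 hE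
  have hroot := etaT_root hm hγ ht ht1 hE
  have htr := trace_pos hm hγ ht ht1 hθ
  have hE' : kT t * eT m γ t t / (t * (1 - t)) = kT t * (-1 / t + (γ - 1) / (1 - t)) * (bT m γ t - t)
      + kT t * (2 * (lT m γ t - BT m γ * t) / ((1 - t) * t)) * (1 / t - t) := by
    rw [eT]; field_simp; ring
  have he : 0 < kT t * eT m γ t t / (t * (1 - t)) := by positivity
  have hη : etaT m γ t = (-(bT m γ t - t - kT t * (-1 / t + (γ - 1) / (1 - t)) * cT m γ t t
    - kT t * (2 * (lT m γ t - BT m γ * t) / ((1 - t) * t)) * t) + √((bT m γ t - t - kT t * (-1 / t + (γ - 1) / (1 - t)) * cT m γ t t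
    - kT t * (2 * (lT m γ t - BT m γ * t) / ((1 - t) * t)) * t) ^ 2 + 4 * cT m γ t t * (kT t * eT m γ t t / (t * (1 - t))))) / (2 * cT m γ t t) := rfl
  set c₀ := kT t * (-1 / t + (γ - 1) / (1 - t)) with hc₀
  set c₁ := kT t * (2 * (lT m γ t - BT m γ * t) / ((1 - t) * t)) with hc₁
  set c := cT m γ t t with hcc
  set p := bT m γ t - t - c₀ * c - c₁ * t with hpp
  set e := kT t * eT m γ t t / (t * (1 - t)) with hee
  have h2 : 2 * c * etaT m γ t + p = √(p ^ 2 + 4 * c * e) := by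
    rw [hη]; field_simp; ring
  have h3 : 0 < 2 * c * etaT m γ t + p := by
    rw [h2]; exact Real.sqrt_pos.2 (by positivity)
  set P := denT m γ t t (etaT m γ t) with hP
  have hPe : P = bT m γ t - t + etaT m γ t * c := rfl
  have hNe : numT t t (etaT m γ t) = 1 / t - t + t * etaT m γ t := rfl
  have key1 : c₁ * (t * P - numT t t (etaT m γ t) * c) =
      P ^ 2 - P * (2 * c * etaT m γ t + p) := by
    linear_combination c * hroot + P * hpp - P * hPe
  have key2 : c₁ * (t * P - numT t t (etaT m γ t) * c) =
      -P ^ 2 + P * (bT m γ t - t + c₀ * c + c₁ * t) := by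
    linear_combination c * hroot + P * hPe
  rw [← mul_div_assoc, abs_lt, lt_div_iff₀ (by positivity), div_lt_iff₀ (by positivity)]
  constructor
  · have := mul_pos hp htr
    linarith
  · have := mul_pos hp h3
    linarith

end ShockODE

namespace ShockODE

/-! ### Agreement of the real and complex formulas -/

section Cast

variable (m γ t a η : ℝ)

theorem ofReal_zT : ((zT γ t : ℝ) : ℂ) = zT (γ : ℂ) t := by simp [zT]

theorem ofReal_lT : ((lT m γ t : ℝ) : ℂ) = lT (m : ℂ) γ t := by simp [lT, ofReal_zT]

theorem ofReal_BT : ((BT m γ : ℝ) : ℂ) = BT (m : ℂ) γ := by simp [BT]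

theorem ofReal_kT : ((kT t : ℝ) : ℂ) = kT (t : ℂ) := by simp [kT]

theorem ofReal_bT : ((bT m γ t : ℝ) : ℂ) = bT (m : ℂ) γ t := by
  simp [bT, ofReal_zT, ofReal_lT, ofReal_kT]

theorem ofReal_cT : ((cT m γ t a : ℝ) : ℂ) = cT (m : ℂ) γ t a := by simp [cT, ofReal_zT]

theorem ofReal_numT : ((numT t a η : ℝ) : ℂ) = numT (t : ℂ) a η := by simp [numT]

theorem ofReal_denT : ((denT m γ t a η : ℝ) : ℂ) = denT (m : ℂ) γ t a η := by
  simp [denT, ofReal_bT, ofReal_cT]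

theorem ofReal_psi : ((psi m γ t a η : ℝ) : ℂ) = psi (m : ℂ) γ t a η := by
  have h1 : ((numT t (t + a) η : ℝ) : ℂ) = numT (t : ℂ) (t + a) η := by simp [numT]
  have h2 : ((denT m γ t (t + a) η : ℝ) : ℂ) = denT (m : ℂ) γ t (t + a) η := by
    rw [ofReal_denT]; simp
  simp [psi, ← h1, ← h2, ofReal_lT, ofReal_kT, ofReal_BT]

end Cast

/-! ### The Briot-Bouquet equation at the triple points -/

variable {m γ t : ℝ}

theorem analyticAt_psi {E : Type*} [NormedAddCommGroup E] [NormedSpace ℂ E] {x ξ η : E → ℂ} {p : E}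
    (hx : AnalyticAt ℂ x p) (hξ : AnalyticAt ℂ ξ p) (hη : AnalyticAt ℂ η p)
    (h1 : x p ≠ 0) (h2 : 2 - (2 - (γ : ℂ)) * x p ≠ 0)
    (h3 : x p + ξ p ≠ 0) (h4 : 1 - (x p + ξ p) ≠ 0)
    (h5 : denT (m : ℂ) γ (x p) (x p + ξ p) (η p) ≠ 0) :
    AnalyticAt ℂ (fun p => psi (m : ℂ) γ (x p) (ξ p) (η p)) p := by
  have hz : AnalyticAt ℂ (fun p => zT (γ : ℂ) (x p)) p := by
    unfold zT; fun_prop (disch := assumption)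
  have hl : AnalyticAt ℂ (fun p => lT (m : ℂ) γ (x p)) p := by
    unfold lT; fun_prop (disch := assumption)
  have hk : AnalyticAt ℂ (fun p => kT (x p)) p := by
    unfold kT; fun_prop (disch := assumption)
  have hb : AnalyticAt ℂ (fun p => bT (m : ℂ) γ (x p)) p := by
    unfold bT; fun_prop (disch := assumption)
  have hc : AnalyticAt ℂ (fun p => cT (m : ℂ) γ (x p) (x p + ξ p)) p := by
    unfold cT; fun_prop (disch := assumption)
  have hn : AnalyticAt ℂ (fun p => numT (x p) (x p + ξ p) (η p)) p := by
    unfold numT; fun_prop (disch := assumption)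
  have hd : AnalyticAt ℂ (fun p => denT (m : ℂ) γ (x p) (x p + ξ p) (η p)) p := by
    unfold denT; fun_prop (disch := assumption)
  have h6 : (1 - (x p + ξ p)) * (x p + ξ p) ≠ 0 := mul_ne_zero h4 h3
  unfold psi
  fun_prop (disch := assumption)

theorem hasDerivAt_psi_zero (η : ℂ) (h5 : denT (m : ℂ) γ t t η ≠ 0) :
    HasDerivAt (fun e => psi (m : ℂ) γ t 0 e)
      (kT (t : ℂ) * (2 * (lT (m : ℂ) γ t - BT (m : ℂ) γ * t) / ((1 - t) * t)) *
        ((t * denT (m : ℂ) γ t t η - numT (t : ℂ) t η * cT (m : ℂ) γ t t)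
          / denT (m : ℂ) γ t t η ^ 2)) η := by
  have hn : HasDerivAt (fun e => numT (t : ℂ) t e) t η := by
    unfold numT
    simpa using ((hasDerivAt_id' η).const_mul (t : ℂ)).const_add (1 / (t : ℂ) - t)
  have hd : HasDerivAt (fun e => denT (m : ℂ) γ t t e) (cT (m : ℂ) γ t t) η := by
    unfold denT
    simpa using ((hasDerivAt_id' η).mul_const (cT (m : ℂ) γ t t)).const_add (bT (m : ℂ) γ t - t)
  have h := (((hn.fun_div hd h5).const_mul
    (2 * (lT (m : ℂ) γ t - BT (m : ℂ) γ * t) / ((1 - t) * t))).const_add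
    (-1 / (t : ℂ) + (γ - 1) / (1 - t))).const_mul (kT (t : ℂ))
  have e : (fun e => psi (m : ℂ) γ t 0 e) = fun y => kT (t : ℂ) * (-1 / (t : ℂ) + (γ - 1) / (1 - t)
      + 2 * (lT (m : ℂ) γ t - BT (m : ℂ) γ * t) / ((1 - t) * t)
        * (numT (t : ℂ) t y / denT (m : ℂ) γ t t y)) := by
    funext y; simp only [psi, zero_mul, add_zero]
  rw [e]
  refine h.congr_deriv ?_
  ring

theorem psi_zero_etaT (hm : 0 < m) (hγ : 1 < γ) (ht : 0 < t) (ht1 : t < 1)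
    (hE : 0 < eT m γ t t) : psi m γ t 0 (etaT m γ t) = etaT m γ t := by
  have hp := denT_etaT_pos hm hγ ht ht1 hE
  have hroot := etaT_root hm hγ ht ht1 hE
  simp only [psi, zero_mul, add_zero]
  apply mul_right_cancel₀ hp.ne'
  rw [hroot]
  field_simp

theorem continuousOn_etaT {K : Set ℝ} (hm : 0 < m) (hγ : 1 < γ) (hK : ∀ t ∈ K, 0 < t ∧ t < 1) :
    ContinuousOn (etaT m γ) K := by
  have h1 : ∀ t ∈ K, t ≠ 0 := fun t ht => (hK t ht).1.ne'
  have h2 : ∀ t ∈ K, 2 - (2 - γ) * t ≠ 0 := fun t ht => (dT_pos hγ (hK t ht).1 (hK t ht).2).ne'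
  have h3 : ∀ t ∈ K, 1 - t ≠ 0 := fun t ht => by linarith [(hK t ht).2]
  have h4 : ∀ t ∈ K, 2 * cT m γ t t ≠ 0 := fun t ht =>
    (mul_pos two_pos (cT_pos hm hγ (hK t ht).1 (hK t ht).2 le_rfl)).ne'
  have h5 : ∀ t ∈ K, (1 - t) * t ≠ 0 := fun t ht => mul_ne_zero (h3 t ht) (h1 t ht)
  have h6 : ∀ t ∈ K, t * (1 - t) ≠ 0 := fun t ht => mul_ne_zero (h1 t ht) (h3 t ht)
  have hz : ContinuousOn (fun t => zT γ t) K := by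
    unfold zT; fun_prop (disch := assumption)
  have hl : ContinuousOn (fun t => lT m γ t) K := by
    unfold lT; fun_prop (disch := assumption)
  have hk : ContinuousOn (fun t : ℝ => kT t) K := by
    unfold kT; fun_prop (disch := assumption)
  have hb : ContinuousOn (fun t => bT m γ t) K := by
    unfold bT; fun_prop (disch := assumption)
  have hc : ContinuousOn (fun t => cT m γ t t) K := by
    unfold cT; fun_prop (disch := assumption)
  have he : ContinuousOn (fun t => eT m γ t t) K := by
    unfold eT; fun_prop (disch := assumption)
  have : etaT m γ = fun t => (-(bT m γ t - t - kT t * (-1 / t + (γ - 1) / (1 - t)) * cT m γ t t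
      - kT t * (2 * (lT m γ t - BT m γ * t) / ((1 - t) * t)) * t)
      + √((bT m γ t - t - kT t * (-1 / t + (γ - 1) / (1 - t)) * cT m γ t t
      - kT t * (2 * (lT m γ t - BT m γ * t) / ((1 - t) * t)) * t) ^ 2
        + 4 * cT m γ t t * (kT t * eT m γ t t / (t * (1 - t))))) / (2 * cT m γ t t) := rfl
  rw [this]
  fun_prop (disch := assumption)

/-- The family of local analytic orbits through the triple points. -/
theorem exists_local_orbit {K : Set ℝ} (hKc : IsCompact K) (hm : 0 < m) (hγ : 1 < γ)
    (hK : ∀ t ∈ K, 0 < t ∧ t < 1) (hE : ∀ t ∈ K, 0 < eT m γ t t)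
    (hθ : ∀ t ∈ K, 0 ≤ lT m γ t - BT m γ * t) :
    ∃ r > 0, ∃ η : ℝ → ℝ → ℝ, (∀ ξ, |ξ| < r → ContinuousOn (fun t => η t ξ) K) ∧
      ∀ t ∈ K, ∀ ξ, |ξ| < r → 0 < η t ξ ∧ 0 < t + ξ ∧ t + ξ < 1 ∧ 0 < kT t + ξ * η t ξ ∧
        AnalyticAt ℝ (η t) ξ ∧ HasDerivAt (fun x => x * η t x) (psi m γ t ξ (η t ξ)) ξ := by
  set f : ℂ × ℂ × ℂ → ℂ := fun p => psi (m : ℂ) γ p.1 p.2.1 p.2.2 with hf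
  -- Every sign needed later is built into the open set W, so it holds along the solution for all t
  -- ∈ K with a single radius.
  set W : Set (ℂ × ℂ × ℂ) := ({p | AnalyticAt ℂ f p} ∩ {p | 0 < p.2.2.re} ∩
    {p | 0 < (p.1 + p.2.1).re} ∩ {p | (p.1 + p.2.1).re < 1}) ∩
    ({p | p.1 ≠ 0} ∩ (fun p => (kT p.1 + p.2.1 * p.2.2).re) ⁻¹' Ioi 0) with hW
  have hWo : IsOpen W := by
    refine IsOpen.inter (IsOpen.inter (IsOpen.inter (IsOpen.inter (isOpen_analyticAt ℂ f) ?_) ?_) ?_) ?_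
    · exact isOpen_lt continuous_const (by fun_prop)
    · exact isOpen_lt continuous_const (by fun_prop)
    · exact isOpen_lt (by fun_prop) continuous_const
    · refine ContinuousOn.isOpen_inter_preimage ?_ (isOpen_ne_fun (by fun_prop) continuous_const)
        isOpen_Ioi
      refine Complex.continuous_re.comp_continuousOn ?_
      unfold kT
      have : ∀ p ∈ {p : ℂ × ℂ × ℂ | p.1 ≠ 0}, p.1 ≠ 0 := fun p hp => hp
      fun_prop (disch := assumption)
  have hWK : ∀ t ∈ K, ((t : ℂ), (0 : ℂ), (etaT m γ t : ℂ)) ∈ W := by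
    intro t ht
    obtain ⟨ht0, ht1⟩ := hK t ht
    refine ⟨⟨⟨⟨analyticAt_psi analyticAt_fst (analyticAt_fst.comp analyticAt_snd)
      (analyticAt_snd.comp analyticAt_snd) ?_ ?_ ?_ ?_ ?_, ?_⟩, ?_⟩, ?_⟩, ?_, ?_⟩
    · change (t : ℂ) ≠ 0; exact_mod_cast ht0.ne'
    · change 2 - (2 - (γ : ℂ)) * t ≠ 0; exact_mod_cast (dT_pos hγ ht0 ht1).ne'
    · simpa using ht0.ne'
    · have : (1 : ℝ) - t ≠ 0 := by linarith
      change 1 - ((t : ℂ) + 0) ≠ 0; rw [add_zero]; exact_mod_cast this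
    · change denT (m : ℂ) γ t (t + 0) (etaT m γ t) ≠ 0
      rw [add_zero, ← ofReal_denT]
      exact_mod_cast (denT_etaT_pos hm hγ ht0 ht1 (hE t ht)).ne'
    · simpa using etaT_pos hm hγ ht0 ht1 (hE t ht)
    · simpa using ht0
    · simpa using ht1
    · simpa using ht0.ne'
    · have := kT_pos ht0 ht1
      simpa [← ofReal_kT] using this
  have hWa : ∀ p ∈ W, AnalyticAt ℂ f p := fun p hp => hp.1.1.1.1
  have key := exists_briotBouquet_of_isCompact hKc (h₀ := etaT m γ)
    (continuousOn_etaT hm hγ hK) hWo hWK hWa ?_ ?_ ?_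
  · obtain ⟨r, hr, H, h1, h2, h3, h4, h5⟩ := key
    refine ⟨r, hr, fun t ξ => (H t ξ).re, fun ξ hξ => ?_, fun t ht ξ hξ => ?_⟩
    · exact Complex.continuous_re.comp_continuousOn (h1 ξ (by simpa using hξ))
    · have hξb : (ξ : ℂ) ∈ Metric.ball (0 : ℂ) r := by simpa using hξ
      have hw := h3 t ht ξ hξb
      have hreal : ((H t ξ).re : ℂ) = H t ξ := by
        apply Complex.ext <;> simp [h4 t ht ξ hξ]
      refine ⟨hw.1.1.1.2, ?_, ?_, ?_, ?_, ?_⟩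
      · have := hw.1.1.2
        simpa using this
      · have := hw.1.2
        simpa using this
      · have := hw.2.2
        have h6 : 0 < (kT (t : ℂ) + ξ * H t ξ).re := this
        rw [← hreal, ← ofReal_kT] at h6
        simpa using h6
      · exact analyticAt_re_ofReal ((h2 t ht).analyticAt (Metric.isOpen_ball.mem_nhds hξb))
      · have h6 := (h5 t ht ξ hξb).real_of_complex
        have h7 : (f (t, ξ, H t ξ)).re = psi m γ t ξ (H t ξ).re := by
          rw [← hreal, hf]; simp only [Complex.ofReal_re, ← ofReal_psi]
        rw [h7] at h6
        simpa using h6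
  · intro t ht
    rw [hf]
    have := psi_zero_etaT hm hγ (hK t ht).1 (hK t ht).2 (hE t ht)
    have h6 := ofReal_psi m γ t 0 (etaT m γ t)
    rw [this] at h6
    simpa using h6.symm
  · intro t ht
    obtain ⟨ht0, ht1⟩ := hK t ht
    have hden := (denT_etaT_pos hm hγ ht0 ht1 (hE t ht)).ne'
    have hp := (hWa _ (hWK t ht)).differentiableAt.hasFDerivAt
    have hc : HasDerivAt (fun e : ℂ => ((t : ℂ), (0 : ℂ), e)) ((0 : ℂ), (0 : ℂ), (1 : ℂ))
        (etaT m γ t : ℂ) := (hasDerivAt_const _ (t : ℂ)).prodMk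
          ((hasDerivAt_const _ (0 : ℂ)).prodMk (hasDerivAt_id' _))
    have h6 := hp.comp_hasDerivAt _ hc
    have h7 := hasDerivAt_psi_zero (m := m) (γ := γ) (t := t) (etaT m γ t : ℂ) (by
      rw [← ofReal_denT]; exact_mod_cast hden)
    have h8 := h6.unique h7
    rw [h8]
    have h9 := abs_slope_lt_one hm hγ ht0 ht1 (hE t ht) (hθ t ht)
    rw [← Real.norm_eq_abs, ← Complex.norm_real] at h9
    simpa [ofReal_kT, ofReal_lT, ofReal_BT, ofReal_denT, ofReal_numT, ofReal_cT] using h9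
  · intro t ξ η
    rw [hf]
    simp only [← ofReal_psi, Complex.ofReal_im]

end ShockODE

namespace ShockODE

/-! ### Continuation of the orbit up to the shock -/

open scoped NNReal in
/-- Flow of a bounded Lipschitz vector field. -/
theorem exists_flow {E : Type*} [NormedAddCommGroup E] [NormedSpace ℝ E] [CompleteSpace E]
    {f : ℝ → E → E} {K L : ℝ≥0} (hlip : ∀ s, LipschitzWith K (f s))
    (hcont : ∀ x, Continuous fun s => f s x) (hb : ∀ s x, ‖f s x‖ ≤ L) (s₀ : ℝ) (T R : ℝ≥0) :
    ∃ α : E × ℝ → E, (∀ x ∈ Metric.closedBall (0 : E) R, α (x, s₀) = x ∧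
      ∀ s ∈ Ioo (s₀ - T) (s₀ + T), HasDerivAt (fun s => α (x, s)) (f s (α (x, s))) s) ∧
      ContinuousOn α (Metric.closedBall 0 R ×ˢ Icc (s₀ - T) (s₀ + T)) := by
  have hT : (0 : ℝ) ≤ T := T.2
  -- A field bounded by L moves a point at most L·T, so the ball of radius R + L·T is not left.
  have hPL : IsPicardLindelof f (tmin := s₀ - T) (tmax := s₀ + T) ⟨s₀, by simp⟩ 0
      (R + L * T) R L K :=
    { lipschitzOnWith := fun s _ => (hlip s).lipschitzOnWith
      continuousOn := fun x _ => (hcont x).continuousOn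
      norm_le := fun s _ x _ => hb s x
      mul_max_le := by simp }
  obtain ⟨α, h1, h2⟩ := hPL.exists_forall_mem_closedBall_eq_hasDerivWithinAt_continuousOn
  refine ⟨α, fun x hx => ⟨(h1 x hx).1, fun s hs => ?_⟩, h2⟩
  exact ((h1 x hx).2 s (Ioo_subset_Icc_self hs)).hasDerivAt (Icc_mem_nhds hs.1 hs.2)

/-- The logarithmic derivative of `κ` as a function of `(a, t, kT t / κ)`. -/
noncomputable def gT (m γ : ℝ) (p : ℝ × ℝ × ℝ) : ℝ :=
  (2 * (lT m γ p.2.1 - BT m γ * p.1) * (p.2.2 * (1 - p.1) ^ 2 - kT p.2.1 * p.1)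
    / (p.2.2 * ((1 - p.1) * (lT m γ p.2.1 - p.1)) - kT p.2.1 * cT m γ p.2.1 p.1)
    - (1 - γ * p.1)) / (p.1 * (1 - p.1))

variable {m γ t a : ℝ}

/-- In terms of τ = kT t / κ the logarithmic slope of κ remains regular down to τ = 0, that is κ =
∞; above the barrier τ ranges in [0, 1], so κ cannot blow up before the shock. -/
theorem slopeT_eq_gT {τ : ℝ} (ht : 0 < t) (ht1 : t < 1) (ha : 0 < a) (ha1 : a < 1) (hτ : 0 < τ)
    (hden : τ * ((1 - a) * (lT m γ t - a)) - kT t * cT m γ t a ≠ 0) :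
    slopeT m γ t a (a * (kT t / τ)) = a * (kT t / τ) * (1 / a + gT m γ (a, t, τ)) := by
  have hk := kT_pos ht ht1
  have h1a : 1 - a ≠ 0 := by linarith
  have hG : GT m γ t a (a * (kT t / τ)) =
      a * (τ * ((1 - a) * (lT m γ t - a)) - kT t * cT m γ t a) / τ := by
    rw [GT, cT]; field_simp; ring
  rw [slopeT, hG, gT]
  simp only
  generalize τ * ((1 - a) * (lT m γ t - a)) - kT t * cT m γ t a = g at *
  field_simp
  ring

theorem gT_den_one (hγ : 1 < γ) (ht : 0 < t) (ht1 : t < 1) (ha : a ≠ 0) :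
    (1 - a) * (lT m γ t - a) - kT t * cT m γ t a = -((a - t) * (bT m γ t - a)) := by
  have h1 := GT_eq (m := m) hγ ht ht1 a 0
  apply mul_left_cancel₀ ha
  rw [GT, denT] at h1
  rw [cT]
  linear_combination h1

theorem bT_sub_pos (hm : 0 < m) (hγ : 1 < γ) (ht : 0 < t) (ht1 : t < 1) (ha1 : a < 1) :
    0 < bT m γ t - a := by
  have := one_div_lt_bT hm hγ ht ht1
  have := one_lt_one_div ht ht1
  linarith

/-- The expression is affine in τ and negative at τ = 0 and τ = 1. -/
theorem gT_den_neg (hm : 0 < m) (hγ : 1 < γ) (ht : 0 < t) (ht1 : t < 1) (hta : t < a) (ha1 : a < 1)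
    {τ : ℝ} (hτ : 0 ≤ τ) (hτ1 : τ ≤ 1) :
    τ * ((1 - a) * (lT m γ t - a)) - kT t * cT m γ t a < 0 := by
  have hc := cT_pos hm hγ ht ht1 hta.le
  have hk := kT_pos ht ht1
  have hb := bT_sub_pos hm hγ ht ht1 ha1
  have h2 := gT_den_one (m := m) hγ ht ht1 (ht.trans hta).ne'
  have h3 : 0 < (a - t) * (bT m γ t - a) := mul_pos (by linarith) hb
  have h4 : τ * ((1 - a) * (lT m γ t - a)) - kT t * cT m γ t a =
      -((1 - τ) * (kT t * cT m γ t a) + τ * ((a - t) * (bT m γ t - a))) := by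
    linear_combination τ * h2
  rw [h4, neg_lt_zero]
  rcases hτ1.lt_or_eq with h | h
  · have : 0 < (1 - τ) * (kT t * cT m γ t a) := mul_pos (by linarith) (by positivity)
    have := mul_nonneg hτ h3.le
    linarith
  · rw [h]; linarith

theorem gT_one_pos (hm : 0 < m) (hγ : 1 < γ) (ht : 0 < t) (ht1 : t < 1) (ha : 0 < a) (ha1 : a < 1)
    (hat : a ≠ t) (hE : 0 < eT m γ t a) : 0 < gT m γ (a, t, 1) := by
  have hk := kT_pos ht ht1
  have hb := bT_sub_pos hm hγ ht ht1 ha1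
  have h1 := slopeT_eq_gT (m := m) (γ := γ) ht ht1 ha ha1 one_pos (by
    rw [one_mul, gT_den_one hγ ht ht1 ha.ne', neg_ne_zero]
    exact mul_ne_zero (sub_ne_zero.2 hat) hb.ne')
  have h2 := slopeT_sub_kT hm hγ ht ht1 ha ha1 hat
  rw [div_one, mul_comm a] at h1
  have h3 : kT t * a * gT m γ (a, t, 1) = kT t * eT m γ t a / ((1 - a) * (bT m γ t - a)) := by
    rw [← h2, h1]; field_simp; ring
  have : 0 < 1 - a := by linarith
  have h4 : 0 < kT t * a * gT m γ (a, t, 1) := by rw [h3]; positivity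
  exact pos_of_mul_pos_right h4 (by positivity)

theorem lipschitz_exp_neg_max : LipschitzWith 1 fun s : ℝ => Real.exp (-max s 0) := by
  have h1 : LipschitzOnWith 1 (fun x : ℝ => Real.exp (-x)) (Ici 0) := by
    refine (convex_Ici 0).lipschitzOnWith_of_nnnorm_hasDerivWithin_le
      (f' := fun x => Real.exp (-x) * (-1)) (fun x _ => ?_) (fun x hx => ?_)
    · exact ((hasDerivAt_neg x).exp).hasDerivWithinAt
    · rw [← NNReal.coe_le_coe, coe_nnnorm, norm_mul, norm_neg, norm_one, mul_one, Real.norm_eq_abs,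
        Real.abs_exp]
      exact Real.exp_le_one_iff.2 (neg_nonpos.2 hx)
  have h2 : LipschitzWith 1 fun s : ℝ => max s 0 := LipschitzWith.id.max_const 0
  have h3 := h1.comp (h2.lipschitzOnWith (s := univ)) (fun x _ => le_max_right x 0)
  rw [one_mul] at h3
  exact lipschitzOnWith_univ.1 h3

theorem contDiffAt_gT (hm : 0 < m) (hγ : 1 < γ) {p : ℝ × ℝ × ℝ} (ht : 0 < p.2.1) (ht1 : p.2.1 < 1)
    (hta : p.2.1 < p.1) (ha1 : p.1 < 1) (hτ : 0 ≤ p.2.2) (hτ1 : p.2.2 ≤ 1) :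
    ContDiffAt ℝ 1 (gT m γ) p := by
  have h1 : p.2.1 ≠ 0 := ht.ne'
  have h2 := (dT_pos hγ ht ht1).ne'
  have h3 := (gT_den_neg hm hγ ht ht1 hta ha1 hτ hτ1).ne
  have h4 : p.1 * (1 - p.1) ≠ 0 := mul_ne_zero (ht.trans hta).ne' (by linarith)
  have hz : ContDiffAt ℝ 1 (fun p : ℝ × ℝ × ℝ => zT γ p.2.1) p := by
    unfold zT; fun_prop (disch := assumption)
  have hl : ContDiffAt ℝ 1 (fun p : ℝ × ℝ × ℝ => lT m γ p.2.1) p := by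
    unfold lT; fun_prop (disch := assumption)
  have hk : ContDiffAt ℝ 1 (fun p : ℝ × ℝ × ℝ => kT p.2.1) p := by
    unfold kT; fun_prop (disch := assumption)
  have hc : ContDiffAt ℝ 1 (fun p : ℝ × ℝ × ℝ => cT m γ p.2.1 p.1) p := by
    unfold cT; fun_prop (disch := assumption)
  unfold gT
  fun_prop (disch := assumption)

/-- Continuation of a family of orbits above the barrier `κ = kT t`. -/
theorem exists_left_family {t₀ t₁ ρ a₁ : ℝ} (hm : 0 < m) (hγ : 1 < γ) (ht₀ : 0 < t₀) (ht₀₁ : t₀ ≤ t₁)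
    (hρ : 0 < ρ) (hρa : t₁ + ρ < a₁) (ha₁ : a₁ < 1)
    (hE : ∀ t ∈ Icc t₀ t₁, ∀ a ∈ Icc t a₁, 0 < eT m γ t a) {s₀ : ℝ → ℝ}
    (hs₀ : ContinuousOn s₀ (Icc t₀ t₁)) (hs₀p : ∀ t ∈ Icc t₀ t₁, 0 < s₀ t) :
    ∃ σ : ℝ → ℝ → ℝ, (∀ t ∈ Icc t₀ t₁, σ t (t + ρ) = s₀ t) ∧
      ContinuousOn (fun t => σ t a₁) (Icc t₀ t₁) ∧
      ∀ t ∈ Icc t₀ t₁, ∀ a ∈ Icc (t + ρ) a₁, 0 < σ t a ∧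
        ∀ᶠ x in 𝓝 a, HasDerivAt (σ t) (gT m γ (x, t, Real.exp (-σ t x))) x := by
  -- A lies beyond a₁, as t + ρ/2 lies before the start t + ρ, so the equation holds in full
  -- neighbourhoods of both ends.
  set A := (1 + a₁) / 2 with hA
  set S : Set (ℝ × ℝ × ℝ) := {p | p.2.1 ∈ Icc t₀ t₁ ∧ p.2.1 + ρ / 2 ≤ p.1 ∧ p.1 ≤ A ∧
    p.2.2 ∈ Icc (0 : ℝ) 1} with hS
  have hSeq : S = {p | t₀ ≤ p.2.1} ∩ {p | p.2.1 ≤ t₁} ∩ {p | p.2.1 + ρ / 2 ≤ p.1} ∩ {p | p.1 ≤ A} ∩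
      {p | 0 ≤ p.2.2} ∩ {p | p.2.2 ≤ 1} := by
    ext p; simp only [hS, mem_ofPred_eq, mem_inter_iff, mem_Icc]; tauto
  have hSc : IsClosed S := by
    rw [hSeq]
    exact (((((isClosed_le (by fun_prop) (by fun_prop)).inter (isClosed_le (by fun_prop)
      (by fun_prop))).inter (isClosed_le (by fun_prop) (by fun_prop))).inter
      (isClosed_le (by fun_prop) (by fun_prop))).inter
      (isClosed_le (by fun_prop) (by fun_prop))).inter (isClosed_le (by fun_prop) (by fun_prop))
  have hScomp : IsCompact S := by
    refine (isCompact_Icc (a := ((t₀ : ℝ), (t₀ : ℝ), (0 : ℝ))) (b := (A, t₁, (1 : ℝ)))).of_isClosed_subset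
      hSc ?_
    rintro p ⟨h1, h2, h3, h4⟩
    exact ⟨⟨by linarith [h1.1], h1.1, h4.1⟩, ⟨h3, h1.2, h4.2⟩⟩
  have hSconv : Convex ℝ S := by
    rintro p ⟨h1, h2, h3, h4⟩ q ⟨k1, k2, k3, k4⟩ x y hx hy hxy
    have hxe : x = 1 - y := by linarith
    simp only [hS, mem_ofPred_eq, Prod.fst_add, Prod.snd_add, Prod.smul_fst, Prod.smul_snd,
      smul_eq_mul, mem_Icc] at *
    refine ⟨⟨?_, ?_⟩, ?_, ?_, ?_, ?_⟩ <;> subst hxe <;> nlinarith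
  have hSmem : ∀ p ∈ S, ContDiffAt ℝ 1 (gT m γ) p := by
    rintro p ⟨h1, h2, h3, h4⟩
    have : p.1 < 1 := by linarith
    exact contDiffAt_gT hm hγ (by linarith [h1.1]) (by linarith) (by linarith) this h4.1 h4.2
  obtain ⟨Kg, hKg⟩ := ContDiffOn.exists_lipschitzOnWith
    (fun p hp => (hSmem p hp).contDiffWithinAt) one_ne_zero hSconv hScomp
  obtain ⟨L, hL⟩ := hScomp.exists_bound_of_continuousOn hKg.continuousOn
  -- the projection onto `S`
  set π : ℝ → ℝ × ℝ → ℝ × ℝ × ℝ := fun ξ x =>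
    (min (max t₀ (min x.2 t₁) + max ξ (ρ / 2)) A, max t₀ (min x.2 t₁), Real.exp (-max x.1 0)) with hπ
  have hπS : ∀ ξ x, π ξ x ∈ S := by
    intro ξ x
    have h1 : max t₀ (min x.2 t₁) ≤ t₁ := max_le ht₀₁ (min_le_right _ _)
    refine ⟨⟨le_max_left _ _, h1⟩, ?_, min_le_right _ _, (Real.exp_pos _).le,
      Real.exp_le_one_iff.2 (neg_nonpos.2 (le_max_right _ _))⟩
    refine le_min ?_ ?_
    · have := le_max_right ξ (ρ / 2)
      simp only [hπ]; linarith
    · simp only [hπ]; linarith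
  have hclamp : LipschitzWith 1 fun x : ℝ × ℝ => max t₀ (min x.2 t₁) :=
    (LipschitzWith.prod_snd.min_const t₁).const_max t₀
  have hπlip : ∀ ξ, LipschitzWith 1 (π ξ) := by
    intro ξ
    have h1 : LipschitzWith 1 fun x : ℝ × ℝ => min (max t₀ (min x.2 t₁) + max ξ (ρ / 2)) A := by
      have : LipschitzWith 1 fun x : ℝ × ℝ => max t₀ (min x.2 t₁) + max ξ (ρ / 2) := by
        simpa using hclamp.add (LipschitzWith.const (max ξ (ρ / 2)))
      exact this.min_const A
    have h3 : LipschitzWith 1 fun x : ℝ × ℝ => Real.exp (-max x.1 0) := by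
      simpa [Function.comp_def] using lipschitz_exp_neg_max.comp (LipschitzWith.prod_fst (α := ℝ) (β := ℝ))
    simpa using h1.prodMk (hclamp.prodMk h3)
  set f : ℝ → ℝ × ℝ → ℝ × ℝ := fun ξ x => (gT m γ (π ξ x), 0) with hf
  have hflip : ∀ ξ, LipschitzWith Kg (f ξ) := by
    intro ξ
    have h1 := hKg.comp ((hπlip ξ).lipschitzOnWith (s := univ)) (fun x _ => hπS ξ x)
    rw [mul_one, lipschitzOnWith_univ] at h1
    have h2 := h1.prodMk (LipschitzWith.const (α := ℝ × ℝ) (0 : ℝ))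
    rw [max_eq_left (zero_le)] at h2
    exact h2
  have hfc : ∀ x, Continuous fun ξ => f ξ x := by
    intro x
    refine Continuous.prodMk ?_ continuous_const
    refine hKg.continuousOn.comp_continuous (f := fun ξ => π ξ x) ?_ (fun ξ => hπS ξ x)
    simp only [hπ]; fun_prop
  have hfb : ∀ ξ x, ‖f ξ x‖ ≤ (Real.toNNReal L : ℝ) := by
    intro ξ x
    have h1 : ‖f ξ x‖ = ‖gT m γ (π ξ x)‖ := by
      rw [hf, Prod.norm_def]; simp
    rw [h1]
    exact (hL _ (hπS ξ x)).trans (Real.le_coe_toNNReal L)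
  have hinit : ContinuousOn (fun t => (s₀ t, t)) (Icc t₀ t₁) := hs₀.prodMk continuousOn_id
  obtain ⟨R, hR⟩ := isCompact_Icc.exists_bound_of_continuousOn hinit
  obtain ⟨α, hα1, hα2⟩ := exists_flow hflip hfc hfb ρ 2 (Real.toNNReal R)
  have hball : ∀ t ∈ Icc t₀ t₁, (s₀ t, t) ∈ Metric.closedBall (0 : ℝ × ℝ) (Real.toNNReal R) := by
    intro t ht
    rw [mem_closedBall_zero_iff]
    exact (hR t ht).trans (Real.le_coe_toNNReal R)
  have hρ1 : ρ < 1 := by linarith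
  have htime : ∀ t ∈ Icc t₀ t₁, ∀ x ∈ Ioo (0 : ℝ) 1, x - t ∈ Ioo (ρ - (2 : NNReal)) (ρ + (2 : NNReal)) := by
    intro t ht x hx
    have h1 := ht.1
    have h2 := ht.2
    have h3 := hx.1
    have h4 := hx.2
    constructor <;> push_cast <;> linarith
  have hsnd : ∀ t ∈ Icc t₀ t₁, ∀ ξ ∈ Ioo (ρ - (2 : NNReal)) (ρ + (2 : NNReal)),
      (α ((s₀ t, t), ξ)).2 = t := by
    intro t ht ξ hξ
    have h1 : ∀ x ∈ Ioo (ρ - (2 : NNReal) : ℝ) (ρ + (2 : NNReal)),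
        HasDerivAt (fun s => (α ((s₀ t, t), s)).2) 0 x :=
      fun x hx => ((hα1 _ (hball t ht)).2 x hx).snd
    have h2 : (α ((s₀ t, t), ρ)).2 = t := by rw [(hα1 _ (hball t ht)).1]
    refine Eq.trans ?_ h2
    refine (convex_Ioo _ _).is_const_of_fderivWithin_eq_zero (𝕜 := ℝ)
      (f := fun s => (α ((s₀ t, t), s)).2) (fun x hx =>
      (h1 x hx).differentiableAt.differentiableWithinAt) (fun x hx => ?_) hξ ⟨?_, ?_⟩
    · rw [fderivWithin_of_isOpen isOpen_Ioo hx, (h1 x hx).hasFDerivAt.fderiv]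
      ext; simp
    · push_cast; linarith
    · push_cast; linarith
  -- With time a - t all orbits start at the same time ρ, so joint continuity of one flow gives
  -- continuity in t.
  set σ : ℝ → ℝ → ℝ := fun t a => (α ((s₀ t, t), a - t)).1 with hσ
  have hder : ∀ t ∈ Icc t₀ t₁, ∀ x ∈ Ioo (0 : ℝ) 1,
      HasDerivAt (σ t) (gT m γ (π (x - t) (σ t x, t))) x := by
    intro t ht x hx
    have h1 : HasDerivAt (fun s => (α ((s₀ t, t), s)).1)
        (gT m γ (π (x - t) (α ((s₀ t, t), x - t)))) (x - t) :=
      ((hα1 _ (hball t ht)).2 (x - t) (htime t ht x hx)).fst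
    have h2 := h1.comp x ((hasDerivAt_id' x).sub_const t)
    rw [mul_one] at h2
    have h3 : α ((s₀ t, t), x - t) = (σ t x, t) := Prod.ext rfl (hsnd t ht _ (htime t ht x hx))
    rw [h3] at h2
    exact h2
  have hπeq : ∀ t ∈ Icc t₀ t₁, ∀ x s, t + ρ / 2 ≤ x → x ≤ A → 0 ≤ s →
      π (x - t) (s, t) = (x, t, Real.exp (-s)) := by
    intro t ht x s h1 h2 h3
    simp only [hπ]
    rw [min_eq_left ht.2, max_eq_right ht.1, max_eq_left h3, max_eq_left (by linarith),
      add_sub_cancel, min_eq_left h2]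
  refine ⟨σ, ?_, ?_, ?_⟩
  · intro t ht
    simp only [hσ]
    rw [add_sub_cancel_left, (hα1 _ (hball t ht)).1]
  · refine continuous_fst.comp_continuousOn (hα2.comp (f := fun t => ((s₀ t, t), a₁ - t)) ?_ ?_)
    · exact hinit.prodMk (by fun_prop)
    · intro t ht
      exact ⟨hball t ht, Ioo_subset_Icc_self (htime t ht a₁ ⟨by linarith [ht.1, ht.2], ha₁⟩)⟩
  · intro t ht
    have ht0 : 0 < t := ht₀.trans_le ht.1
    have ht1 : t < 1 := by linarith [ht.2]
    have hpos : ∀ a ∈ Icc (t + ρ) a₁, 0 < σ t a := by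
      intro a ha
      rcases ha.1.eq_or_lt with h | h
      · rw [← h]; simp only [hσ]
        rw [add_sub_cancel_left, (hα1 _ (hball t ht)).1]
        exact hs₀p t ht
      -- The barrier in logarithmic form: at σ = 0 the slope is `gT` at τ = 1, which is positive. So
      -- σ stays positive and the clamp is inactive.
      refine pos_of_deriv_pos_of_eq_zero (a := t + ρ) (b := a₁)
        (fun x hx => hder t ht x ⟨by linarith [hx.1], by linarith [hx.2]⟩) ?_ ?_ a ⟨h, ha.2⟩
      · simp only [hσ]
        rw [add_sub_cancel_left, (hα1 _ (hball t ht)).1]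
        exact (hs₀p t ht).le
      · intro x hx h0
        rw [hπeq t ht x _ (by linarith [hx.1]) (by linarith [hx.2]) h0.ge, h0, neg_zero, Real.exp_zero]
        exact gT_one_pos hm hγ ht0 ht1 (by linarith [hx.1]) (by linarith [hx.2])
          (by linarith [hx.1] : t < x).ne' (hE t ht x ⟨by linarith [hx.1], hx.2⟩)
    intro a ha
    refine ⟨hpos a ha, ?_⟩
    have hc := (hder t ht a ⟨by linarith [ha.1], by linarith [ha.2]⟩).continuousAt
    have h1 : ∀ᶠ x in 𝓝 a, 0 < σ t x := hc.eventually (lt_mem_nhds (hpos a ha))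
    have h2 : ∀ᶠ x in 𝓝 a, x ∈ Ioo (t + ρ / 2) A :=
      Ioo_mem_nhds (by linarith [ha.1]) (by linarith [ha.2])
    filter_upwards [h1, h2] with x hx1 hx2
    have h3 := hder t ht x ⟨by linarith [hx2.1], by linarith [hx2.2]⟩
    rwa [hπeq t ht x _ hx2.1.le hx2.2.le hx1.le] at h3

end ShockODE

namespace ShockODE

/-! ### Continuation of the orbit to the origin -/

open scoped NNReal in
/-- Global solutions for bounded Lipschitz vector fields. -/
theorem exists_global_solution {E : Type*} [NormedAddCommGroup E] [NormedSpace ℝ E] [CompleteSpace E]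
    {f : ℝ → E → E} {K L : ℝ≥0} (hlip : ∀ s, LipschitzWith K (f s))
    (hcont : ∀ x, Continuous fun s => f s x) (hb : ∀ s x, ‖f s x‖ ≤ L) (s₀ : ℝ) (x₀ : E) :
    ∃ α : ℝ → E, α s₀ = x₀ ∧ ∀ s, HasDerivAt α (f s (α s)) s := by
  have hx₀ : x₀ ∈ Metric.closedBall (0 : E) ‖x₀‖₊ := by simp
  choose α hα _ using fun T : ℝ≥0 => exists_flow hlip hcont hb s₀ T ‖x₀‖₊
  have hagree : ∀ T T' : ℝ≥0, 0 < T → T ≤ T' → ∀ s ∈ Ioo (s₀ - T) (s₀ + T),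
      α T (x₀, s) = α T' (x₀, s) := by
    intro T T' hT hTT
    have hT0 : (0 : ℝ) < T := hT
    have hTT' : (T : ℝ) ≤ T' := hTT
    have := ODE_solution_unique_of_mem_Ioo (v := f) (s := fun _ => univ) (K := K)
      (f := fun s => α T (x₀, s)) (g := fun s => α T' (x₀, s)) (a := s₀ - T) (b := s₀ + T) (t₀ := s₀)
      (fun s _ => (hlip s).lipschitzOnWith) ⟨by linarith, by linarith⟩
      (fun s hs => ⟨(hα T x₀ hx₀).2 s hs, mem_univ _⟩)
      (fun s hs => ⟨(hα T' x₀ hx₀).2 s ⟨by linarith [hs.1], by linarith [hs.2]⟩, mem_univ _⟩)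
      (by rw [(hα T x₀ hx₀).1, (hα T' x₀ hx₀).1])
    exact this
  -- Solutions on growing intervals agree by uniqueness and patch together.
  set β : ℝ → E := fun s => α (‖s - s₀‖₊ + 1) (x₀, s) with hβ
  have hmem : ∀ (T : ℝ≥0) (s : ℝ), ‖s - s₀‖ < T → s ∈ Ioo (s₀ - T) (s₀ + T) := by
    intro T s hs
    rw [Real.norm_eq_abs, abs_lt] at hs
    exact ⟨by linarith, by linarith⟩
  have hβeq : ∀ (T : ℝ≥0) (s : ℝ), ‖s - s₀‖₊ + 1 ≤ T → β s = α T (x₀, s) := by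
    intro T s hs
    refine hagree _ T (by positivity) hs s (hmem _ s ?_)
    push_cast; linarith
  refine ⟨β, ?_, fun s => ?_⟩
  · rw [hβ]; exact (hα _ x₀ hx₀).1
  · set T := ‖s - s₀‖₊ + 2 with hT
    have h1 := (hα T x₀ hx₀).2 s (hmem T s (by rw [hT]; push_cast; linarith))
    have h2 : β s = α T (x₀, s) := hβeq T s (by rw [hT]; gcongr; norm_num)
    rw [h2]
    refine h1.congr_of_eventuallyEq ?_
    have h3 : ∀ᶠ x in 𝓝 s, ‖x - s₀‖₊ < ‖s - s₀‖₊ + 1 :=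
      (by fun_prop : Continuous fun x : ℝ => ‖x - s₀‖₊).continuousAt.eventually
        (gt_mem_nhds (lt_add_of_pos_right _ one_pos))
    filter_upwards [h3] with x hx
    refine hβeq T x ?_
    rw [hT, show (2 : ℝ≥0) = 1 + 1 by norm_num, ← add_assoc]
    gcongr

theorem lipschitz_exp_min : LipschitzWith 1 fun s : ℝ => Real.exp (min s 0) := by
  have h1 : LipschitzOnWith 1 (fun x : ℝ => Real.exp x) (Iic 0) := by
    refine (convex_Iic 0).lipschitzOnWith_of_nnnorm_hasDerivWithin_le
      (f' := fun x => Real.exp x) (fun x _ => ?_) (fun x hx => ?_)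
    · exact (Real.hasDerivAt_exp x).hasDerivWithinAt
    · rw [← NNReal.coe_le_coe, coe_nnnorm, Real.norm_eq_abs, Real.abs_exp]
      exact Real.exp_le_one_iff.2 hx
  have h2 : LipschitzWith 1 fun s : ℝ => min s 0 := LipschitzWith.id.min_const 0
  have h3 := h1.comp (h2.lipschitzOnWith (s := univ)) (fun x _ => min_le_right x 0)
  rw [one_mul] at h3
  exact lipschitzOnWith_univ.1 h3

/-- The derivative of `log κ` with respect to `log a`, as a function of `(a, κ / kT t)`. -/
noncomputable def hT (m γ t : ℝ) (p : ℝ × ℝ) : ℝ :=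
  (2 * (lT m γ t - BT m γ * p.1) * ((1 - p.1) ^ 2 - kT t * p.2 * p.1)
    / ((1 - p.1) * (lT m γ t - p.1) - kT t * p.2 * cT m γ t p.1)
    - (1 - γ * p.1)) / (1 - p.1)

variable {m γ t a : ℝ}

/-- Again affine in σ, and positive at σ = 0 and σ = 1. -/
theorem hT_den_pos (hm : 0 < m) (hγ : 1 < γ) (ht : 0 < t) (ht1 : t < 1) (ha : 0 ≤ a) (hta : a < t)
    {σ : ℝ} (hσ : 0 ≤ σ) (hσ1 : σ ≤ 1) :
    0 < (1 - a) * (lT m γ t - a) - kT t * σ * cT m γ t a := by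
  have hl := one_lt_lT hm hγ ht ht1
  have hk := kT_pos ht ht1
  have h1 : 0 < (1 - a) * (lT m γ t - a) := mul_pos (by linarith) (by linarith)
  have h2 : 0 < (1 - a) * (lT m γ t - a) - kT t * cT m γ t a := by
    rcases ha.eq_or_lt with rfl | ha
    · have : 0 < kT t * (2 * m * zT γ t) := by
        have := zT_pos hγ ht ht1
        positivity
      rw [cT]; linarith
    · rw [gT_den_one hγ ht ht1 ha.ne']
      have := mul_pos (sub_pos.2 hta) (bT_sub_pos hm hγ ht ht1 (hta.trans ht1))
      linarith
  have h3 : (1 - a) * (lT m γ t - a) - kT t * σ * cT m γ t a =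
      (1 - σ) * ((1 - a) * (lT m γ t - a)) + σ * ((1 - a) * (lT m γ t - a) - kT t * cT m γ t a) := by
    ring
  rw [h3]
  rcases hσ.eq_or_lt with h | h
  · rw [← h]; linarith
  · have := mul_pos h h2
    have := mul_nonneg (sub_nonneg.2 hσ1) h1.le
    linarith

theorem hT_eq_gT {σ : ℝ} (ha : a ≠ 0) (hσ : σ ≠ 0) (ha1 : 1 - a ≠ 0)
    (hden : (1 - a) * (lT m γ t - a) - kT t * σ * cT m γ t a ≠ 0) :
    hT m γ t (a, σ) = a * gT m γ (a, t, 1 / σ) := by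
  have h1 : 1 / σ * ((1 - a) * (lT m γ t - a)) - kT t * cT m γ t a =
      ((1 - a) * (lT m γ t - a) - kT t * σ * cT m γ t a) / σ := by field_simp
  rw [hT, gT]
  simp only
  rw [h1]
  generalize (1 - a) * (lT m γ t - a) - kT t * σ * cT m γ t a = g at *
  field_simp

/-- Continuation of the orbit below the barrier `κ = kT t`. -/
theorem exists_right_orbit {ρ s₀ : ℝ} (hm : 0 < m) (hγ : 1 < γ) (ht : 0 < t) (ht1 : t < 1)
    (hρ : 0 < ρ) (hρt : ρ < t) (hE : ∀ a ∈ Ioo 0 t, 0 < eT m γ t a) (hs₀ : s₀ < 0) :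
    ∃ σ : ℝ → ℝ, σ (t - ρ) = s₀ ∧ ∀ a ∈ Ioc 0 (t - ρ), σ a < 0 ∧
      ∀ᶠ x in 𝓝 a, HasDerivAt σ (gT m γ (x, t, Real.exp (-σ x))) x := by
  set A := t - ρ / 2 with hA
  set S : Set (ℝ × ℝ) := Icc 0 A ×ˢ Icc 0 1 with hS
  have hA0 : 0 < A := by linarith
  have hScomp : IsCompact S := isCompact_Icc.prod isCompact_Icc
  have hSconv : Convex ℝ S := (convex_Icc _ _).prod (convex_Icc _ _)
  have hden : ∀ p ∈ S, (1 - p.1) * (lT m γ t - p.1) - kT t * p.2 * cT m γ t p.1 ≠ 0 :=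
    fun p hp => (hT_den_pos hm hγ ht ht1 hp.1.1 (by linarith [hp.1.2]) hp.2.1 hp.2.2).ne'
  have hSmem : ContDiffOn ℝ 1 (hT m γ t) S := by
    have h1 : ∀ p ∈ S, 1 - p.1 ≠ 0 := fun p hp => by linarith [hp.1.2]
    unfold hT
    unfold cT at *
    fun_prop (disch := assumption)
  obtain ⟨Kg, hKg⟩ := hSmem.exists_lipschitzOnWith one_ne_zero hSconv hScomp
  obtain ⟨L, hL⟩ := hScomp.exists_bound_of_continuousOn hKg.continuousOn
  set π : ℝ → ℝ → ℝ × ℝ := fun b s => (min (Real.exp b) A, Real.exp (min s 0)) with hπ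
  have hπS : ∀ b s, π b s ∈ S := fun b s =>
    ⟨⟨le_min (Real.exp_pos _).le hA0.le, min_le_right _ _⟩, (Real.exp_pos _).le,
      Real.exp_le_one_iff.2 (min_le_right _ _)⟩
  set f : ℝ → ℝ → ℝ := fun b s => hT m γ t (π b s) with hf
  have hflip : ∀ b, LipschitzWith Kg (f b) := by
    intro b
    have h0 : LipschitzWith 1 (π b) := by
      simpa using (LipschitzWith.const (α := ℝ) (min (Real.exp b) A)).prodMk lipschitz_exp_min
    have h1 := hKg.comp (h0.lipschitzOnWith (s := univ)) (fun x _ => hπS b x)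
    rw [mul_one, lipschitzOnWith_univ] at h1
    exact h1
  have hfc : ∀ s, Continuous fun b => f b s := by
    intro s
    refine hKg.continuousOn.comp_continuous (f := fun b => π b s) ?_ (fun b => hπS b s)
    simp only [hπ]; fun_prop
  have hfb : ∀ b s, ‖f b s‖ ≤ (Real.toNNReal L : ℝ) := fun b s =>
    (hL _ (hπS b s)).trans (Real.le_coe_toNNReal L)
  -- With log a as time the singular point a = 0 moves to -∞, and `hT` is regular there, so a global
  -- solution reaches every a > 0.
  obtain ⟨α, hα0, hα⟩ := exists_global_solution hflip hfc hfb (Real.log (t - ρ)) s₀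
  have hder : ∀ x, 0 < x → HasDerivAt (fun a => α (Real.log a))
      (hT m γ t (π (Real.log x) (α (Real.log x))) * x⁻¹) x := fun x hx =>
    (hα (Real.log x)).comp x (Real.hasDerivAt_log hx.ne')
  have hπeq : ∀ x s, 0 < x → x ≤ A → s ≤ 0 → π (Real.log x) s = (x, Real.exp s) := by
    intro x s h1 h2 h3
    simp only [hπ]
    rw [Real.exp_log h1, min_eq_left h2, min_eq_left h3]
  have hval : ∀ x s, 0 < x → x ≤ A → s ≤ 0 →
      hT m γ t (π (Real.log x) s) * x⁻¹ = gT m γ (x, t, Real.exp (-s)) := by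
    intro x s h1 h2 h3
    rw [hπeq x s h1 h2 h3, hT_eq_gT h1.ne' (Real.exp_pos _).ne' (by linarith)
      (hT_den_pos hm hγ ht ht1 h1.le (by linarith) (Real.exp_pos _).le (Real.exp_le_one_iff.2 h3)).ne',
      one_div, ← Real.exp_neg]
    field_simp
  have hneg : ∀ a ∈ Ioc 0 (t - ρ), α (Real.log a) < 0 := by
    intro a ha
    rcases ha.2.eq_or_lt with h | h
    · rw [h, hα0]; exact hs₀
    refine neg_of_deriv_pos_of_eq_zero (f := fun a => α (Real.log a)) (a := a) (b := t - ρ)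
      (fun x hx => hder x (ha.1.trans_le hx.1)) (by rw [hα0]; exact hs₀.le) ?_ a ⟨le_rfl, h⟩
    intro x hx h0
    have hx0 := ha.1.trans_le hx.1
    have hxt : x < t := by linarith [hx.2]
    rw [hval x _ hx0 (by linarith [hx.2]) h0.le, h0, neg_zero, Real.exp_zero]
    exact gT_one_pos hm hγ ht ht1 hx0 (by linarith) hxt.ne (hE x ⟨hx0, hxt⟩)
  refine ⟨fun a => α (Real.log a), hα0, fun a ha => ⟨hneg a ha, ?_⟩⟩
  have hc := (hder a ha.1).continuousAt
  have h1 : ∀ᶠ x in 𝓝 a, α (Real.log x) < 0 := hc.eventually (gt_mem_nhds (hneg a ha))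
  have h2 : ∀ᶠ x in 𝓝 a, x ∈ Ioo 0 A := Ioo_mem_nhds ha.1 (by linarith [ha.2])
  filter_upwards [h1, h2] with x hx1 hx2
  have h3 := hder x hx2.1
  rwa [hval x _ hx2.1 hx2.2.le hx1.le] at h3

end ShockODE

namespace ShockODE

/-! ### Gluing the pieces of an orbit -/

variable {m γ t a : ℝ} {Y Z : ℝ → ℝ}

/-- `Y` solves the orbit equation in a neighbourhood of `a`. -/
def SolvesNear (m γ t : ℝ) (Y : ℝ → ℝ) (a : ℝ) : Prop :=
  ∀ᶠ x in 𝓝 a, HasDerivAt Y (slopeT m γ t x (Y x)) x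

theorem SolvesNear.hasDerivAt (h : SolvesNear m γ t Y a) : HasDerivAt Y (slopeT m γ t a (Y a)) a :=
  h.self_of_nhds

theorem SolvesNear.congr (h : SolvesNear m γ t Y a) (hYZ : Z =ᶠ[𝓝 a] Y) : SolvesNear m γ t Z a := by
  filter_upwards [h, eventually_eventually_nhds.2 hYZ] with x hx hx'
  rw [hx'.self_of_nhds]
  exact hx.congr_of_eventuallyEq hx'

theorem hasDerivAt_ite {f g : ℝ → ℝ} {f' b : ℝ} (hf : HasDerivAt f f' b) (hg : HasDerivAt g f' b)
    (h : f b = g b) : HasDerivAt (fun x => if x ≤ b then f x else g x) f' b := by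
  have h1 : HasDerivWithinAt (fun x => if x ≤ b then f x else g x) f' (Iic b) b :=
    hf.hasDerivWithinAt.congr (fun x hx => if_pos hx) (if_pos le_rfl)
  have h2 : HasDerivWithinAt (fun x => if x ≤ b then f x else g x) f' (Ici b) b := by
    refine hg.hasDerivWithinAt.congr (fun x hx => ?_) (by rw [if_pos le_rfl, h])
    rcases (show b ≤ x from hx).eq_or_lt with rfl | h'
    · rw [if_pos le_rfl, h]
    · exact if_neg (not_le.2 h')
  have := h1.union h2
  rwa [Iic_union_Ici, hasDerivWithinAt_univ] at this

theorem ite_eventuallyEq_left {f g : ℝ → ℝ} {b : ℝ} (hab : a < b) :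
    (fun x => if x ≤ b then f x else g x) =ᶠ[𝓝 a] f := by
  filter_upwards [gt_mem_nhds hab] with x hx using if_pos (le_of_lt hx)

theorem ite_eventuallyEq_right {f g : ℝ → ℝ} {b : ℝ} (hab : b < a) :
    (fun x => if x ≤ b then f x else g x) =ᶠ[𝓝 a] g := by
  filter_upwards [lt_mem_nhds hab] with x hx using if_neg (not_le.2 hx)

theorem SolvesNear.ite {f g : ℝ → ℝ} (hf : SolvesNear m γ t f a) (hg : SolvesNear m γ t g a)
    (h : f a = g a) : SolvesNear m γ t (fun x => if x ≤ a then f x else g x) a := by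
  filter_upwards [hf.eventually_nhds, hg.eventually_nhds] with x hx hx'
  rcases lt_trichotomy x a with h' | rfl | h'
  · exact (SolvesNear.congr (m := m) (γ := γ) (t := t) hx (ite_eventuallyEq_left h')).hasDerivAt
  · have h1 := hx.self_of_nhds
    have h2 := hx'.self_of_nhds
    rw [← h] at h2
    simp only [le_refl, if_true]
    exact hasDerivAt_ite h1 h2 h
  · exact (SolvesNear.congr (m := m) (γ := γ) (t := t) hx' (ite_eventuallyEq_right h')).hasDerivAt

/-- The factors a - t of D and G cancel in the quotient, which is what makes `psi` regular at the
triple point. -/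
theorem slopeT_eq_psi {η : ℝ} (hγ : 1 < γ) (ht : 0 < t) (ht1 : t < 1) (ha : 0 < a) (ha1 : a < 1)
    (hat : a ≠ t) (hden : denT m γ t a η ≠ 0) :
    slopeT m γ t a (a * (kT t + (a - t) * η)) =
      (kT t + (a - t) * η) + a * psi m γ t (a - t) η := by
  have h1 := GT_eq (m := m) hγ ht ht1 a η
  have h2 := sonic_eq ht a η
  have hat' : a - t ≠ 0 := sub_ne_zero.2 hat
  have h1a : 1 - a ≠ 0 := by linarith
  rw [slopeT, mul_comm a, h1, h2, psi, add_sub_cancel]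
  have hane := ha.ne'
  have : (lT m γ t - BT m γ * a) * -((a - t) * numT t a η) / -(a * (a - t) * denT m γ t a η) =
      (lT m γ t - BT m γ * a) * numT t a η / (a * denT m γ t a η) := by
    rw [div_eq_div_iff (by simp [hane, hat', hden]) (by simp [hane, hden])]; ring
  rw [this]
  generalize denT m γ t a η = b at *
  generalize numT t a η = n at *
  generalize lT m γ t - BT m γ * a = l at *
  generalize kT t + (a - t) * η = κ at *
  field_simp
  ring

theorem sonic_lt_left (ht : 0 < t) (ht1 : t < 1) (hta : t < a) (ha1 : a < 1) :
    (1 - a) ^ 2 < kT t * a := by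
  have h := sonic_eq ht a 0
  rw [mul_zero, add_zero, numT, mul_zero, add_zero] at h
  have : 0 < (a - t) * (1 / t - a) := mul_pos (by linarith) (by linarith [one_lt_one_div ht ht1])
  linarith

theorem sonic_lt_right (ht : 0 < t) (ht1 : t < 1) (hta : a < t) : kT t * a < (1 - a) ^ 2 := by
  have h := sonic_eq ht a 0
  rw [mul_zero, add_zero, numT, mul_zero, add_zero] at h
  have : 0 < (t - a) * (1 / t - a) := mul_pos (by linarith) (by linarith [one_lt_one_div ht ht1])
  linarith

theorem GT_neg_of_le {y : ℝ} (hm : 0 < m) (hγ : 1 < γ) (ht : 0 < t) (ht1 : t < 1) (hta : t < a)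
    (ha1 : a < 1) (hy : kT t * a ≤ y) : GT m γ t a y < 0 := by
  have hk := kT_pos ht ht1
  have ha : 0 < a := ht.trans hta
  have hy0 : 0 < y := lt_of_lt_of_le (by positivity) hy
  have h1 := gT_den_neg hm hγ ht ht1 hta ha1 (τ := kT t * a / y) (by positivity)
    (by rw [div_le_one hy0]; exact hy)
  have e : GT m γ t a y = y / kT t * (kT t * a / y * ((1 - a) * (lT m γ t - a)) - kT t * cT m γ t a) := by
    rw [GT, cT]; field_simp; ring
  rw [e]
  exact mul_neg_of_pos_of_neg (by positivity) h1

theorem GT_pos_of_le {y : ℝ} (hm : 0 < m) (hγ : 1 < γ) (ht : 0 < t) (ht1 : t < 1) (ha : 0 < a)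
    (hta : a < t) (hy0 : 0 ≤ y) (hy : y ≤ kT t * a) : 0 < GT m γ t a y := by
  have hk := kT_pos ht ht1
  have h1 := hT_den_pos hm hγ ht ht1 ha.le hta (σ := y / (kT t * a)) (by positivity)
    (by rw [div_le_one (by positivity)]; exact hy)
  have e : GT m γ t a y =
      a * ((1 - a) * (lT m γ t - a) - kT t * (y / (kT t * a)) * cT m γ t a) := by
    rw [GT, cT]; field_simp; ring
  rw [e]
  exact mul_pos ha h1

/-- An orbit given in terms of the logarithm of `κ / kT t`. -/
theorem solvesNear_of_log {σ : ℝ → ℝ} (hm : 0 < m) (hγ : 1 < γ) (ht : 0 < t) (ht1 : t < 1)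
    (ha : 0 < a) (ha1 : a < 1) (hside : t < a ∧ 0 < σ a ∨ a < t ∧ σ a < 0)
    (hσ : ∀ᶠ x in 𝓝 a, HasDerivAt σ (gT m γ (x, t, Real.exp (-σ x))) x) :
    SolvesNear m γ t (fun x => x * (kT t * Real.exp (σ x))) a := by
  have hc : ContinuousAt σ a := hσ.self_of_nhds.continuousAt
  have hk := kT_pos ht ht1
  have hside' : ∀ᶠ x in 𝓝 a, t < x ∧ 0 < σ x ∨ x < t ∧ σ x < 0 := by
    rcases hside with h | h
    · filter_upwards [lt_mem_nhds h.1, hc.eventually (lt_mem_nhds h.2)] with x h1 h2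
        using Or.inl ⟨h1, h2⟩
    · filter_upwards [gt_mem_nhds h.1, hc.eventually (gt_mem_nhds h.2)] with x h1 h2
        using Or.inr ⟨h1, h2⟩
  filter_upwards [hσ, hside', lt_mem_nhds ha, gt_mem_nhds ha1] with x hx hs hx0 hx1
  have h1 : HasDerivAt (fun x => x * (kT t * Real.exp (σ x)))
      (1 * (kT t * Real.exp (σ x)) + x * (kT t * (Real.exp (σ x) * gT m γ (x, t, Real.exp (-σ x))))) x :=
    (hasDerivAt_id' x).mul (hx.exp.const_mul (kT t))
  refine h1.congr_deriv ?_
  have hτ := Real.exp_pos (-σ x)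
  have e1 : kT t * Real.exp (σ x) = kT t / Real.exp (-σ x) := by
    rw [Real.exp_neg, div_inv_eq_mul]
  have hden : Real.exp (-σ x) * ((1 - x) * (lT m γ t - x)) - kT t * cT m γ t x ≠ 0 := by
    rcases hs with h | h
    · exact (gT_den_neg hm hγ ht ht1 h.1 hx1 hτ.le (Real.exp_le_one_iff.2 (by linarith))).ne
    · have h2 := hT_den_pos hm hγ ht ht1 hx0.le h.1 (Real.exp_pos (σ x)).le
        (Real.exp_le_one_iff.2 h.2.le)
      have e2 : Real.exp (-σ x) * ((1 - x) * (lT m γ t - x)) - kT t * cT m γ t x =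
          Real.exp (-σ x) * ((1 - x) * (lT m γ t - x) - kT t * Real.exp (σ x) * cT m γ t x) := by
        have : Real.exp (-σ x) * Real.exp (σ x) = 1 := by rw [← Real.exp_add]; simp
        linear_combination (kT t * cT m γ t x) * this
      rw [e2]; positivity
  have h3 := slopeT_eq_gT (m := m) (γ := γ) ht ht1 hx0 hx1 hτ hden
  rw [e1, h3, ← e1]
  field_simp

/-- The local analytic orbit solves the orbit equation off the triple point. -/
theorem solvesNear_local {η : ℝ → ℝ} {r : ℝ} (hm : 0 < m) (hγ : 1 < γ) (ht : 0 < t) (ht1 : t < 1)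
    (hη : ∀ ξ, |ξ| < r → 0 < η ξ ∧ 0 < t + ξ ∧ t + ξ < 1 ∧ 0 < kT t + ξ * η ξ ∧
      AnalyticAt ℝ η ξ ∧ HasDerivAt (fun x => x * η x) (psi m γ t ξ (η ξ)) ξ)
    (hat : a ≠ t) (har : |a - t| < r) :
    SolvesNear m γ t (fun x => x * (kT t + (x - t) * η (x - t))) a := by
  have h1 : ∀ᶠ x in 𝓝 a, |x - t| < r :=
    (by fun_prop : Continuous fun x : ℝ => |x - t|).continuousAt.eventually (gt_mem_nhds har)
  filter_upwards [h1, isOpen_ne.mem_nhds hat] with x hx hxt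
  have hxt' : x ≠ t := hxt
  obtain ⟨h2, h3, h4, h5, h6, h7⟩ := hη (x - t) hx
  rw [add_sub_cancel] at h3 h4
  have h8 := h7.comp x ((hasDerivAt_id' x).sub_const t)
  rw [mul_one] at h8
  have h9 : HasDerivAt (fun x => x * (kT t + (x - t) * η (x - t)))
      (1 * (kT t + (x - t) * η (x - t)) + x * psi m γ t (x - t) (η (x - t))) x :=
    (hasDerivAt_id' x).mul (h8.const_add (kT t))
  refine h9.congr_deriv ?_
  rw [one_mul]
  refine (slopeT_eq_psi hγ ht ht1 h3 h4 hxt' ?_).symm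
  -- `denT` = 0 would mean G = 0, excluded off t because η > 0 puts the orbit on the right side of
  -- the barrier.
  have hG := GT_eq (m := m) hγ ht ht1 x (η (x - t))
  intro h0
  rw [h0, mul_zero, neg_zero] at hG
  rcases lt_or_gt_of_ne hxt' with h' | h'
  · refine (GT_pos_of_le hm hγ ht ht1 h3 h' (by positivity) ?_).ne' hG
    exact mul_le_mul_of_nonneg_right (by nlinarith) h3.le
  · refine (GT_neg_of_le hm hγ ht ht1 h' h4 ?_).ne hG
    exact mul_le_mul_of_nonneg_right (by nlinarith) h3.le

/-! ### The range of triple points -/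

theorem continuousOn_theta (hγ : 1 < γ) : ContinuousOn (fun t => lT m γ t - BT m γ * t) (Ioo 0 1) := by
  have h2 : ∀ t ∈ Ioo (0 : ℝ) 1, 2 - (2 - γ) * t ≠ 0 := fun t ht => (dT_pos hγ ht.1 ht.2).ne'
  unfold lT zT
  fun_prop (disch := assumption)

/-- Supplies the sign change of λ - B t that bounds the shooting interval from above. -/
theorem theta_start_neg (hm : 0 < m) (hγ : 1 < γ) :
    lT m γ (2 / (γ + 1)) - BT m γ * (2 / (γ + 1)) < 0 := by
  have hg : 0 < γ + 1 := by linarith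
  have hγ1 : 0 < γ - 1 := by linarith
  have hg2 : 0 < 2 * γ - 1 := by linarith
  have e : lT m γ (2 / (γ + 1)) - BT m γ * (2 / (γ + 1)) =
      -(m * (γ - 1) ^ 2 / ((γ + 1) * (2 * γ - 1))) := by
    have hz : zT γ (2 / (γ + 1)) = (γ - 1) / ((γ + 1) * (2 * γ - 1)) := by
      have : 2 - (2 - γ) * (2 / (γ + 1)) = 2 * (2 * γ - 1) / (γ + 1) := by field_simp; ring
      rw [zT, this]; field_simp; ring
    have hq : (γ - 1) / ((γ + 1) * (2 * γ - 1)) * (2 * γ - 1) = (γ - 1) / (γ + 1) := by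
      rw [← div_div, div_mul_cancel₀ _ hg2.ne']
    rw [lT, BT, hz, ← mul_div_assoc', pow_two, ← mul_div_assoc']
    generalize (γ - 1) / ((γ + 1) * (2 * γ - 1)) = q at hq ⊢
    have hB : (γ + 1 + m * (γ - 1)) / 2 * (2 / (γ + 1)) = 1 + m * ((γ - 1) / (γ + 1)) := by
      field_simp
    rw [hB, ← hq]
    ring
  rw [e, neg_lt_zero]
  positivity

/-- The triple points to be considered for the existence of a connection. -/
theorem exists_triple_range (hm : m = 1 ∨ m = 2) (hγ : 1 < γ) (hγ3 : γ ≤ 3) :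
    ∃ t₀ t₁ : ℝ, 0 < t₀ ∧ t₀ < t₁ ∧ t₁ < 2 / (γ + 1) ∧ kT t₀ = γ * (γ - 1) / (γ + 1) ∧
      lT m γ t₁ - BT m γ * t₁ = 0 ∧ (∀ t ∈ Icc t₀ t₁, 0 ≤ lT m γ t - BT m γ * t) ∧
      ∀ t ∈ Icc t₀ t₁, ∀ a ∈ Icc 0 (2 / (γ + 1)), 0 < eT m γ t a := by
  obtain ⟨hu, hu1⟩ := u_mem hγ hγ3
  have hγu := gamma_eq_of_u hγ
  have ha1 := one_sub_u hγ
  have hst := start_eq hγ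
  have ha10 := two_div_add_one_pos hγ
  have ha11 := two_div_lt_one hγ
  have hm0 : 0 < m := by rcases hm with rfl | rfl <;> norm_num
  set u := (γ - 1) / (γ + 1) with hu'
  set a₁ := 2 / (γ + 1) with ha₁
  set κ := γ * (γ - 1) / (γ + 1) with hκ
  -- t₀ is where the line from the origin to the post-shock point meets the sonic line.
  obtain ⟨t₀, ht₀, h0⟩ : ∃ t₀ ∈ Ioo 0 a₁, (1 - t₀) ^ 2 - κ * t₀ = 0 := by
    refine intermediate_value_Ioo' ha10.le (f := fun x => (1 - x) ^ 2 - κ * x) (by fun_prop) ⟨?_, ?_⟩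
    · rw [hst, ha1]; nlinarith
    · norm_num
  have hk : kT t₀ = κ := by rw [kT, div_eq_iff ht₀.1.ne']; linarith
  have hy2 : (1 - t₀) ^ 2 ≤ u * (1 + u) := by
    have hκ0 : 0 < κ := by rw [← hk]; exact kT_pos ht₀.1 (ht₀.2.trans ha11)
    have : κ * t₀ ≤ κ * a₁ := mul_le_mul_of_nonneg_left ht₀.2.le hκ0.le
    linarith
  have h1u : 0 < 1 - u := by linarith
  have hrel : (1 - t₀) ^ 2 * (1 - u) = u * (1 + u) * t₀ := by
    have : κ * (1 - u) = u * (1 + u) := by rw [← ha1, hst]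
    linear_combination (1 - u) * h0 + t₀ * this
  have h54 : 5 * u ≤ 4 * (1 - t₀) := by
    by_contra hcon
    push Not at hcon
    have hy : 0 < 1 - t₀ := by linarith [ht₀.2]
    have h1 : (1 - t₀) ^ 2 ≤ (5 / 4 * u) ^ 2 := pow_le_pow_left₀ hy.le (by linarith) 2
    have h2 : (1 - t₀) ^ 2 * (1 - u) ≤ (5 / 4 * u) ^ 2 * (1 - u) :=
      mul_le_mul_of_nonneg_right h1 h1u.le
    have h3 : u * (1 + u) * (1 - 5 / 4 * u) ≤ u * (1 + u) * t₀ :=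
      mul_le_mul_of_nonneg_left (by linarith) (by positivity)
    have h4 : 0 < u * (1 - 29 / 16 * u + 5 / 16 * u ^ 2) := mul_pos hu (by nlinarith)
    nlinarith
  have hθ₀ := theta_pos_of_lt hm hu hu1 hγu ht₀.1 (ht₀.2.trans ha11) h54
  set θ : ℝ → ℝ := fun t => lT m γ t - BT m γ * t with hθ
  have hθc : ContinuousOn θ (Icc t₀ a₁) := (continuousOn_theta hγ).mono
    fun x hx => ⟨ht₀.1.trans_le hx.1, hx.2.trans_lt ha11⟩
  -- t₁ will be the first zero of λ - B t after t₀, so the sign needed for the local solution holds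
  -- on all of [t₀, t₁].
  set Z := Icc t₀ a₁ ∩ θ ⁻¹' Iic 0 with hZ
  have hZc : IsCompact Z :=
    isCompact_Icc.of_isClosed_subset (hθc.preimage_isClosed_of_isClosed isClosed_Icc isClosed_Iic)
      inter_subset_left
  obtain ⟨t₁, ht₁, hleast⟩ := hZc.exists_isLeast
    ⟨a₁, ⟨ht₀.2.le, le_rfl⟩, (theta_start_neg hm0 hγ).le⟩
  have hpos : ∀ x ∈ Ico t₀ t₁, 0 < θ x := by
    intro x hx
    by_contra hcon
    have := hleast ⟨⟨hx.1, hx.2.le.trans ht₁.1.2⟩, not_lt.1 hcon⟩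
    linarith [hx.2]
  have hlt : t₀ < t₁ := by
    rcases ht₁.1.1.eq_or_lt with h | h
    · have : θ t₁ ≤ 0 := ht₁.2
      rw [← h] at this
      exact absurd hθ₀ (not_lt.2 this)
    · exact h
  have hz : θ t₁ = 0 := by
    refine le_antisymm ht₁.2 ?_
    have hc : ContinuousWithinAt θ (Ico t₀ t₁) t₁ :=
      (hθc t₁ ht₁.1).mono fun x hx => ⟨hx.1, hx.2.le.trans ht₁.1.2⟩
    have : t₁ ∈ closure (Ico t₀ t₁) := by rw [closure_Ico hlt.ne]; exact ⟨hlt.le, le_rfl⟩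
    have hne : (𝓝[Ico t₀ t₁] t₁).NeBot := mem_closure_iff_nhdsWithin_neBot.1 this
    exact ge_of_tendsto hc.tendsto (by filter_upwards [self_mem_nhdsWithin] with x hx using (hpos x hx).le)
  have hlt1 : t₁ < a₁ := by
    refine lt_of_le_of_ne ht₁.1.2 fun h => ?_
    have := theta_start_neg hm0 hγ
    change θ a₁ < 0 at this
    rw [← h, hz] at this
    exact lt_irrefl _ this
  have hθK : ∀ t ∈ Icc t₀ t₁, 0 ≤ θ t := by
    intro t ht
    rcases ht.2.eq_or_lt with h | h
    · rw [h, hz]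
    · exact (hpos t ⟨ht.1, h⟩).le
  refine ⟨t₀, t₁, ht₀.1, hlt, hlt1, hk, hz, hθK, ?_⟩
  intro t ht a ha
  have htp : 0 < t := ht₀.1.trans_le ht.1
  have hta : t ≤ a₁ := ht.2.trans hlt1.le
  have ht1 : t < 1 := hta.trans_lt ha11
  have ha1' : a < 1 := ha.2.trans_lt ha11
  have key : ∀ x ≤ a₁, γ - 1 ≤ (γ + 1) * (1 - x) := by
    intro x hx
    rw [ha₁, le_div_iff₀ (by linarith)] at hx; linarith
  have hyt : (1 - t) ^ 2 ≤ (1 - t₀) ^ 2 := pow_le_pow_left₀ (by linarith) (by linarith [ht.1]) 2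
  have hθt := hθK t ht
  rcases hm with rfl | rfl
  · exact eT_one_pos hγ htp ht1 ha.1 ha1' (key _ ha.2) (key _ hta)
  · refine eT_two_pos hu hu1 hγu htp ht1 ha1' ?_ (hyt.trans hy2) ?_
    · by_contra hcon
      have := theta_neg_two hu hu1 hγu htp ht1 (not_le.1 hcon)
      exact absurd hθt (not_le.2 this)
    -- No dynamics is needed here: for 1 - t₀ > 0.827 the relation (1-t₀)²(1-u) = u(1+u)t₀ would
    -- have its left side too large.
    · right
      by_contra hcon
      push Not at hcon
      have h1 : 827 / 1000 < 1 - t₀ := by linarith [ht.1]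
      have h2 : (827 / 1000) ^ 2 ≤ (1 - t₀) ^ 2 := pow_le_pow_left₀ (by norm_num) h1.le 2
      have h3 : (827 / 1000) ^ 2 * (1 / 2) ≤ (1 - t₀) ^ 2 * (1 - u) :=
        mul_le_mul h2 (by linarith) (by norm_num) (sq_nonneg _)
      have h4 : u * (1 + u) * t₀ ≤ 3 / 4 * (173 / 1000) :=
        mul_le_mul (by nlinarith) (by linarith) ht₀.1.le (by norm_num)
      norm_num at h3 h4
      linarith

end ShockODE

namespace ShockODE

/-! ### Existence of a connection -/

section Glue

variable {m γ t a r ρ a₁ : ℝ} {η σ : ℝ → ℝ}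

/-- At the junction both pieces solve the equation and agree in value, hence in slope. The barrier
is respected because η > 0 on one piece and σ > 0 on the other. -/
theorem solvesNear_glue_left (hm : 0 < m) (hγ : 1 < γ) (ht : 0 < t) (ht1 : t < 1)
    (hη : ∀ ξ, |ξ| < r → 0 < η ξ ∧ 0 < t + ξ ∧ t + ξ < 1 ∧ 0 < kT t + ξ * η ξ ∧
      AnalyticAt ℝ η ξ ∧ HasDerivAt (fun x => x * η x) (psi m γ t ξ (η ξ)) ξ)
    (hρ : 0 < ρ) (hρr : ρ < r) (ha₁ : a₁ < 1) (hσ₀ : kT t * Real.exp (σ (t + ρ)) = kT t + ρ * η ρ)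
    (hσ : ∀ a ∈ Icc (t + ρ) a₁, 0 < σ a ∧
      ∀ᶠ x in 𝓝 a, HasDerivAt σ (gT m γ (x, t, Real.exp (-σ x))) x)
    (ha : a ∈ Ioc t a₁) :
    SolvesNear m γ t (fun x => if x ≤ t + ρ then x * (kT t + (x - t) * η (x - t))
      else x * (kT t * Real.exp (σ x))) a ∧
    kT t * a < (if a ≤ t + ρ then a * (kT t + (a - t) * η (a - t))
      else a * (kT t * Real.exp (σ a))) := by
  have hk := kT_pos ht ht1
  have ha0 : 0 < a := ht.trans ha.1
  have hloc : ∀ a, t < a → a ≤ t + ρ → |a - t| < r := fun a h1 h2 => by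
    rw [abs_of_pos (by linarith)]; linarith
  have hlog : ∀ a, t + ρ ≤ a → a ≤ a₁ →
      SolvesNear m γ t (fun x => x * (kT t * Real.exp (σ x))) a := fun a h1 h2 =>
    solvesNear_of_log hm hγ ht ht1 (by linarith) (by linarith)
      (Or.inl ⟨by linarith, (hσ a ⟨h1, h2⟩).1⟩) (hσ a ⟨h1, h2⟩).2
  constructor
  · rcases lt_trichotomy a (t + ρ) with h | h | h
    · exact (solvesNear_local hm hγ ht ht1 hη ha.1.ne' (hloc a ha.1 h.le)).congr
        (ite_eventuallyEq_left h)
    · subst h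
      refine SolvesNear.ite (solvesNear_local hm hγ ht ht1 hη ha.1.ne' (hloc _ ha.1 le_rfl))
        (hlog _ le_rfl ha.2) ?_
      rw [hσ₀, add_sub_cancel_left]
    · exact (hlog a h.le ha.2).congr (ite_eventuallyEq_right h)
  · split_ifs with h
    · have := (hη (a - t) (hloc a ha.1 h)).1
      have : 0 < a * ((a - t) * η (a - t)) := mul_pos ha0 (mul_pos (by linarith [ha.1]) this)
      linarith
    · have h1 := Real.one_lt_exp_iff.2 (hσ a ⟨(not_le.1 h).le, ha.2⟩).1
      have : 0 < a * kT t := by positivity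
      nlinarith

theorem solvesNear_glue_right (hm : 0 < m) (hγ : 1 < γ) (ht : 0 < t) (ht1 : t < 1)
    (hη : ∀ ξ, |ξ| < r → 0 < η ξ ∧ 0 < t + ξ ∧ t + ξ < 1 ∧ 0 < kT t + ξ * η ξ ∧
      AnalyticAt ℝ η ξ ∧ HasDerivAt (fun x => x * η x) (psi m γ t ξ (η ξ)) ξ)
    (hρ : 0 < ρ) (hρr : ρ < r)
    (hσ₀ : kT t * Real.exp (σ (t - ρ)) = kT t + -ρ * η (-ρ))
    (hσ : ∀ a ∈ Ioc 0 (t - ρ), σ a < 0 ∧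
      ∀ᶠ x in 𝓝 a, HasDerivAt σ (gT m γ (x, t, Real.exp (-σ x))) x)
    (ha : a ∈ Ioo 0 t) :
    SolvesNear m γ t (fun x => if x ≤ t - ρ then x * (kT t * Real.exp (σ x))
      else x * (kT t + (x - t) * η (x - t))) a ∧
    0 < (if a ≤ t - ρ then a * (kT t * Real.exp (σ a))
      else a * (kT t + (a - t) * η (a - t))) ∧
    (if a ≤ t - ρ then a * (kT t * Real.exp (σ a))
      else a * (kT t + (a - t) * η (a - t))) < kT t * a := by
  have hk := kT_pos ht ht1
  have hloc : ∀ a, a < t → t - ρ ≤ a → |a - t| < r := fun a h1 h2 => by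
    rw [abs_of_neg (by linarith)]; linarith
  have hlog : ∀ a, 0 < a → a ≤ t - ρ →
      SolvesNear m γ t (fun x => x * (kT t * Real.exp (σ x))) a := fun a h1 h2 =>
    solvesNear_of_log hm hγ ht ht1 h1 (by linarith)
      (Or.inr ⟨by linarith, (hσ a ⟨h1, h2⟩).1⟩) (hσ a ⟨h1, h2⟩).2
  refine ⟨?_, ?_⟩
  · rcases lt_trichotomy a (t - ρ) with h | h | h
    · exact (hlog a ha.1 h.le).congr (ite_eventuallyEq_left h)
    · subst h
      refine SolvesNear.ite (hlog _ ha.1 le_rfl)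
        (solvesNear_local hm hγ ht ht1 hη ha.2.ne (hloc _ ha.2 le_rfl)) ?_
      rw [hσ₀, sub_sub_cancel_left]
    · exact (solvesNear_local hm hγ ht ht1 hη ha.2.ne (hloc a ha.2 h.le)).congr
        (ite_eventuallyEq_right h)
  · have ha0 := ha.1
    split_ifs with h
    · have h1 := Real.exp_lt_one_iff.2 (hσ a ⟨ha.1, h⟩).1
      have : 0 < a * kT t := by positivity
      exact ⟨by positivity, by nlinarith⟩
    · obtain ⟨h1, -, -, h2, -⟩ := hη (a - t) (hloc a ha.2 (not_le.1 h).le)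
      have : 0 < a * ((t - a) * η (a - t)) := mul_pos ha0 (mul_pos (by linarith [ha.2]) h1)
      exact ⟨mul_pos ha0 h2, by linarith⟩

end Glue

section Orbit

variable {γ t a : ℝ} {Y : ℝ → ℝ}

theorem slopeT_pos_right {m : ℝ} (hm : 0 < m) (hγ : 1 < γ) (ht : 0 < t) (ht1 : t < 1)
    (hθ : 0 ≤ lT m γ t - BT m γ * t) (ha : 0 < a) (hat : a < t) {y : ℝ} (hy0 : 0 < y)
    (hy : y < kT t * a) : 0 < slopeT m γ t a y := by
  have hG := GT_pos_of_le hm hγ ht ht1 ha hat hy0.le hy.le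
  have hD := sonic_lt_right ht ht1 hat
  have hB : 0 < BT m γ := by
    have : 0 < m * (γ - 1) := mul_pos hm (by linarith)
    rw [BT]; linarith
  have h1 : 0 < lT m γ t - BT m γ * a := by nlinarith
  have h2 : 0 < (1 - a) ^ 2 - y := by linarith
  have h3 : 0 < γ - 1 := by linarith
  have h4 : 0 < 1 - a := by linarith
  rw [slopeT]
  positivity

/-- Over the common denominator G < 0 the numerator is affine and decreasing in y. It is negative on
the barrier, where the slope is positive, and so also above it. -/
theorem slopeT_pos_left {m : ℝ} (hm : 0 < m) (hγ : 1 < γ) (ht : 0 < t) (ht1 : t < 1)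
    (hE : 0 < eT m γ t a) (hta : t < a) (ha1 : a < 1) {y : ℝ}
    (hy : kT t * a < y) : 0 < slopeT m γ t a y := by
  have ha : 0 < a := ht.trans hta
  have hk := kT_pos ht ht1
  have h1a : 0 < 1 - a := by linarith
  have hrepr : ∀ y, GT m γ t a y < 0 → slopeT m γ t a y = 2 * y / (1 - a) *
      (((γ - 1) / 2 * GT m γ t a y + (lT m γ t - BT m γ * a) * ((1 - a) ^ 2 - y)) /
        GT m γ t a y) := fun y hG => by
    rw [slopeT, add_div, mul_div_cancel_right₀ _ hG.ne]
  have hG0 := GT_neg_of_le hm hγ ht ht1 hta ha1 (le_refl (kT t * a))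
  have hG := GT_neg_of_le hm hγ ht ht1 hta ha1 hy.le
  have hs : 0 < slopeT m γ t a (kT t * a) := by
    have h1 := slopeT_sub_kT hm hγ ht ht1 ha ha1 hta.ne'
    have h2 : 0 < bT m γ t - a := by
      linarith [one_div_lt_bT hm hγ ht ht1, one_lt_one_div ht ht1]
    have : 0 < kT t * eT m γ t a / ((1 - a) * (bT m γ t - a)) := by positivity
    linarith
  rw [hrepr _ hG0] at hs
  have hs' := pos_of_mul_pos_right hs (by positivity)
  have hN : (γ - 1) / 2 * GT m γ t a (kT t * a)
      + (lT m γ t - BT m γ * a) * ((1 - a) ^ 2 - kT t * a) < 0 := by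
    by_contra hcon
    exact absurd hs' (not_lt.2 (div_nonpos_of_nonneg_of_nonpos (not_lt.1 hcon) hG0.le))
  have hz := zT_pos hγ ht ht1
  rw [hrepr _ hG]
  refine mul_pos (div_pos (by nlinarith) h1a) (div_pos_of_neg_of_neg ?_ hG)
  have e : (γ - 1) / 2 * GT m γ t a y + (lT m γ t - BT m γ * a) * ((1 - a) ^ 2 - y) =
      (γ - 1) / 2 * GT m γ t a (kT t * a)
      + (lT m γ t - BT m γ * a) * ((1 - a) ^ 2 - kT t * a)
      - (1 - a + m * zT γ t) * (y - kT t * a) := by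
    rw [GT, GT, BT, lT]; ring
  rw [e]
  have : 0 < (1 - a + m * zT γ t) * (y - kT t * a) := mul_pos (by positivity) (by linarith)
  linarith

/-- Where G ≠ 0 the slope is a rational function without pole, so `analyticAt_of_ode` applies. -/
theorem SolvesNear.analyticAt {m : ℝ} (h : SolvesNear m γ t Y a) (ha : a < 1)
    (hG : GT m γ t a (Y a) ≠ 0) : AnalyticAt ℝ Y a := by
  have h1 : (1 - a : ℂ) ≠ 0 := by exact_mod_cast (by linarith : (1 - a : ℝ) ≠ 0)
  have h2 : ((Y a : ℂ) * (2 * (m : ℂ) * (zT γ t : ℝ) - ((m : ℂ) + 1) * a)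
      + a * (1 - a) * ((lT m γ t : ℝ) - a)) ≠ 0 := by
    rw [GT] at hG; exact_mod_cast hG
  refine analyticAt_of_ode (g := fun a y => slopeT m γ t a y)
    (f := fun p => 2 * p.2 / (1 - p.1) * (((γ : ℂ) - 1) / 2 +
      (((lT m γ t : ℝ) : ℂ) - ((BT m γ : ℝ) : ℂ) * p.1) * ((1 - p.1) ^ 2 - p.2)
        / (p.2 * (2 * (m : ℂ) * (zT γ t : ℝ) - ((m : ℂ) + 1) * p.1)
      + p.1 * (1 - p.1) * ((lT m γ t : ℝ) - p.1)))) ?_ ?_ h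
  · have hf : AnalyticAt ℂ (fun p : ℂ × ℂ => p.1) ((a : ℂ), (Y a : ℂ)) := analyticAt_fst
    have hs : AnalyticAt ℂ (fun p : ℂ × ℂ => p.2) ((a : ℂ), (Y a : ℂ)) := analyticAt_snd
    exact ((analyticAt_const.mul hs).div (analyticAt_const.sub hf) h1).mul
      (analyticAt_const.add (((analyticAt_const.sub (analyticAt_const.mul hf)).mul
        (((analyticAt_const.sub hf).pow 2).sub hs)).div
        ((hs.mul (analyticAt_const.sub (analyticAt_const.mul hf))).add
          ((hf.mul (analyticAt_const.sub hf)).mul (analyticAt_const.sub hf))) h2))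
  · intro a b
    rw [slopeT, GT]; push_cast; rfl

/-- An orbit through the triple point between the barriers `Y = kT t * a` is a connection. -/
theorem isConnection_of_orbit {m : ℕ} (hm : m = 1 ∨ m = 2) (hγ : 1 < γ) (ht : 0 < t)
    (hta : t < 2 / (γ + 1)) (hθ : 0 ≤ lT (m : ℝ) γ t - BT (m : ℝ) γ * t)
    (hE : ∀ a ∈ Icc 0 (2 / (γ + 1)), 0 < eT (m : ℝ) γ t a)
    (hleft : ∀ a ∈ Ioc t (2 / (γ + 1)), SolvesNear m γ t Y a ∧ kT t * a < Y a)
    (hright : ∀ a ∈ Ioo 0 t, SolvesNear m γ t Y a ∧ 0 < Y a ∧ Y a < kT t * a)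
    (hYt : Y t = (1 - t) ^ 2) (hYa : AnalyticAt ℝ Y t) (hYd : 0 < deriv Y t)
    (hstart : Y (2 / (γ + 1)) = γ * (γ - 1) / (γ + 1) * (2 / (γ + 1))) :
    IsConnection m γ (zT γ t) (fun V => √(Y (-V))) := by
  have ha11 := two_div_lt_one hγ
  have ht1 : t < 1 := hta.trans ha11
  have hm0 : (0 : ℝ) < m := by rcases hm with rfl | rfl <;> norm_num
  have hk := kT_pos ht ht1
  have hG : ∀ a ∈ Ioc 0 (2 / (γ + 1)), a ≠ t → GT m γ t a (Y a) ≠ 0 := by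
    intro a ha hat
    rcases lt_or_gt_of_ne hat with h | h
    · have := hright a ⟨ha.1, h⟩
      exact (GT_pos_of_le hm0 hγ ht ht1 ha.1 h this.2.1.le this.2.2.le).ne'
    · exact (GT_neg_of_le hm0 hγ ht ht1 h (ha.2.trans_lt ha11) (hleft a ⟨h, ha.2⟩).2.le).ne
  have hsol : ∀ a ∈ Ioc 0 (2 / (γ + 1)), a ≠ t → SolvesNear m γ t Y a := by
    intro a ha hat
    rcases lt_or_gt_of_ne hat with h | h
    · exact (hright a ⟨ha.1, h⟩).1
    · exact (hleft a ⟨h, ha.2⟩).1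
  have han : ∀ a ∈ Ioc 0 (2 / (γ + 1)), AnalyticAt ℝ Y a := by
    intro a ha
    rcases eq_or_ne a t with rfl | hat
    · exact hYa
    · exact (hsol a ha hat).analyticAt (ha.2.trans_lt ha11) (hG a ha hat)
  have hpos : ∀ a ∈ Ioc 0 (2 / (γ + 1)), 0 < Y a := by
    intro a ha
    rcases lt_trichotomy a t with h | rfl | h
    · exact (hright a ⟨ha.1, h⟩).2.1
    · rw [hYt]; have : 0 < 1 - a := by linarith
      positivity
    · exact lt_trans (mul_pos hk ha.1) (hleft a ⟨h, ha.2⟩).2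
  have hmono : StrictMonoOn Y (Ioc 0 (2 / (γ + 1))) := by
    refine strictMonoOn_of_deriv_pos (convex_Ioc _ _)
      (fun a ha => (han a ha).continuousAt.continuousWithinAt) fun a ha => ?_
    rw [interior_Ioc] at ha
    rcases lt_trichotomy a t with h | rfl | h
    · have := hright a ⟨ha.1, h⟩
      rw [this.1.hasDerivAt.deriv]
      exact slopeT_pos_right hm0 hγ ht ht1 hθ ha.1 h this.2.1 this.2.2
    · exact hYd
    · have := hleft a ⟨h, ha.2.le⟩
      rw [this.1.hasDerivAt.deriv]
      exact slopeT_pos_left hm0 hγ ht ht1 (hE a ⟨ha.1.le, ha.2.le⟩) h (ha.2.trans ha11) this.2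
  have hsonic : ∀ a ∈ Ioc 0 (2 / (γ + 1)), D (-a) (√(Y a)) = 0 → a = t := by
    intro a ha hD
    rw [D_neg_eq, Real.sq_sqrt (hpos a ha).le] at hD
    rcases lt_trichotomy a t with h | h | h
    · linarith [sonic_lt_right ht ht1 h, (hright a ⟨ha.1, h⟩).2.2]
    · exact h
    · linarith [sonic_lt_left ht ht1 h (ha.2.trans_lt ha11), (hleft a ⟨h, ha.2⟩).2]
  have hneg : ∀ V ∈ Ico (V₁ γ) 0, -V ∈ Ioc 0 (2 / (γ + 1)) := by
    intro V hV
    rw [V₁_eq] at hV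
    exact ⟨neg_pos.2 hV.2, by linarith [hV.1]⟩
  refine ⟨zT_pos hγ ht ht1, ?_, ?_, ?_, ?_, ?_, ?_, ?_⟩
  · intro V hV
    have h1 : AnalyticAt ℝ (fun V => Y (-V)) V :=
      (han (-V) (hneg V hV)).comp_of_eq (analyticAt_id.neg) rfl
    -- For positive Y the square root is exp(log Y / 2), which is analytic.
    have h2 : AnalyticAt ℝ (fun V => Real.exp (Real.log (Y (-V)) / 2)) V :=
      ((h1.log (hpos _ (hneg V hV))).div analyticAt_const two_ne_zero).rexp
    refine h2.congr ?_
    filter_upwards [h1.continuousAt.eventually (lt_mem_nhds (hpos _ (hneg V hV)))] with x hx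
    rw [Real.sqrt_eq_rpow, Real.rpow_def_of_pos hx]
    congr 1; ring
  · exact fun V hV => Real.sqrt_pos.2 (hpos _ (hneg V hV))
  · intro V hV W hW hVW
    exact Real.sqrt_lt_sqrt (hpos _ (hneg W hW)).le
      (hmono (hneg W hW) (hneg V hV) (neg_lt_neg hVW))
  · intro V hV hD
    have hV' := hneg V hV
    obtain ⟨a, rfl⟩ : ∃ a, V = -a := ⟨-V, (neg_neg V).symm⟩
    simp only [neg_neg] at hV' hD ⊢
    have hat : a ≠ t := by
      rintro rfl
      apply hD
      rw [D_neg_eq, Real.sq_sqrt (hpos _ hV').le, hYt, sub_self]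
    have hsq := Real.sq_sqrt (hpos a hV').le
    have hGa := hG a hV' hat
    have h1a : 1 - a ≠ 0 := by linarith [hV'.2]
    refine ⟨by rw [G_neg_eq, hsq]; exact hGa, ?_⟩
    have h1 : HasDerivAt (fun V => Y (-V)) (-slopeT m γ t a (Y a)) (-a) := by
      have := HasDerivAt.comp_of_eq (-a) (hsol a hV' hat).hasDerivAt (hasDerivAt_neg (-a))
        (neg_neg a).symm
      exact this.congr_deriv (mul_neg_one _)
    have h2 := h1.sqrt (by simpa using (hpos a hV').ne')
    refine h2.congr_deriv ?_
    have h3 := two_mul_slope m γ t (√(Y a)) h1a (by rw [hsq]; exact hGa)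
    rw [hsq] at h3
    rw [← h3, neg_neg]
    have := (Real.sqrt_pos.2 (hpos a hV')).ne'
    field_simp
  · intro V hV hD
    have hV' := hneg V hV
    obtain ⟨a, rfl⟩ : ∃ a, V = -a := ⟨-V, (neg_neg V).symm⟩
    simp only [neg_neg] at hV' hD ⊢
    obtain rfl := hsonic a hV' hD
    have h1a : 1 - a ≠ 0 := by linarith [hV'.2]
    have hsq := Real.sq_sqrt (hpos a hV').le
    rw [F_neg_eq _ _ _ _ h1a, G_neg_eq, hsq, hYt, GT_at hγ ht ht1]
    simp
  · have h1 : 0 ≤ 2 * γ * (γ - 1) := mul_nonneg (by linarith) (by linarith)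
    rw [V₁_eq, neg_neg, hstart, ← C₁_sq hγ, Real.sqrt_sq (C₁_pos hγ).le]
  · have h1 : Tendsto (fun V : ℝ => √(kT t * (-V))) (𝓝[<] 0) (𝓝 0) := by
      have : Continuous fun V : ℝ => √(kT t * (-V)) := by fun_prop
      have h2 := (this.tendsto 0).mono_left (nhdsWithin_le_nhds (s := Iio 0))
      simpa using h2
    refine squeeze_zero' (Eventually.of_forall fun _ => Real.sqrt_nonneg _) ?_ h1
    filter_upwards [Ioo_mem_nhdsLT (neg_lt_zero.2 ht)] with V hV
    exact Real.sqrt_le_sqrt (hright (-V) ⟨neg_pos.2 hV.2, by linarith [hV.1]⟩).2.2.le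

/-- Shooting in t: only the piece between triple point and shock enters the choice of t; the piece
to the origin exists for the chosen t without further condition. -/
theorem exists_isConnection {m : ℕ} (hm : m = 1 ∨ m = 2) (hγ : 1 < γ) (hγ3 : γ ≤ 3) :
    ∃ (z : ℝ) (C : ℝ → ℝ), IsConnection m γ z C := by
  have hmR : (m : ℝ) = 1 ∨ (m : ℝ) = 2 := by rcases hm with rfl | rfl <;> norm_num
  have hm0 : (0 : ℝ) < m := by rcases hm with rfl | rfl <;> norm_num
  obtain ⟨t₀, t₁, ht₀, ht₀₁, ht₁, hk₀, hθ₁, hθ, hE⟩ := exists_triple_range hmR hγ hγ3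
  have ha11 := two_div_lt_one hγ
  set a₁ := 2 / (γ + 1) with ha₁
  have hK : ∀ t ∈ Icc t₀ t₁, 0 < t ∧ t < 1 := fun t ht =>
    ⟨ht₀.trans_le ht.1, (ht.2.trans_lt ht₁).trans ha11⟩
  obtain ⟨r, hr, η, hηc, hη⟩ := exists_local_orbit (m := m) (γ := γ) isCompact_Icc hm0 hγ hK
    (fun t ht => hE t ht t ⟨(hK t ht).1.le, ht.2.trans ht₁.le⟩) hθ
  obtain ⟨ρ, hρ, hρr, hρt, hρa⟩ : ∃ ρ > 0, ρ < r ∧ ρ < t₀ ∧ t₁ + ρ < a₁ := by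
    refine ⟨min r (min t₀ (a₁ - t₁)) / 2, ?_, ?_, ?_, ?_⟩
    · exact half_pos (lt_min hr (lt_min ht₀ (sub_pos.2 ht₁)))
    all_goals
      have h1 : 0 < min r (min t₀ (a₁ - t₁)) := lt_min hr (lt_min ht₀ (sub_pos.2 ht₁))
      have h2 := min_le_left r (min t₀ (a₁ - t₁))
      have h3 := (min_le_right r (min t₀ (a₁ - t₁))).trans (min_le_left _ _)
      have h4 := (min_le_right r (min t₀ (a₁ - t₁))).trans (min_le_right _ _)
      linarith
  have hρ' : |ρ| < r := by rwa [abs_of_pos hρ]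
  have hkc : ContinuousOn (fun t : ℝ => kT t) (Icc t₀ t₁) := by
    have : ∀ t ∈ Icc t₀ t₁, t ≠ 0 := fun t ht => (hK t ht).1.ne'
    unfold kT
    fun_prop (disch := assumption)
  have hkp : ∀ t ∈ Icc t₀ t₁, 0 < kT t := fun t ht => kT_pos (hK t ht).1 (hK t ht).2
  have hq : ∀ t ∈ Icc t₀ t₁, 1 < (kT t + ρ * η t ρ) / kT t := by
    intro t ht
    have := mul_pos hρ (hη t ht ρ hρ').1
    rw [one_lt_div (hkp t ht)]; linarith
  obtain ⟨σ, hσ₀, hσc, hσ⟩ := exists_left_family (m := m) (γ := γ)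
    (s₀ := fun t => Real.log ((kT t + ρ * η t ρ) / kT t)) hm0 hγ ht₀ ht₀₁.le hρ hρa ha11
    (fun t ht a ha => hE t ht a ⟨(hK t ht).1.le.trans ha.1, ha.2⟩)
    (ContinuousOn.log ((hkc.add (continuousOn_const.mul (hηc ρ hρ'))).div hkc
      fun t ht => (hkp t ht).ne') fun t ht => (zero_lt_one.trans (hq t ht)).ne')
    (fun t ht => Real.log_pos (hq t ht))
  have hexp : ∀ t ∈ Icc t₀ t₁, kT t * Real.exp (σ t (t + ρ)) = kT t + ρ * η t ρ := by
    intro t ht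
    rw [hσ₀ t ht, Real.exp_log (zero_lt_one.trans (hq t ht)), mul_div_cancel₀ _ (hkp t ht).ne']
  have hleft : ∀ t ∈ Icc t₀ t₁, ∀ a ∈ Ioc t a₁, _ := fun t ht a ha =>
    solvesNear_glue_left hm0 hγ (hK t ht).1 (hK t ht).2 (hη t ht) hρ hρr ha11 (hexp t ht)
      (hσ t ht) ha
  have hlocal : ∀ t ∈ Icc t₀ t₁, AnalyticAt ℝ (fun x => x * (kT t + (x - t) * η t (x - t))) t := by
    intro t ht
    have h1 : AnalyticAt ℝ (η t) (t - t) := by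
      rw [sub_self]; exact (hη t ht 0 (by simpa using hr)).2.2.2.2.1
    have h2 : AnalyticAt ℝ (fun x => η t (x - t)) t :=
      h1.comp (f := fun x => x - t) (analyticAt_id.sub analyticAt_const)
    fun_prop
  have hkt : ∀ t ∈ Icc t₀ t₁, t * kT t = (1 - t) ^ 2 := fun t ht => by
    rw [kT, mul_div_cancel₀ _ (hK t ht).1.ne']
  -- At t₁, where λ = B t₁, the orbit ends too low; at t₀ the barrier itself ends at the target and
  -- the orbit lies above it.
  obtain ⟨t, ht, htend⟩ : ∃ t ∈ Icc t₀ t₁, kT t * Real.exp (σ t a₁) = γ * (γ - 1) / (γ + 1) := by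
    refine intermediate_value_Icc' ht₀₁.le (f := fun t => kT t * Real.exp (σ t a₁))
      (hkc.mul (Real.continuous_exp.comp_continuousOn hσc)) ⟨?_, ?_⟩
    · have ht : t₁ ∈ Icc t₀ t₁ := ⟨ht₀₁.le, le_rfl⟩
      have key := end_lt_of_theta_nonpos (Y := fun x =>
        if x ≤ t₁ + ρ then x * (kT t₁ + (x - t₁) * η t₁ (x - t₁))
        else x * (kT t₁ * Real.exp (σ t₁ x))) hmR hγ hγ3 (hK t₁ ht).1 ht₁ hθ₁.le ?_ ?_ ?_ ?_ ?_
      · beta_reduce at key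
        rw [← ha₁, if_neg (not_le.2 hρa), mul_comm] at key
        exact (lt_of_mul_lt_mul_right key ((hK t₁ ht).1.trans ht₁).le).le
      · simp [hρ.le, hkt t₁ ht]
      · intro x hx
        rcases hx.1.eq_or_lt with h | h
        · rw [← h]
          exact ((hlocal t₁ ht).continuousAt.congr
            (ite_eventuallyEq_left (lt_add_of_pos_right _ hρ)).symm).continuousWithinAt
        · exact (hleft t₁ ht x ⟨h, hx.2⟩).1.hasDerivAt.continuousAt.continuousWithinAt
      · exact fun a ha => (hleft t₁ ht a ⟨ha.1, ha.2.le⟩).1.hasDerivAt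
      · exact fun a ha => (sonic_lt_left (hK t₁ ht).1 (hK t₁ ht).2 ha.1 (ha.2.trans ha11)).trans
          (hleft t₁ ht a ⟨ha.1, ha.2.le⟩).2
      · exact fun a ha => GT_neg_of_le hm0 hγ (hK t₁ ht).1 (hK t₁ ht).2 ha.1 (ha.2.trans ha11)
          (hleft t₁ ht a ⟨ha.1, ha.2.le⟩).2.le
    · have ht : t₀ ∈ Icc t₀ t₁ := ⟨le_rfl, ht₀₁.le⟩
      rw [← hk₀]
      have := Real.one_lt_exp_iff.2 (hσ t₀ ht a₁ ⟨by linarith, le_rfl⟩).1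
      exact le_mul_of_one_le_right (hkp t₀ ht).le this.le
  have hn : |(-ρ)| < r := by rwa [abs_neg]
  obtain ⟨hηn, -, -, hηn', -⟩ := hη t ht (-ρ) hn
  have hq0 : 0 < (kT t + -ρ * η t (-ρ)) / kT t := div_pos hηn' (hkp t ht)
  have hq1 : (kT t + -ρ * η t (-ρ)) / kT t < 1 := by
    have := mul_pos hρ hηn
    rw [div_lt_one (hkp t ht)]; linarith
  obtain ⟨τ, hτ₀, hτ⟩ := exists_right_orbit (m := m) (γ := γ) hm0 hγ (hK t ht).1 (hK t ht).2 hρ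
    (hρt.trans_le ht.1) (fun a ha => hE t ht a ⟨ha.1.le, ha.2.le.trans (ht.2.trans ht₁.le)⟩)
    (Real.log_neg hq0 hq1)
  have hexp' : kT t * Real.exp (τ (t - ρ)) = kT t + -ρ * η t (-ρ) := by
    rw [hτ₀, Real.exp_log hq0, mul_div_cancel₀ _ (hkp t ht).ne']
  have hright : ∀ a ∈ Ioo 0 t, _ := fun a ha =>
    solvesNear_glue_right hm0 hγ (hK t ht).1 (hK t ht).2 (hη t ht) hρ hρr hexp' hτ ha
  have hta : t < a₁ := ht.2.trans_lt ht₁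
  have hnear : (fun x => if x ≤ t then
      (if x ≤ t - ρ then x * (kT t * Real.exp (τ x)) else x * (kT t + (x - t) * η t (x - t)))
      else (if x ≤ t + ρ then x * (kT t + (x - t) * η t (x - t))
        else x * (kT t * Real.exp (σ t x)))) =ᶠ[𝓝 t]
      fun x => x * (kT t + (x - t) * η t (x - t)) := by
    filter_upwards [Ioo_mem_nhds (sub_lt_self t hρ) (lt_add_of_pos_right t hρ)] with x hx
    rw [if_neg (not_le.2 hx.1), if_pos hx.2.le, ite_self]
  refine ⟨zT γ t, _, isConnection_of_orbit (Y := fun x => if x ≤ t then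
      (if x ≤ t - ρ then x * (kT t * Real.exp (τ x)) else x * (kT t + (x - t) * η t (x - t)))
      else (if x ≤ t + ρ then x * (kT t + (x - t) * η t (x - t))
        else x * (kT t * Real.exp (σ t x)))) hm hγ (hK t ht).1 hta (hθ t ht) (hE t ht) ?_ ?_ ?_ ?_
      ?_ ?_⟩
  · intro a ha
    refine ⟨(hleft t ht a ha).1.congr (ite_eventuallyEq_right ha.1), ?_⟩
    rw [if_neg (not_le.2 ha.1)]
    exact (hleft t ht a ha).2
  · intro a ha
    refine ⟨(hright a ha).1.congr (ite_eventuallyEq_left ha.2), ?_⟩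
    rw [if_pos ha.2.le]
    exact (hright a ha).2
  · refine hnear.self_of_nhds.trans ?_
    beta_reduce
    rw [sub_self, zero_mul, add_zero, hkt t ht]
  · exact (hlocal t ht).congr hnear.symm
  · rw [hnear.deriv_eq]
    have h1 : DifferentiableAt ℝ (fun x => η t (x - t)) t := by
      have h1 : AnalyticAt ℝ (η t) (t - t) := by
        rw [sub_self]; exact (hη t ht 0 (by simpa using hr)).2.2.2.2.1
      exact (h1.comp (f := fun x => x - t) (analyticAt_id.sub analyticAt_const)).differentiableAt
    have h2 := (hasDerivAt_id' t).fun_mul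
      ((((hasDerivAt_id' t).sub_const t).fun_mul h1.hasDerivAt).const_add (kT t))
    rw [h2.deriv]
    have := (hη t ht 0 (by simpa using hr)).1
    have h3 := mul_pos (hK t ht).1 this
    simp only [sub_self, zero_mul, add_zero, one_mul]
    linarith [hkp t ht]
  · rw [if_neg (not_le.2 hta), ← ha₁, if_neg (by linarith [ht.2]), htend, mul_comm]

end Orbit

end ShockODE

namespace ShockODE

/-! ### The similarity variable along an orbit -/

theorem exists_antideriv {q : ℝ → ℝ} {b a₁ : ℝ} (hq : ∀ a ∈ Ioo 0 b, AnalyticAt ℝ q a)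
    (ha₁ : a₁ ∈ Ioo 0 b) (c : ℝ) :
    ∃ f : ℝ → ℝ, f a₁ = c ∧ ∀ a ∈ Ioo 0 b, AnalyticAt ℝ f a ∧ HasDerivAt f (q a) a := by
  have hcont : ContinuousOn q (Ioo 0 b) := fun a ha => (hq a ha).continuousAt.continuousWithinAt
  have hd : ∀ a ∈ Ioo 0 b, HasDerivAt (fun u => c + ∫ x in a₁..u, q x) (q a) a := by
    intro a ha
    refine (intervalIntegral.integral_hasDerivAt_right ?_ ?_ (hq a ha).continuousAt).const_add c
    · refine (hcont.mono fun x hx => ?_).intervalIntegrable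
      exact (ordConnected_Ioo.uIcc_subset ha₁ ha) hx
    · exact hcont.stronglyMeasurableAtFilter isOpen_Ioo a ha
  refine ⟨fun u => c + ∫ x in a₁..u, q x, by simp, fun a ha => ⟨?_, hd a ha⟩⟩
  refine analyticAt_of_hasDerivAt (hq a ha) ?_
  filter_upwards [isOpen_Ioo.mem_nhds ha] with x hx using hd x hx

/-- The inverse of an increasing analytic function which tends to `-∞` at `0`. -/
theorem exists_analytic_inverse {L q : ℝ → ℝ} {b a₁ : ℝ} (ha₁ : a₁ ∈ Ioo 0 b)
    (hL : ∀ a ∈ Ioo 0 b, AnalyticAt ℝ L a ∧ HasDerivAt L (q a) a) (hq : ∀ a ∈ Ioo 0 b, 0 < q a)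
    (hbot : Tendsto L (𝓝[>] 0) atBot) :
    ∃ A : ℝ → ℝ, A (L a₁) = a₁ ∧ Tendsto A atBot (𝓝[>] 0) ∧ ∀ s ≤ L a₁,
      A s ∈ Ioc 0 a₁ ∧ L (A s) = s ∧ (s < L a₁ → A s < a₁) ∧
        AnalyticAt ℝ A s ∧ HasDerivAt A (q (A s))⁻¹ s := by
  have hcont : ContinuousOn L (Ioo 0 b) := fun a ha => (hL a ha).1.continuousAt.continuousWithinAt
  have hmono : StrictMonoOn L (Ioo 0 b) := by
    refine strictMonoOn_of_deriv_pos (convex_Ioo _ _) hcont fun a ha => ?_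
    rw [interior_Ioo] at ha
    rw [(hL a ha).2.deriv]
    exact hq a ha
  set A := Function.invFunOn L (Ioo 0 b) with hA
  have hAL : ∀ a ∈ Ioo 0 b, A (L a) = a := fun a ha => hmono.injOn.leftInvOn_invFunOn ha
  have hex : ∀ s ≤ L a₁, ∃ a ∈ Ioc 0 a₁, L a = s := by
    intro s hs
    obtain ⟨x, hx1, hx2⟩ := ((hbot.eventually (eventually_le_atBot s)).and
      (Ioo_mem_nhdsGT ha₁.1)).exists
    obtain ⟨a, ha, has⟩ := intermediate_value_Icc hx2.2.le
      (hcont.mono fun y hy => ⟨hx2.1.trans_le hy.1, hy.2.trans_lt ha₁.2⟩) ⟨hx1, hs⟩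
    exact ⟨a, ⟨hx2.1.trans_le ha.1, ha.2⟩, has⟩
  refine ⟨A, hAL a₁ ha₁, ?_, fun s hs => ?_⟩
  · have h0 : ∀ᶠ s in atBot, 0 < A s := by
      filter_upwards [eventually_le_atBot (L a₁)] with s hs
      obtain ⟨a, ha, rfl⟩ := hex s hs
      rw [hAL a ⟨ha.1, ha.2.trans_lt ha₁.2⟩]
      exact ha.1
    refine tendsto_nhdsWithin_iff.2 ⟨?_, h0⟩
    refine tendsto_order.2 ⟨fun x hx => ?_, fun x hx => ?_⟩
    · filter_upwards [h0] with s hs using hx.trans hs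
    · have hm : min x a₁ ∈ Ioo 0 b := ⟨lt_min hx ha₁.1, (min_le_right _ _).trans_lt ha₁.2⟩
      filter_upwards [eventually_le_atBot (L a₁), eventually_lt_atBot (L (min x a₁))] with s hs hs'
      obtain ⟨a, ha, rfl⟩ := hex s hs
      have ha' : a ∈ Ioo 0 b := ⟨ha.1, ha.2.trans_lt ha₁.2⟩
      rw [hAL a ha']
      exact ((hmono.lt_iff_lt ha' hm).1 hs').trans_le (min_le_left _ _)
  · obtain ⟨a, ha, rfl⟩ := hex s hs
    have ha' : a ∈ Ioo 0 b := ⟨ha.1, ha.2.trans_lt ha₁.2⟩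
    rw [hAL a ha']
    have hd := (hL a ha').2
    have hne : deriv L a ≠ 0 := by rw [hd.deriv]; exact (hq a ha').ne'
    have hloc : ∀ᶠ x in 𝓝 a, A (L x) = x := by
      filter_upwards [isOpen_Ioo.mem_nhds ha'] with x hx using hAL x hx
    -- A ∘ L is the identity near a and L' ≠ 0, so A is analytic at L a.
    have hAan : AnalyticAt ℝ A (L a) :=
      (analyticAt_comp_iff_of_deriv_ne_zero (hL a ha').1 hne).1
        (analyticAt_id.congr (hloc.mono fun x hx => hx.symm))
    refine ⟨ha, rfl, fun h => (hmono.lt_iff_lt ha' ha₁).1 h, hAan, ?_⟩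
    have hAd := hAan.differentiableAt.hasDerivAt
    refine hAd.congr_deriv ?_
    have h5 : HasDerivAt (fun x => A (L x)) (deriv A (L a) * q a) a := hAd.comp a hd
    have h6 : HasDerivAt (fun x => A (L x)) 1 a :=
      (hasDerivAt_id' a).congr_of_eventuallyEq hloc
    exact eq_inv_of_mul_eq_one_left (h5.unique h6)

variable {m γ t a : ℝ} {Y : ℝ → ℝ}

namespace SonicOrbit

/-- The quotient `D / G` extends analytically over the triple point. -/
theorem exists_ratio (h : SonicOrbit m γ t Y) (hm : m = 1 ∨ m = 2) (hγ : 1 < γ) (hγ3 : γ ≤ 3)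
    (hY : ∀ a ∈ Ioc 0 (2 / (γ + 1)), AnalyticAt ℝ Y a) :
    ∃ (Q : ℝ → ℝ) (b : ℝ), 2 / (γ + 1) < b ∧ b < 1 ∧ (∀ a ∈ Ioo 0 b, AnalyticAt ℝ Q a ∧ 0 < Q a) ∧
      ∀ a ∈ Ioc 0 (2 / (γ + 1)), GT m γ t a (Y a) * Q a = (1 - a) ^ 2 - Y a ∧
        HasDerivAt Y (2 * Y a / (1 - a) * ((γ - 1) / 2 + (lT m γ t - BT m γ * a) * Q a)) a := by
  have ht := h.t_pos
  have ht1 := h.t_lt_one hγ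
  have hm0 : 0 < m := by rcases hm with rfl | rfl <;> norm_num
  have hθ := h.theta_pos hm hγ hγ3
  have htm : t ∈ Ioc 0 (2 / (γ + 1)) := ⟨ht, h.t_lt.le⟩
  have ha11 := two_div_lt_one hγ
  have ha10 := two_div_add_one_pos hγ
  -- The orbit equation solved for D / G. Near t the divisor λ - B a does not vanish, so E is
  -- analytic across the triple point.
  set E : ℝ → ℝ := fun a => ((1 - a) * deriv Y a / (2 * Y a) - (γ - 1) / 2) /
    (lT m γ t - BT m γ * a) with hEdef
  set q : ℝ → ℝ := fun a => ((1 - a) ^ 2 - Y a) / GT m γ t a (Y a) with hqdef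
  set Q : ℝ → ℝ := fun a => if a = t then E a else q a with hQdef
  have hGne : ∀ a ∈ Ioc 0 (2 / (γ + 1)), a ≠ t → GT m γ t a (Y a) ≠ 0 := by
    intro a ha hat
    rcases lt_or_gt_of_ne hat with h' | h'
    · exact (h.G_right a ⟨ha.1, h'⟩).ne'
    · exact (h.G_left a ⟨h', ha.2⟩).ne
  have hqE : ∀ a ∈ Ioc 0 (2 / (γ + 1)), a ≠ t → lT m γ t - BT m γ * a ≠ 0 → q a = E a := by
    intro a ha hat hl
    have h1a : 1 - a ≠ 0 := by linarith [ha.2]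
    have hYa := (h.pos a ha).ne'
    rw [hEdef]; beta_reduce
    rw [eq_div_iff hl, (h.ode a ha hat).deriv, slopeT, hqdef]
    beta_reduce
    have hg := hGne a ha hat
    generalize GT m γ t a (Y a) = g at *
    field_simp
    ring
  have hQne : ∀ a, a ≠ t → Q =ᶠ[𝓝 a] q := by
    intro a hat
    filter_upwards [isOpen_ne.mem_nhds hat] with x hx using if_neg hx
  have hlne : ∀ᶠ x in 𝓝 t, lT m γ t - BT m γ * x ≠ 0 :=
    (by fun_prop : Continuous fun x : ℝ => lT m γ t - BT m γ * x).continuousAt.eventually_ne hθ.ne'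
  have hQt : Q =ᶠ[𝓝 t] E := by
    filter_upwards [hlne, Ioo_mem_nhds ht h.t_lt] with x hx hx'
    rcases eq_or_ne x t with rfl | hxt
    · exact if_pos rfl
    · exact (if_neg hxt).trans (hqE x ⟨hx'.1, hx'.2.le⟩ hxt hx)
  have hGan : ∀ a ∈ Ioc 0 (2 / (γ + 1)), AnalyticAt ℝ (fun a => GT m γ t a (Y a)) a := by
    intro a ha
    have := hY a ha
    unfold GT
    fun_prop
  have hQan : ∀ a ∈ Ioc 0 (2 / (γ + 1)), AnalyticAt ℝ Q a := by
    intro a ha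
    have hYa := hY a ha
    rcases eq_or_ne a t with rfl | hat
    · refine AnalyticAt.congr ?_ hQt.symm
      have := hYa.deriv
      have h2 : 2 * Y a ≠ 0 := mul_ne_zero two_ne_zero (h.pos a ha).ne'
      have h3 := hθ.ne'
      exact ((((analyticAt_const.sub analyticAt_id).mul this).div (analyticAt_const.mul hYa) h2).sub
        analyticAt_const).div (analyticAt_const.sub (analyticAt_const.mul analyticAt_id)) h3
    · refine AnalyticAt.congr ?_ (hQne a hat).symm
      exact (((analyticAt_const.sub analyticAt_id).pow 2).sub hYa).div (hGan a ha) (hGne a ha hat)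
  have hGQ : ∀ a ∈ Ioc 0 (2 / (γ + 1)), GT m γ t a (Y a) * Q a = (1 - a) ^ 2 - Y a := by
    intro a ha
    rcases eq_or_ne a t with rfl | hat
    · rw [h.at_t, GT_at hγ ht ht1, zero_mul, sub_self]
    · rw [(hQne a hat).self_of_nhds, mul_div_cancel₀ _ (hGne a ha hat)]
  have hQpos : ∀ a ∈ Ioc 0 (2 / (γ + 1)), 0 < Q a := by
    intro a ha
    rcases lt_trichotomy a t with h' | rfl | h'
    · rw [(hQne a h'.ne).self_of_nhds]
      exact div_pos (sub_pos.2 (h.sonic_right a ⟨ha.1, h'⟩)) (h.G_right a ⟨ha.1, h'⟩)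
    -- Differentiating G Q = D at the triple point gives G' Q = D'; both derivatives are negative,
    -- G' by `kT_lt_deriv`.
    · have h1 := (h.hasDerivAt_GT hγ).fun_mul (hQan a ha).differentiableAt.hasDerivAt
      have h2 : HasDerivAt (fun x => (1 - x) ^ 2 - Y x) (2 * (1 - a) * (-1) - deriv Y a) a := by
        simpa using (((hasDerivAt_id' a).const_sub 1).fun_pow 2).fun_sub
          (h.diff a ha).hasDerivAt
      have h3 : (fun x => GT m γ a x (Y x) * Q x) =ᶠ[𝓝 a] fun x => (1 - x) ^ 2 - Y x := by
        filter_upwards [Ioo_mem_nhds ht h.t_lt] with x hx using hGQ x ⟨hx.1, hx.2.le⟩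
      have h4 := h1.unique (h2.congr_of_eventuallyEq h3)
      rw [h.at_t, GT_at hγ ht ht1, zero_mul, add_zero] at h4
      have hk := h.kT_lt_deriv hm hγ hγ3
      have hkp := kT_pos ht ht1
      have hc := cT_pos hm0 hγ ht ht1 (le_refl a)
      have hb : 0 < bT m γ a - a := by
        linarith [one_div_lt_bT hm0 hγ ht ht1, one_lt_one_div ht ht1]
      have hP : 0 < a * (bT m γ a - a) + (deriv Y a - kT a) * cT m γ a a := by
        have := mul_pos (sub_pos.2 hk) hc
        have := mul_pos ht hb
        linarith
      have : 0 < (a * (bT m γ a - a) + (deriv Y a - kT a) * cT m γ a a) * Q a := by linarith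
      exact pos_of_mul_pos_right this hP.le
    · rw [(hQne a h'.ne').self_of_nhds]
      exact div_pos_of_neg_of_neg (sub_neg.2 (h.sonic_left a ⟨h', ha.2⟩)) (h.G_left a ⟨h', ha.2⟩)
  have ham : 2 / (γ + 1) ∈ Ioc 0 (2 / (γ + 1)) := ⟨ha10, le_rfl⟩
  obtain ⟨ε, hε, hball⟩ := Metric.eventually_nhds_iff_ball.1 ((hQan _ ham).eventually_analyticAt.and
    ((hQan _ ham).continuousAt.eventually (lt_mem_nhds (hQpos _ ham))))
  obtain ⟨b, hb1, hb2⟩ := exists_between (lt_min (lt_add_of_pos_right (2 / (γ + 1)) hε) ha11)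
  refine ⟨Q, b, hb1, hb2.trans_le (min_le_right _ _), fun a ha => ?_, fun a ha => ⟨hGQ a ha, ?_⟩⟩
  · rcases le_or_gt a (2 / (γ + 1)) with h' | h'
    · exact ⟨hQan a ⟨ha.1, h'⟩, hQpos a ⟨ha.1, h'⟩⟩
    · refine hball a ?_
      rw [Metric.mem_ball, Real.dist_eq, abs_of_pos (sub_pos.2 h')]
      linarith [ha.2, hb2.trans_le (min_le_left _ _)]
  · have hd := (h.diff a ha).hasDerivAt
    refine hd.congr_deriv ?_
    have h1a : 1 - a ≠ 0 := by linarith [ha.2]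
    rcases eq_or_ne a t with rfl | hat
    · rw [hQt.self_of_nhds]
      have hYa := (h.pos a ha).ne'
      have h3 := hθ.ne'
      rw [hEdef]; beta_reduce
      rw [mul_div_cancel₀ _ h3]
      field_simp
      ring
    · rw [(h.ode a ha hat).deriv, slopeT, (hQne a hat).self_of_nhds, hqdef, mul_div_assoc']

end SonicOrbit

end ShockODE

namespace ShockODE

/-! ### Behaviour at the origin -/

section Limits

variable {m γ t : ℝ} {Y : ℝ → ℝ}

/-- Here q stands for a D / G. The last bound gives a κ' ≥ δ κ, so κ decays like a power of a; the
third one says that 1 - λ q is of order a + κ. -/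
theorem origin_bounds {m z l B k δ a κ q : ℝ} (hm : 0 < m) (hz : 0 < z) (hl : 1 < l)
    (ha : 0 < a) (ha2 : a ≤ 1 / 2) (hma : (m + 1) * a ≤ 2 * m * z) (hla : 0 < l - B * a)
    (hκ0 : 0 < κ) (hκk : κ < k) (hδ0 : 0 < δ)
    (hδM : δ * (l + 2 * m * z * k) = (l - 2 * m * z * k) / 2)
    (hP : (l - 2 * m * z * k) / 2 <
      2 * (l - B * a) * ((1 - a) ^ 2 - k * a) - ((1 - a) * (l - a) + 2 * m * z * k))
    (hD : κ * a < (1 - a) ^ 2)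
    (hq : ((1 - a) * (l - a) + κ * (2 * m * z - (m + 1) * a)) * q = (1 - a) ^ 2 - κ * a) :
    0 < q ∧ q ≤ 4 ∧ |1 - l * q| ≤ 4 * (2 * m * z + l + m + 1) * (a + κ) ∧
      1 + δ ≤ 2 * (l - B * a) * q := by
  have hmz : 0 < m * z := mul_pos hm hz
  set g := (1 - a) * (l - a) + κ * (2 * m * z - (m + 1) * a) with hg
  have hg4 : 1 / 4 ≤ g := by
    have h1 : 0 ≤ κ * (2 * m * z - (m + 1) * a) := mul_nonneg hκ0.le (by linarith)
    have h2 : 1 / 2 * (1 / 2) ≤ (1 - a) * (l - a) := by gcongr <;> linarith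
    linarith
  have hgu : g ≤ (1 - a) * (l - a) + 2 * m * z * k := by
    have h1 : κ * (2 * m * z - (m + 1) * a) ≤ κ * (2 * m * z) :=
      mul_le_mul_of_nonneg_left (by linarith [mul_pos (by linarith : 0 < m + 1) ha]) hκ0.le
    have h2 : κ * (2 * m * z) ≤ k * (2 * m * z) := by gcongr
    linarith
  have hgM : g ≤ l + 2 * m * z * k := by
    have : (1 - a) * (l - a) ≤ 1 * l := by gcongr <;> linarith
    linarith
  have hg0 : 0 < g := by linarith
  have hq0 : 0 < q := pos_of_mul_pos_right (by linarith) hg0.le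
  refine ⟨hq0, ?_, ?_, ?_⟩
  · have h1 : 0 < κ * a := mul_pos hκ0 ha
    have h2 : 1 / 4 * q ≤ g * q := by gcongr
    have h3 : (1 - a) ^ 2 ≤ 1 := by nlinarith
    linarith
  · have e2 : g * (1 - l * q) =
        a * ((1 - a) * (l - 1)) + κ * (2 * m * z + (l - m - 1) * a) := by
      rw [mul_sub, mul_left_comm, hq, hg]; ring
    have h3 : |(1 - a) * (l - 1)| ≤ 2 * m * z + l + m + 1 := by
      rw [abs_of_nonneg (mul_nonneg (by linarith) (by linarith))]
      have : (1 - a) * (l - 1) ≤ 1 * (l - 1) := by gcongr; linarith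
      linarith
    have h4 : |2 * m * z + (l - m - 1) * a| ≤ 2 * m * z + l + m + 1 := by
      have h5 : (l + m + 1) * a ≤ (l + m + 1) * 1 := by gcongr; linarith
      have h6 : 0 < (l + m + 1) * a := by positivity
      have h7 : 0 < (m + 1) * a := by positivity
      have h8 : 0 < l * a := by positivity
      rw [abs_le]
      constructor <;> linarith
    have h1 : g * |1 - l * q| ≤ (2 * m * z + l + m + 1) * (a + κ) := by
      rw [← abs_of_pos hg0, ← abs_mul, e2]
      refine (abs_add_le _ _).trans ?_
      rw [abs_mul a, abs_mul κ, abs_of_pos ha, abs_of_pos hκ0, mul_add, mul_comm a, mul_comm κ]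
      gcongr
    have h2 : 1 / 4 * |1 - l * q| ≤ g * |1 - l * q| := by gcongr
    linarith
  · have h1 : 2 * (l - B * a) * ((1 - a) ^ 2 - k * a) ≤
        2 * (l - B * a) * ((1 - a) ^ 2 - κ * a) := by gcongr
    have h2 : g * (1 + δ) ≤ g * (2 * (l - B * a) * q) := by
      have h3 : g * (2 * (l - B * a) * q) = 2 * (l - B * a) * ((1 - a) ^ 2 - κ * a) := by
        rw [← hq]; ring
      have h4 : g * δ ≤ (l - 2 * m * z * k) / 2 := by rw [← hδM, mul_comm]; gcongr
      rw [h3]; linarith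
    exact le_of_mul_le_mul_left h2 hg0

-- L will be log(-x) and W will be log R, so these limits are those of V/x, C/x and R at collapse.
-- In each case the derivative is dominated by that of a bounded function.
set_option maxHeartbeats 1000000 in
theorem SonicOrbit.exists_limits (h : SonicOrbit m γ t Y) (hm : m = 1 ∨ m = 2) (hγ : 1 < γ)
    (hγ3 : γ ≤ 3) {Q L W : ℝ → ℝ}
    (hQ : ∀ a ∈ Ioc 0 (2 / (γ + 1)), GT m γ t a (Y a) * Q a = (1 - a) ^ 2 - Y a ∧
      HasDerivAt Y (2 * Y a / (1 - a) * ((γ - 1) / 2 + (lT m γ t - BT m γ * a) * Q a)) a)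
    (hL : ∀ a ∈ Ioc 0 (2 / (γ + 1)), HasDerivAt L (lT m γ t * Q a) a)
    (hW : ∀ a ∈ Ioc 0 (2 / (γ + 1)), HasDerivAt W ((1 - (m + 1) * (a * Q a)) / (1 - a)) a) :
    (∃ l, Tendsto (fun a => Real.log a - L a) (𝓝[>] 0) (𝓝 l)) ∧
    (∃ l, Tendsto (fun a => Real.log (Y a) / 2 - L a) (𝓝[>] 0) (𝓝 l)) ∧
    ∃ l, Tendsto W (𝓝[>] 0) (𝓝 l) := by
  have ht := h.t_pos
  have ht1 := h.t_lt_one hγ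
  have hm0 : 0 < m := by rcases hm with rfl | rfl <;> norm_num
  have hθ := h.theta_pos hm hγ hγ3
  have hz := zT_pos hγ ht ht1
  have hk := kT_pos ht ht1
  have hl1 := one_lt_lT hm0 hγ ht ht1
  have hE := h.eT_pos hm hγ hγ3 le_rfl (two_div_add_one_pos hγ).le
  have hB : 0 < BT m γ := by
    have : 0 < m * (γ - 1) := mul_pos hm0 (by linarith)
    rw [BT]; linarith
  have hP0 : 0 < lT m γ t - 2 * m * zT γ t * kT t := by
    have e : eT m γ t 0 * t = lT m γ t - 2 * m * zT γ t * kT t := by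
      rw [eT, bT]; field_simp; ring
    rw [← e]; exact mul_pos hE ht
  have hGT : ∀ a y, a ≠ 0 → GT m γ t a y = a * ((1 - a) * (lT m γ t - a)
      + y / a * (2 * m * zT γ t - (m + 1) * a)) := by
    intro a y ha; rw [GT]; field_simp; ring
  have hYk : ∀ a ∈ Ioo 0 t, Y a < kT t * a := fun a ha => h.barrier_right hm hγ hγ3 ha
  generalize lT m γ t = l at *
  generalize BT m γ = B at *
  generalize zT γ t = z at *
  generalize kT t = k at *
  -- At a = 0 the bracket equals λ - 2mzk = t · eT(0) > 0, so near 0 it exceeds half this value.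
  obtain ⟨b, hb0, hbt, hb2, hbm, hbP⟩ : ∃ b > 0, b < t ∧ b ≤ 1 / 2 ∧ (m + 1) * b ≤ 2 * m * z ∧
      ∀ a ∈ Ioc 0 b, (l - 2 * m * z * k) / 2 <
        2 * (l - B * a) * ((1 - a) ^ 2 - k * a) - ((1 - a) * (l - a) + 2 * m * z * k) := by
    have hcont : Continuous fun a : ℝ =>
      2 * (l - B * a) * ((1 - a) ^ 2 - k * a) - ((1 - a) * (l - a) + 2 * m * z * k) := by fun_prop
    have h1 := (hcont.continuousAt (x := 0)).eventually
      (lt_mem_nhds (a := (l - 2 * m * z * k) / 2) (by simp only [mul_zero]; linarith))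
    obtain ⟨ε, hε, hball⟩ := Metric.eventually_nhds_iff_ball.1 h1
    refine ⟨min (min (ε / 2) (t / 2)) (min (1 / 2) (2 * m * z / (m + 1))), ?_, ?_, ?_, ?_, ?_⟩
    · exact lt_min (lt_min (by positivity) (by positivity)) (lt_min (by norm_num) (by positivity))
    · refine ((min_le_left _ _).trans (min_le_right _ _)).trans_lt (by linarith)
    · exact (min_le_right _ _).trans (min_le_left _ _)
    · have h2 : min (min (ε / 2) (t / 2)) (min (1 / 2) (2 * m * z / (m + 1)))
          ≤ 2 * m * z / (m + 1) := (min_le_right _ _).trans (min_le_right _ _)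
      rw [le_div_iff₀ (by positivity)] at h2
      linarith
    · intro a ha
      refine hball a ?_
      have h2 := ha.2.trans ((min_le_left _ _).trans (min_le_left _ _))
      rw [Metric.mem_ball, Real.dist_eq, sub_zero, abs_of_pos ha.1]
      linarith
  have hsub : ∀ a ∈ Ioc 0 b, a ∈ Ioc 0 (2 / (γ + 1)) := fun a ha =>
    ⟨ha.1, (ha.2.trans hbt.le).trans h.t_lt.le⟩
  set N := 2 * m * z + l + m + 1 with hN
  have hN0 : 0 < N := by positivity
  set δ := (l - 2 * m * z * k) / 2 / (l + 2 * m * z * k) with hδ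
  have hM2 : 0 < l + 2 * m * z * k := by positivity
  have hδ0 : 0 < δ := div_pos (by linarith) hM2
  have hδM : δ * (l + 2 * m * z * k) = (l - 2 * m * z * k) / 2 := div_mul_cancel₀ _ hM2.ne'
  have key : ∀ a ∈ Ioc 0 b, 0 < a * Q a ∧ a * Q a ≤ 4 ∧
      |1 - l * (a * Q a)| ≤ 4 * N * (a + Y a / a) ∧ 1 + δ ≤ 2 * (l - B * a) * (a * Q a) := by
    intro a ha
    have ha0 := ha.1
    have hab := ha.2
    have hat : a < t := ha.2.trans_lt hbt
    have hY0 := h.pos a (hsub a ha)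
    have hκ0 : 0 < Y a / a := div_pos hY0 ha0
    have hκk : Y a / a < k := by rw [div_lt_iff₀ ha0]; exact hYk a ⟨ha0, hat⟩
    have hD := h.sonic_right a ⟨ha0, hat⟩
    have hYκ : Y a = Y a / a * a := (div_mul_cancel₀ _ ha0.ne').symm
    have e := (hQ a (hsub a ha)).1
    rw [hGT a _ ha0.ne'] at e
    refine origin_bounds hm0 hz hl1 ha0 (hab.trans hb2) (le_trans (by gcongr) hbm)
      (by nlinarith) hκ0 hκk hδ0 hδM (hbP a ha) (by linarith) ?_
    linear_combination e - hYκ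
  refine ⟨?_, ?_, ?_⟩
  -- The error term κ / a need not be bounded, but it is at most κ' / δ, and κ is bounded by k.
  · refine exists_tendsto_of_abs_deriv_le (b := b) (B := 4 * N * b + 4 * N / δ * k) hb0
      (f' := fun a => a⁻¹ - l * Q a)
      (g := fun a => 4 * N * a + 4 * N / δ * (Y a / a))
      (g' := fun a => 4 * N * 1 + 4 * N / δ *
        ((2 * Y a / (1 - a) * ((γ - 1) / 2 + (l - B * a) * Q a) * a - Y a * 1) / a ^ 2)) ?_ ?_ ?_ ?_
    · exact fun a ha => (Real.hasDerivAt_log ha.1.ne').fun_sub (hL a (hsub a ha))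
    · intro a ha
      exact ((hasDerivAt_id' a).const_mul _).fun_add
        (((hQ a (hsub a ha)).2.fun_div (hasDerivAt_id' a) ha.1.ne').const_mul _)
    · intro a ha
      obtain ⟨h1, -, h3, h4⟩ := key a ha
      have ha0 := ha.1
      have hab := ha.2
      have hY0 := h.pos a (hsub a ha)
      have e1 : a⁻¹ - l * Q a = (1 - l * (a * Q a)) / a := by field_simp
      rw [e1, abs_div, abs_of_pos ha0, div_le_iff₀ ha0]
      refine h3.trans ?_
      have h5 : (1 + δ) * Y a ≤ 2 * Y a / (1 - a) * ((γ - 1) / 2 + (l - B * a) * Q a) * a := by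
        have h1a : 0 < 1 - a := by linarith
        have h6 : 2 * Y a ≤ 2 * Y a / (1 - a) := by
          rw [le_div_iff₀ (by linarith)]; nlinarith
        have h7 : 0 < (l - B * a) * (a * Q a) := by linarith
        have h8 : (l - B * a) * (a * Q a) ≤ ((γ - 1) / 2 + (l - B * a) * Q a) * a := by nlinarith
        calc (1 + δ) * Y a ≤ 2 * Y a * ((l - B * a) * (a * Q a)) := by nlinarith
          _ ≤ 2 * Y a / (1 - a) * (((γ - 1) / 2 + (l - B * a) * Q a) * a) := by gcongr
          _ = _ := by ring
      have h9 : δ * Y a / a ^ 2 ≤ (2 * Y a / (1 - a) * ((γ - 1) / 2 + (l - B * a) * Q a) * a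
          - Y a * 1) / a ^ 2 := by
        gcongr; linarith
      have h10 : 4 * N / δ * (δ * Y a / a ^ 2) ≤ 4 * N / δ * ((2 * Y a / (1 - a) *
          ((γ - 1) / 2 + (l - B * a) * Q a) * a - Y a * 1) / a ^ 2) := by gcongr
      have e3 : 4 * N * (a + Y a / a) = (4 * N * 1 + 4 * N / δ * (δ * Y a / a ^ 2)) * a := by
        field_simp
      rw [e3]
      gcongr
    · intro a ha
      have hκk : Y a / a < k := by
        rw [div_lt_iff₀ ha.1]; exact hYk a ⟨ha.1, ha.2.trans_lt hbt⟩
      have hκ0 : 0 < Y a / a := div_pos (h.pos a (hsub a ha)) ha.1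
      have ha0 := ha.1
      have hab := ha.2
      rw [abs_of_pos (by positivity)]
      gcongr
  -- In the derivative of log C - L the term λ Q of order 1/a cancels and leaves a bounded function.
  · refine exists_tendsto_of_abs_deriv_le (b := b) (B := 2 * (γ + 4 * |l - B|) * b) hb0
      (f' := fun a => 2 * Y a / (1 - a) * ((γ - 1) / 2 + (l - B * a) * Q a) / Y a / 2 - l * Q a)
      (g := fun a => 2 * (γ + 4 * |l - B|) * a)
      (g' := fun a => 2 * (γ + 4 * |l - B|) * 1) ?_ ?_ ?_ ?_
    · intro a ha
      exact (((hQ a (hsub a ha)).2.log (h.pos a (hsub a ha)).ne').div_const 2).fun_sub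
        (hL a (hsub a ha))
    · exact fun a ha => (hasDerivAt_id' a).const_mul _
    · intro a ha
      obtain ⟨h1, h2, -, -⟩ := key a ha
      have hY0 := (h.pos a (hsub a ha)).ne'
      have h1a : 0 < 1 - a := by linarith [ha.2]
      have e : 2 * Y a / (1 - a) * ((γ - 1) / 2 + (l - B * a) * Q a) / Y a / 2 - l * Q a =
          ((γ - 1) / 2 + (l - B) * (a * Q a)) / (1 - a) := by
        field_simp; ring
      rw [e, abs_div, abs_of_pos h1a, div_le_iff₀ h1a]
      have h3 : |(γ - 1) / 2 + (l - B) * (a * Q a)| ≤ γ + 4 * |l - B| := by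
        refine (abs_add_le _ _).trans ?_
        rw [abs_mul, abs_of_pos h1, abs_of_pos (by linarith : 0 < (γ - 1) / 2)]
        nlinarith [abs_nonneg (l - B)]
      nlinarith [abs_nonneg (l - B), ha.2]
    · intro a ha
      have ha0 := ha.1
      have hab := ha.2
      have : 0 < γ := by linarith
      rw [abs_of_pos (by positivity)]
      gcongr
  · refine exists_tendsto_of_abs_deriv_le (b := b) (B := 2 * (1 + (m + 1) * 4) * b) hb0
      (f' := fun a => (1 - (m + 1) * (a * Q a)) / (1 - a))
      (g := fun a => 2 * (1 + (m + 1) * 4) * a)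
      (g' := fun a => 2 * (1 + (m + 1) * 4) * 1) (fun a ha => hW a (hsub a ha)) ?_ ?_ ?_
    · exact fun a ha => (hasDerivAt_id' a).const_mul _
    · intro a ha
      obtain ⟨h1, h2, -, -⟩ := key a ha
      have h1a : 0 < 1 - a := by linarith [ha.2]
      rw [abs_div, abs_of_pos h1a, div_le_iff₀ h1a]
      have h3 : |1 - (m + 1) * (a * Q a)| ≤ 1 + (m + 1) * 4 := by
        have h4 : (m + 1) * (a * Q a) ≤ (m + 1) * 4 := by gcongr
        have h5 : 0 < (m + 1) * (a * Q a) := by positivity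
        rw [abs_le]; constructor <;> linarith
      refine h3.trans ?_
      have h6 : 0 ≤ (1 + (m + 1) * 4) * (1 - 2 * a) :=
        mul_nonneg (by positivity) (by linarith [ha.2])
      linarith
    · intro a ha
      have ha0 := ha.1
      have hab := ha.2
      rw [abs_of_pos (by positivity)]
      gcongr

end Limits

/-! ### The Euler equations in self-similar form -/

section Euler

variable {m : ℕ} {γ l t r V' C' R' : ℝ} {V C R : ℝ → ℝ}

theorem hasDerivAt_similarity_time (t r l : ℝ) :
    HasDerivAt (fun s => s / r ^ l) (1 / r ^ l) t := (hasDerivAt_id' t).div_const _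

theorem hasDerivAt_similarity_radius (hr : 0 < r) (t l : ℝ) :
    HasDerivAt (fun y => t / y ^ l) (-(l * (t / r ^ l) / r)) r := by
  have h1 := (Real.hasDerivAt_rpow_const (x := r) (p := l) (Or.inl hr.ne')).inv
    (Real.rpow_pos_of_pos hr l).ne'
  have h2 := h1.const_mul t
  refine (h2.congr_of_eventuallyEq ?_).congr_deriv ?_
  · filter_upwards with y; rw [div_eq_mul_inv]; rfl
  · have := (Real.rpow_pos_of_pos hr l).ne'
    rw [Real.rpow_sub_one hr.ne']
    field_simp

/-- The chain rule for x = t / r^l turns the system into ordinary differential equations in x d/dx,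
which are the last three hypotheses. -/
theorem eulerAt_of_profile (ht : t ≠ 0) (hr : 0 < r) (hl : l ≠ 0) (hγ : γ ≠ 0)
    (hV : HasDerivAt V V' (t / r ^ l)) (hC : HasDerivAt C C' (t / r ^ l))
    (hR : HasDerivAt R R' (t / r ^ l)) (hR0 : R (t / r ^ l) ≠ 0)
    (mass : l * (t / r ^ l * R' * (1 + V (t / r ^ l)) + R (t / r ^ l) * (t / r ^ l * V')) =
      (m + 1) * R (t / r ^ l) * V (t / r ^ l))
    (momentum : l * (V (t / r ^ l) - (1 + V (t / r ^ l)) * (t / r ^ l * V')) + V (t / r ^ l) ^ 2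
      + 1 / γ * (2 * C (t / r ^ l) ^ 2 - l * (t / r ^ l * R' / R (t / r ^ l) * C (t / r ^ l) ^ 2
        + 2 * C (t / r ^ l) * (t / r ^ l * C'))) = 0)
    (sound : l * (C (t / r ^ l) - (1 + V (t / r ^ l)) * (t / r ^ l * C'))
      + V (t / r ^ l) * C (t / r ^ l)
      - (γ - 1) / 2 * C (t / r ^ l) * (l * (t / r ^ l * V') - (m + 1) * V (t / r ^ l)) = 0) :
    EulerAt m γ (densityField l R) (scaledField l V) (scaledField l C) t r := by
  have hrl := (Real.rpow_pos_of_pos hr l).ne'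
  have hsim : DifferentiableAt ℝ (fun p : ℝ × ℝ => p.1 / p.2 ^ l) (t, r) := by
    have h1 : DifferentiableAt ℝ (fun p : ℝ × ℝ => p.2 ^ l) (t, r) :=
      differentiableAt_snd.rpow_const (Or.inl hr.ne')
    simp only [div_eq_mul_inv]
    exact differentiableAt_fst.fun_mul (h1.fun_inv hrl)
  have hpre : DifferentiableAt ℝ (fun p : ℝ × ℝ => -(p.2 / (l * p.1))) (t, r) := by
    have h1 : DifferentiableAt ℝ (fun p : ℝ × ℝ => l * p.1) (t, r) :=
      differentiableAt_fst.const_mul l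
    simp only [div_eq_mul_inv]
    exact (differentiableAt_snd.fun_mul (h1.fun_inv (mul_ne_zero hl ht))).fun_neg
  have hcomp : ∀ {f : ℝ → ℝ} {f' : ℝ}, HasDerivAt f f' (t / r ^ l) →
      DifferentiableAt ℝ (fun p : ℝ × ℝ => f (p.1 / p.2 ^ l)) (t, r) := fun {f f'} hf =>
    DifferentiableAt.comp (t, r) (g := f) (f := fun p : ℝ × ℝ => p.1 / p.2 ^ l)
      hf.differentiableAt hsim
  have hT : ∀ {f : ℝ → ℝ} {f' : ℝ}, HasDerivAt f f' (t / r ^ l) →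
      HasDerivAt (fun s => f (s / r ^ l)) (f' * (1 / r ^ l)) t := fun {f f'} hf =>
    HasDerivAt.comp t hf (hasDerivAt_similarity_time t r l)
  have hX : ∀ {f : ℝ → ℝ} {f' : ℝ}, HasDerivAt f f' (t / r ^ l) →
      HasDerivAt (fun y => f (t / y ^ l)) (f' * -(l * (t / r ^ l) / r)) r := fun {f f'} hf =>
    HasDerivAt.comp r hf (hasDerivAt_similarity_radius hr t l)
  have hpT : HasDerivAt (fun s => -(r / (l * s))) (r / (l * t ^ 2)) t := by
    have := ((hasDerivAt_const t r).fun_div ((hasDerivAt_id' t).const_mul l)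
      (mul_ne_zero hl ht)).fun_neg
    refine this.congr_deriv ?_
    field_simp; ring
  have hpX : HasDerivAt (fun y => -(y / (l * t))) (-(1 / (l * t))) r :=
    ((hasDerivAt_id' r).div_const _).fun_neg
  have hsT : ∀ {f : ℝ → ℝ} {f' : ℝ}, HasDerivAt f f' (t / r ^ l) →
      HasDerivAt (fun s => scaledField l f s r)
        (r / (l * t ^ 2) * (f (t / r ^ l) - t / r ^ l * f')) t := fun {f f'} hf => by
    refine (hpT.fun_mul (hT hf)).congr_deriv ?_
    field_simp; ring
  have hsX : ∀ {f : ℝ → ℝ} {f' : ℝ}, HasDerivAt f f' (t / r ^ l) →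
      HasDerivAt (fun y => scaledField l f t y)
        (1 / (l * t) * (l * (t / r ^ l * f') - f (t / r ^ l))) r := fun {f f'} hf => by
    refine (hpX.fun_mul (hX hf)).congr_deriv ?_
    field_simp; ring
  have hdX : HasDerivAt (fun y => densityField l R t y) (R' * -(l * (t / r ^ l) / r)) r := hX hR
  have hdT : HasDerivAt (fun s => densityField l R s r) (R' * (1 / r ^ l)) t := hT hR
  refine ⟨hcomp hR, hpre.fun_mul (hcomp hV), hpre.fun_mul (hcomp hC), ?_, ?_, ?_⟩
  · rw [hdT.deriv, (hdX.fun_mul (hsX hV)).deriv]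
    have e : R' * (1 / r ^ l) = 1 / t * (t / r ^ l * R') := by field_simp
    rw [e]
    simp only [densityField, scaledField] at *
    generalize t / r ^ l = x at *
    field_simp
    linear_combination mass
  · rw [(hsT hV).deriv, (hsX hV).deriv, (hdX.fun_mul ((hsX hC).fun_pow 2)).deriv]
    simp only [Nat.cast_ofNat, Nat.add_one_sub_one, pow_one]
    simp only [densityField, scaledField] at *
    generalize t / r ^ l = x at *
    have := congrArg (fun y => r / (l ^ 2 * t ^ 2) * y) momentum
    simp only [mul_zero] at this
    refine Eq.trans ?_ this
    field_simp
    ring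
  · rw [(hsT hC).deriv, (hsX hV).deriv, (hsX hC).deriv]
    simp only [densityField, scaledField] at *
    generalize t / r ^ l = x at *
    have := congrArg (fun y => r / (l ^ 2 * t ^ 2) * y) sound
    simp only [mul_zero] at this
    refine Eq.trans ?_ this
    field_simp
    ring

theorem div_shockRadius_rpow (hl : l ≠ 0) (ht : t < 0) : t / shockRadius l t ^ l = -1 := by
  rw [shockRadius, ← Real.rpow_mul (neg_nonneg.2 ht.le), one_div_mul_cancel hl, Real.rpow_one,
    div_neg_self ht.ne]

theorem eq_shockRadius (hl : l ≠ 0) (hr : 0 < r) (h : t / r ^ l = -1) :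
    r = shockRadius l t := by
  have hrl := (Real.rpow_pos_of_pos hr l).ne'
  have : -t = r ^ l := by
    rw [div_eq_iff hrl] at h; linarith
  rw [shockRadius, this, ← Real.rpow_mul hr.le, mul_one_div_cancel hl, Real.rpow_one]

theorem deriv_shockRadius (ht : t < 0) : deriv (shockRadius l) t = shockRadius l t / (l * t) := by
  have h1 := (hasDerivAt_neg t).rpow_const (p := 1 / l) (Or.inl (neg_pos.2 ht).ne')
  have h2 : HasDerivAt (shockRadius l) (-1 * (1 / l) * (-t) ^ (1 / l - 1)) t := h1
  rw [h2.deriv, Real.rpow_sub_one (neg_pos.2 ht).ne', shockRadius, div_neg]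
  ring

/-- Strong-shock relations, homogeneous in the speed S. The Lax condition behind the shock is 1 + V₁
< C₁, that is D < 0 at the post-shock point. -/
theorem shockConditions_start (hγ : 1 < γ) {S : ℝ} (hS : 0 < S) :
    ShockConditions γ (-S) 1 0 0 (1 / (1 + V₁ γ)) (S * V₁ γ) (S * C₁ γ) := by
  have hg : 0 < γ + 1 := by linarith
  have hg1 : 0 < γ - 1 := by linarith
  have hC := C₁_sq hγ
  have hu : 1 + V₁ γ = (γ - 1) / (γ + 1) := by rw [V₁]; field_simp; ring
  have hC1 := C₁_pos hγ
  have hu0 : 0 < (γ - 1) / (γ + 1) := div_pos hg1 hg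
  have hp : (S * C₁ γ) ^ 2 = S ^ 2 * (γ * (γ - 1) / (γ + 1) * (2 / (γ + 1))) := by rw [mul_pow, hC]
  have hγ0 : γ ≠ 0 := by linarith
  have hg1' := hg1.ne'
  constructor
  · rw [hu, V₁]; field_simp; ring
  · simp only [pressure]; rw [hu, hp, V₁]; field_simp; ring
  · simp only [energy, pressure]; rw [hu, hp, V₁]; field_simp; ring
  · simpa using hS.ne'
  · have e : S * V₁ γ - -S = S * ((γ - 1) / (γ + 1)) := by rw [← hu]; ring
    rw [e, abs_of_pos (mul_pos hS hu0)]
    refine mul_lt_mul_of_pos_left ?_ hS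
    refine lt_of_pow_lt_pow_left₀ 2 hC1.le ?_
    rw [hC, start_eq hγ]
    nlinarith

end Euler

end ShockODE

namespace ShockODE

/-! ### The shock obtained from a connection -/

section Profile

variable {m γ t a c q : ℝ}

/-- The momentum balance is (D - G q) / (q(1-a)), so it encodes the definition of q; mass and sound
hold by the choice of the derivatives of log R and C. -/
theorem profile_momentum (hγ : γ ≠ 0) (hl : lT m γ t ≠ 0) (ha : 1 - a ≠ 0) (hq : q ≠ 0)
    (hG : GT m γ t a (c ^ 2) * q = (1 - a) ^ 2 - c ^ 2) :
    lT m γ t * (-a - (1 + -a) * -(1 / (lT m γ t * q))) + (-a) ^ 2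
      + 1 / γ * (2 * c ^ 2 - lT m γ t *
        ((1 - (m + 1) * (a * q)) / (1 - a) * (1 / (lT m γ t * q)) * c ^ 2
        + 2 * c * (c / (1 - a) * ((γ - 1) / 2 + (lT m γ t - BT m γ * a) * q)
          * (1 / (lT m γ t * q))))) = 0 := by
  have e : lT m γ t * (-a - (1 + -a) * -(1 / (lT m γ t * q))) + (-a) ^ 2
      + 1 / γ * (2 * c ^ 2 - lT m γ t *
        ((1 - (m + 1) * (a * q)) / (1 - a) * (1 / (lT m γ t * q)) * c ^ 2
        + 2 * c * (c / (1 - a) * ((γ - 1) / 2 + (lT m γ t - BT m γ * a) * q)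
          * (1 / (lT m γ t * q))))) =
      ((1 - a) ^ 2 - c ^ 2 - GT m γ t a (c ^ 2) * q) / (q * (1 - a)) := by
    have h2 : 2 * m * zT γ t = (2 * lT m γ t - 2) / γ := by rw [lT]; field_simp; ring
    rw [GT, h2, BT]
    generalize lT m γ t = l at *
    field_simp
    ring
  rw [e, hG, sub_self, zero_div]

end Profile

variable {m : ℕ} {γ z : ℝ} {C : ℝ → ℝ}

theorem IsConnection.exists_shock (h : IsConnection m γ z C) (hm : m = 1 ∨ m = 2) (hγ : 1 < γ)
    (hγ3 : γ ≤ 3) : ∃ Vx Cx Rx : ℝ → ℝ, IsConvergingShock m γ (lam m γ z) Vx Cx Rx ∧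
      Vx (-1) = V₁ γ ∧ ∀ x ∈ Ico (-1 : ℝ) 0, Vx x ∈ Ico (V₁ γ) 0 ∧ Cx x = C (Vx x) := by
  obtain ⟨t, rfl, -, ho⟩ := h.exists_orbit hm hγ hγ3
  have hmR : (m : ℝ) = 1 ∨ (m : ℝ) = 2 := by rcases hm with rfl | rfl <;> norm_num
  have hm0 : (0 : ℝ) < m := by rcases hm with rfl | rfl <;> norm_num
  have hlam : lam m γ (zT γ t) = lT (m : ℝ) γ t := rfl
  have hl1 := one_lt_lT hm0 hγ ho.t_pos (ho.t_lt_one hγ)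
  have hl0 : lT (m : ℝ) γ t ≠ 0 := by linarith
  have hγ0 : γ ≠ 0 := by linarith
  have ha11 := two_div_lt_one hγ
  have ha10 := two_div_add_one_pos hγ
  have hV1 := V₁_eq γ
  rw [hlam]
  set c : ℝ → ℝ := fun a => C (-a) with hc
  have hcan : ∀ a ∈ Ioc 0 (2 / (γ + 1)), AnalyticAt ℝ c a := fun a ha => h.analyticAt_neg ha
  have hcpos : ∀ a ∈ Ioc 0 (2 / (γ + 1)), 0 < c a := fun a ha => h.pos _ (neg_mem ha)
  obtain ⟨Q, b, hb1, hb2, hQ, hGQ⟩ := ho.exists_ratio hmR hγ hγ3 fun a ha => (hcan a ha).pow 2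
  set a₁ := 2 / (γ + 1) with ha₁
  have ham : a₁ ∈ Ioo 0 b := ⟨ha10, hb1⟩
  have hsub : ∀ a ∈ Ioc 0 a₁, a ∈ Ioo 0 b := fun a ha => ⟨ha.1, ha.2.trans_lt hb1⟩
  -- L(a) = log(-x), normalised to 0 at the shock x = -1.
  obtain ⟨L, hL1, hL⟩ := exists_antideriv (q := fun a => lT (m : ℝ) γ t * Q a)
    (fun a ha => analyticAt_const.mul (hQ a ha).1) ham 0
  -- W = log R, integrated from the mass equation; its value at the shock is the logarithm of the
  -- compression ratio 1/(1+V₁).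
  obtain ⟨W, hW1, hW⟩ := exists_antideriv (q := fun a => (1 - (m + 1) * (a * Q a)) / (1 - a))
    (fun a ha => (analyticAt_const.sub (analyticAt_const.mul (analyticAt_id.mul (hQ a ha).1))).div
      (analyticAt_const.sub analyticAt_id) (by
        have : 0 < 1 - a := by linarith [ha.2]
        exact this.ne')) ham (Real.log (1 / (1 + V₁ γ)))
  obtain ⟨⟨l₁, hl₁⟩, ⟨l₂, hl₂⟩, ⟨l₃, hl₃⟩⟩ := ho.exists_limits hmR hγ hγ3 hGQ
    (fun a ha => (hL a (hsub a ha)).2) (fun a ha => (hW a (hsub a ha)).2)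
  have hnear : ∀ᶠ a in 𝓝[>] (0 : ℝ), a ∈ Ioc 0 a₁ := Ioc_mem_nhdsGT ha10
  have hclog : Tendsto (fun a => Real.log (c a)) (𝓝[>] 0) atBot := by
    refine Real.tendsto_log_nhdsGT_zero.comp (tendsto_nhdsWithin_iff.2 ⟨h.tendsto_neg, ?_⟩)
    filter_upwards [hnear] with a ha using hcpos a ha
  have hl₂' : Tendsto (fun a => Real.log (c a) - L a) (𝓝[>] 0) (𝓝 l₂) := by
    refine hl₂.congr' ?_
    filter_upwards with a
    rw [Real.log_pow]; push_cast; ring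
  -- log C → -∞ while log C - L converges, so x → 0 corresponds to a → 0.
  have hbot : Tendsto L (𝓝[>] 0) atBot := by
    have := hclog.atBot_add hl₂'.neg
    refine this.congr fun a => ?_
    ring
  obtain ⟨A, hA1, hA0, hA⟩ := exists_analytic_inverse ham hL
    (fun a ha => mul_pos (by linarith) (hQ a ha).2) hbot
  rw [hL1] at hA1 hA
  have hlog : ∀ x ∈ Ico (-1 : ℝ) 0, Real.log (-x) ≤ 0 := fun x hx =>
    Real.log_nonpos (by linarith [hx.2]) (by linarith [hx.1])
  have hAx : ∀ x ∈ Ico (-1 : ℝ) 0, A (Real.log (-x)) ∈ Ioc 0 a₁ := fun x hx =>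
    (hA _ (hlog x hx)).1
  have hAan : ∀ x ∈ Ico (-1 : ℝ) 0, AnalyticAt ℝ (fun x => A (Real.log (-x))) x := by
    intro x hx
    have h1 : AnalyticAt ℝ (fun x : ℝ => Real.log (-x)) x :=
      (analyticAt_id.neg).log (neg_pos.2 hx.2)
    exact (hA _ (hlog x hx)).2.2.2.1.comp_of_eq h1 rfl
  have hCan : ∀ x ∈ Ico (-1 : ℝ) 0, AnalyticAt ℝ (fun x => c (A (Real.log (-x)))) x :=
    fun x hx => (hcan _ (hAx x hx)).comp_of_eq (hAan x hx) rfl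
  have hRan : ∀ x ∈ Ico (-1 : ℝ) 0, AnalyticAt ℝ (fun x => Real.exp (W (A (Real.log (-x))))) x :=
    fun x hx => ((hW _ (hsub _ (hAx x hx))).1.comp_of_eq (hAan x hx) rfl).rexp'
  have hAd : ∀ x ∈ Ico (-1 : ℝ) 0, HasDerivAt (fun x => A (Real.log (-x)))
      ((lT (m : ℝ) γ t * Q (A (Real.log (-x))))⁻¹ * x⁻¹) x := by
    intro x hx
    have h1 : HasDerivAt (fun x : ℝ => Real.log (-x)) x⁻¹ x := by
      refine ((hasDerivAt_neg x).log (neg_pos.2 hx.2).ne').congr_deriv ?_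
      rw [neg_div_neg_eq, one_div]
    exact HasDerivAt.comp x (hA _ (hlog x hx)).2.2.2.2 h1
  have hcd : ∀ a ∈ Ioc 0 a₁, HasDerivAt c
      (c a / (1 - a) * ((γ - 1) / 2 + (lT (m : ℝ) γ t - BT (m : ℝ) γ * a) * Q a)) a := by
    intro a ha
    have h1 := (hcan a ha).differentiableAt.hasDerivAt
    refine h1.congr_deriv ?_
    have h2 := (h1.fun_pow 2).unique (hGQ a ha).2
    have hca := (hcpos a ha).ne'
    have h1a : 1 - a ≠ 0 := by linarith [ha.2]
    have h3 : 2 * c a * deriv c a = 2 * c a * (c a / (1 - a) *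
        ((γ - 1) / 2 + (lT (m : ℝ) γ t - BT (m : ℝ) γ * a) * Q a)) := by
      simp only [Nat.cast_ofNat, Nat.add_one_sub_one, pow_one] at h2
      rw [h2]; change 2 * c a ^ 2 / (1 - a) * _ = _; ring
    exact mul_left_cancel₀ (mul_ne_zero two_ne_zero hca) h3
  have hpull : Tendsto (fun x : ℝ => A (Real.log (-x))) (𝓝[<] 0) (𝓝[>] 0) := by
    refine hA0.comp (Real.tendsto_log_nhdsGT_zero.comp ?_)
    simpa using tendsto_neg_nhdsLT (a := (0 : ℝ))
  have hev : ∀ x, -1 < x → ∀ {f : ℝ → ℝ} {d : ℝ}, (fun x => if x < -1 then d else f x) =ᶠ[𝓝 x] f :=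
    fun x hx {f d} => by
      filter_upwards [lt_mem_nhds hx] with y hy using if_neg (not_lt.2 (le_of_lt hy))
  have hon : ∀ {f : ℝ → ℝ} {d : ℝ}, EqOn (fun x => if x < -1 then d else f x) f (Ico (-1) 0) :=
    fun {f d} x hx => if_neg (not_lt.2 hx.1)
  have hevl : ∀ {f : ℝ → ℝ} {d : ℝ}, (fun x => if x < -1 then d else f x) =ᶠ[𝓝[<] 0] f :=
    fun {f d} => by
      filter_upwards [Ico_mem_nhdsLT (by norm_num : (-1 : ℝ) < 0)] with x hx using hon hx
  refine ⟨fun x => if x < -1 then 0 else -A (Real.log (-x)),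
    fun x => if x < -1 then 0 else c (A (Real.log (-x))),
    fun x => if x < -1 then 1 else Real.exp (W (A (Real.log (-x)))), ?_, ?_, ?_⟩
  · refine ⟨hl1, ?_, ?_, ?_, ?_, ?_, ?_, ?_, ?_⟩
    · intro x hx
      simp only [if_pos hx, and_self]
    · refine ⟨ContinuousOn.congr ?_ hon, ContinuousOn.congr ?_ hon, ContinuousOn.congr ?_ hon⟩
      · exact fun x hx => (hAan x hx).continuousAt.neg.continuousWithinAt
      · exact fun x hx => (hCan x hx).continuousAt.continuousWithinAt
      · exact fun x hx => (hRan x hx).continuousAt.continuousWithinAt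
    · refine ⟨fun x hx => ?_, fun x hx => ?_, fun x hx => ?_⟩
      · exact (hAan x ⟨hx.1.le, hx.2⟩).neg.congr (hev x hx.1).symm
      · exact (hCan x ⟨hx.1.le, hx.2⟩).congr (hev x hx.1).symm
      · exact (hRan x ⟨hx.1.le, hx.2⟩).congr (hev x hx.1).symm
    · intro x hx
      simp only [if_neg (not_lt.2 hx.1)]
      exact ⟨hcpos _ (hAx x hx), Real.exp_pos _⟩
    · intro s r hs hr hne
      have hx0 : s / r ^ lT (m : ℝ) γ t < 0 := div_neg_of_neg_of_pos hs (Real.rpow_pos_of_pos hr _)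
      have hx1 : s / r ^ lT (m : ℝ) γ t ≠ -1 := fun h' => hne (eq_shockRadius hl0 hr h')
      rcases lt_or_gt_of_ne hx1 with hx | hx
      · have hconst : ∀ {f : ℝ → ℝ} {d : ℝ}, HasDerivAt (fun x => if x < -1 then d else f x) 0
            (s / r ^ lT (m : ℝ) γ t) := fun {f d} => by
          refine (hasDerivAt_const _ d).congr_of_eventuallyEq ?_
          filter_upwards [gt_mem_nhds hx] with y hy using if_pos hy
        refine eulerAt_of_profile hs.ne hr hl0 hγ0 hconst hconst hconst ?_ ?_ ?_ ?_ <;> simp [hx]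
      · have hxm : s / r ^ lT (m : ℝ) γ t ∈ Ico (-1 : ℝ) 0 := ⟨hx.le, hx0⟩
        have ha := hAx _ hxm
        have hd := hAd _ hxm
        have hq := (hQ _ (hsub _ ha)).2.ne'
        have hG := (hGQ _ ha).1
        have h1a : 1 - A (Real.log (-(s / r ^ lT (m : ℝ) γ t))) ≠ 0 := by linarith [ha.2]
        have hVd := hd.fun_neg.congr_of_eventuallyEq (hev _ hx (d := 0))
        have hCd := (HasDerivAt.comp_of_eq _ (hcd _ ha) hd rfl).congr_of_eventuallyEq
          (hev _ hx (f := fun x => c (A (Real.log (-x)))) (d := 0))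
        have hRd := (HasDerivAt.comp_of_eq _ (hW _ (hsub _ ha)).2 hd rfl).exp.congr_of_eventuallyEq
          (hev _ hx (f := fun x => Real.exp (W (A (Real.log (-x))))) (d := 1))
        have hxne := hx0.ne
        refine eulerAt_of_profile hs.ne hr hl0 hγ0 hVd hCd hRd ?_ ?_ ?_ ?_
        all_goals
          simp only [if_neg (not_lt.2 hxm.1), Function.comp]
          generalize A (Real.log (-(s / r ^ lT (m : ℝ) γ t))) = a at *
          generalize s / r ^ lT (m : ℝ) γ t = x at *
        · exact (Real.exp_pos _).ne'
        · generalize Real.exp (W a) = R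
          generalize lT (m : ℝ) γ t = l at *
          field_simp
          ring
        · have hR := (Real.exp_pos (W a)).ne'
          have key := profile_momentum (c := c a) hγ0 hl0 h1a hq hG
          generalize Real.exp (W a) = R at *
          refine Eq.trans ?_ key
          generalize lT (m : ℝ) γ t = l at *
          field_simp
        · rw [BT]
          generalize lT (m : ℝ) γ t = l at *
          field_simp
          ring
    · intro s hs
      have hx := div_shockRadius_rpow hl0 hs
      have hr : 0 < shockRadius (lT (m : ℝ) γ t) s := Real.rpow_pos_of_pos (neg_pos.2 hs) _
      have hS : 0 < -(shockRadius (lT (m : ℝ) γ t) s / (lT (m : ℝ) γ t * s)) :=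
        neg_pos.2 (div_neg_of_pos_of_neg hr (mul_neg_of_pos_of_neg (by linarith) hs))
      have key := shockConditions_start hγ hS
      rw [neg_neg, ← deriv_shockRadius hs] at key
      have hu : 0 < 1 + V₁ γ := by rw [hV1]; linarith
      simp only [densityField, scaledField]
      rw [hx]
      simp only [lt_irrefl, if_false, neg_neg, Real.log_one, hA1, hW1]
      rw [Real.exp_log (by positivity), ← hV1, hc]
      simp only
      rw [← hV1, h.start, ← deriv_shockRadius hs]
      exact key
    · refine ⟨Tendsto.congr' hevl.symm ?_, Tendsto.congr' hevl.symm ?_⟩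
      · have := (tendsto_nhdsWithin_iff.1 hpull).1.neg
        rwa [neg_zero] at this
      · exact h.tendsto_neg.comp hpull
    -- Thus V/x = exp(log a - L) and C/x = -exp(log C - L).
    · have hval : ∀ x ∈ Ico (-1 : ℝ) 0, x = -Real.exp (L (A (Real.log (-x)))) := fun x hx => by
        rw [(hA _ (hlog x hx)).2.1, Real.exp_log (neg_pos.2 hx.2), neg_neg]
      have hI := Ico_mem_nhdsLT (by norm_num : (-1 : ℝ) < 0)
      refine ⟨Real.exp l₁, -Real.exp l₂, Real.exp l₃, ?_, ?_, ?_⟩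
      · refine Tendsto.congr' ?_ ((Real.continuous_exp.tendsto l₁).comp (hl₁.comp hpull))
        filter_upwards [hI] with x hx
        simp only [if_neg (not_lt.2 hx.1), Function.comp]
        have hx' := hval x hx
        have ha := hAx x hx
        generalize A (Real.log (-x)) = a at *
        rw [hx', Real.exp_sub, Real.exp_log ha.1, neg_div_neg_eq]
      · refine Tendsto.congr' ?_ ((Real.continuous_exp.tendsto l₂).comp (hl₂'.comp hpull)).neg
        filter_upwards [hI] with x hx
        simp only [if_neg (not_lt.2 hx.1), Function.comp]
        have hx' := hval x hx
        have ha := hcpos _ (hAx x hx)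
        generalize A (Real.log (-x)) = a at *
        rw [hx', Real.exp_sub, Real.exp_log ha, div_neg]
      · refine Tendsto.congr' hevl.symm ((Real.continuous_exp.tendsto l₃).comp (hl₃.comp hpull))
  · simp only [lt_irrefl, if_false, neg_neg, Real.log_one, hA1]
    exact hV1.symm
  · intro x hx
    simp only [if_neg (not_lt.2 hx.1)]
    have := hAx x hx
    rw [hV1]
    exact ⟨⟨neg_le_neg this.2, neg_lt_zero.2 this.1⟩, rfl⟩

end ShockODE

/-! ### The main theorem -/

open ShockODE in
theorem mainTheorem1 (m : ℕ) (hm : m = 1 ∨ m = 2) :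
    ∃ γs : ℝ, (∀ g : ℝ, IsGammaStar g ↔ g = γs) ∧ 5 / 3 < γs ∧ γs < 2 ∧
      -- (i) existence; every solution passes through a triple point and yields a converging shock
      (∀ γ : ℝ, 1 < γ → γ ≤ 3 →
        (∃ (z : ℝ) (C : ℝ → ℝ), IsConnection m γ z C) ∧
        (∀ (z : ℝ) (C : ℝ → ℝ), IsConnection m γ z C →
          z ≤ zM γ ∧ (PassesThrough γ C (P₆ γ z) ∨ PassesThrough γ C (P₈ γ z)) ∧
          ∃ Vx Cx Rx : ℝ → ℝ, IsConvergingShock m γ (lam m γ z) Vx Cx Rx ∧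
            Vx (-1) = V₁ γ ∧
            ∀ x ∈ Set.Ico (-1 : ℝ) 0, Vx x ∈ Set.Ico (V₁ γ) 0 ∧ Cx x = C (Vx x))) ∧
      -- (ii)
      (∀ γ : ℝ, 1 < γ → γ ≤ γs →
        (∃! z : ℝ, ∃ C : ℝ → ℝ, IsConnection m γ z C) ∧
        (∀ (z : ℝ) (C : ℝ → ℝ), IsConnection m γ z C →
          PassesThrough γ C (P₆ γ z) ∧ z ∈ Set.Ioc (zg m γ) (zM γ))) ∧
      -- (iii)
      (∀ γ : ℝ, γs < γ → γ < 2 →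
        (∀ (z : ℝ) (C : ℝ → ℝ), IsConnection m γ z C → PassesThrough γ C (P₆ γ z) →
          z ∈ Set.Ioc (zg m γ) (zM γ) ∧
          ∀ (z' : ℝ) (C' : ℝ → ℝ), IsConnection m γ z' C' → PassesThrough γ C' (P₆ γ z') →
            z' = z) ∧
        (∀ (z : ℝ) (C : ℝ → ℝ), IsConnection m γ z C → PassesThrough γ C (P₈ γ z) →
          z ∈ Set.Ioc (z₁ γ) (zM γ))) ∧
      -- (iv)
      (∀ γ : ℝ, 2 ≤ γ → γ ≤ 3 →
        ∀ (z : ℝ) (C : ℝ → ℝ), IsConnection m γ z C →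
          PassesThrough γ C (P₈ γ z) ∧
          (γ ≤ 1 + √2 → z ∈ Set.Ioc (z₁ γ) (zM γ)) ∧
          (1 + √2 < γ → z ∈ Set.Ioc (z₂ γ) (zM γ))) := by
  have hmR : (m : ℝ) = 1 ∨ (m : ℝ) = 2 := by rcases hm with rfl | rfl <;> norm_num
  obtain ⟨γs, hγs, h53, hs2, hs0⟩ := exists_gammaStar
  have hmem : ∀ {γ t : ℝ} {Y : ℝ → ℝ}, SonicOrbit m γ t Y → t ∈ Set.Ioc 0 (2 / (γ + 1)) :=
    fun ho => ⟨ho.t_pos, ho.t_lt.le⟩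
  -- The inequality is γ² - 2γ - 1 ≤ 0, with larger root 1 + √2.
  have hone : ∀ {γ : ℝ}, 1 < γ → γ ≤ 1 + √2 → γ * (γ - 1) / (γ + 1) ≤ 1 := fun {γ} h1 h2 => by
    have h3 : √2 ^ 2 = (2 : ℝ) := Real.sq_sqrt (by norm_num)
    rw [div_le_one (by linarith)]
    nlinarith [Real.sqrt_nonneg 2]
  refine ⟨γs, hγs, h53, hs2, ?_, ?_, ?_, ?_⟩
  · intro γ hγ hγ3
    refine ⟨exists_isConnection hm hγ hγ3, fun z C h => ?_⟩
    have hshock := h.exists_shock hm hγ hγ3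
    obtain ⟨t, rfl, hC, ho⟩ := h.exists_orbit hm hγ hγ3
    refine ⟨zT_le_zM hγ ho.t_pos (ho.t_lt_one hγ), ?_, hshock⟩
    rw [h.passesThrough_six_iff hγ (hmem ho) hC, h.passesThrough_eight_iff hγ (hmem ho) hC]
    exact le_total _ _
  · intro γ hγ hγle
    have hγ2 : γ < 2 := hγle.trans_lt hs2
    have hγ3 : γ ≤ 3 := by linarith
    have hstar : starFun γ ≤ 0 := by
      rw [← hs0]
      exact starFun_strictMonoOn.monotoneOn (show (1 : ℝ) ≤ γ from hγ.le)
        (show (1 : ℝ) ≤ γs by linarith) hγle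
    have hsteep : ∀ {t : ℝ} {Y : ℝ → ℝ}, SonicOrbit m γ t Y → 2 * (1 - t) ^ 2 ≤ γ * t ^ 2 :=
      fun ho => (steep_of_kT_lt hγ ho.t_pos (ho.t_lt_one hγ) hstar (ho.kT_lt hmR hγ hγ3)).le
    refine ⟨?_, fun z C h => ?_⟩
    · obtain ⟨z, C, h⟩ := exists_isConnection hm hγ hγ3
      refine ⟨z, ⟨C, h⟩, fun z' ⟨C', h'⟩ => ?_⟩
      obtain ⟨t, rfl, -, ho⟩ := h.exists_orbit hm hγ hγ3
      obtain ⟨t', rfl, -, ho'⟩ := h'.exists_orbit hm hγ hγ3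
      rw [ho.eq_of_steep ho' hmR hγ hγ2 (hsteep ho) (hsteep ho')]
    · obtain ⟨t, rfl, hC, ho⟩ := h.exists_orbit hm hγ hγ3
      have ht1 := ho.t_lt_one hγ
      exact ⟨(h.passesThrough_six_iff hγ (hmem ho) hC).2 (hsteep ho),
        zg_lt hm hγ ho.t_pos ht1 (hsteep ho) (ho.theta_pos hmR hγ hγ3),
        zT_le_zM hγ ho.t_pos ht1⟩
  · intro γ hsγ hγ2
    have hγ : 1 < γ := by linarith
    have hγ3 : γ ≤ 3 := by linarith
    refine ⟨fun z C h hP => ?_, fun z C h hP => ?_⟩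
    · obtain ⟨t, rfl, hC, ho⟩ := h.exists_orbit hm hγ hγ3
      have ht1 := ho.t_lt_one hγ
      rw [h.passesThrough_six_iff hγ (hmem ho) hC] at hP
      refine ⟨⟨zg_lt hm hγ ho.t_pos ht1 hP (ho.theta_pos hmR hγ hγ3), zT_le_zM hγ ho.t_pos ht1⟩,
        fun z' C' h' hP' => ?_⟩
      obtain ⟨t', rfl, hC', ho'⟩ := h'.exists_orbit hm hγ hγ3
      rw [h'.passesThrough_six_iff hγ (hmem ho') hC'] at hP'
      rw [ho'.eq_of_steep ho hmR hγ hγ2 hP' hP]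
    · obtain ⟨t, rfl, hC, ho⟩ := h.exists_orbit hm hγ hγ3
      have ht1 := ho.t_lt_one hγ
      rw [h.passesThrough_eight_iff hγ (hmem ho) hC] at hP
      have h2 : 1 ≤ √2 := Real.one_le_sqrt.2 (by norm_num)
      exact ⟨z₁_lt hγ ho.t_pos ht1 hP ((ho.kT_lt hmR hγ hγ3).trans_le (hone hγ (by linarith))),
        zT_le_zM hγ ho.t_pos ht1⟩
  · intro γ hγ2 hγ3 z C h
    have hγ : 1 < γ := by linarith
    obtain ⟨t, rfl, hC, ho⟩ := h.exists_orbit hm hγ hγ3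
    have ht1 := ho.t_lt_one hγ
    have hP := ho.gamma_mul_sq_le hmR hγ2 hγ3
    have hk := ho.kT_lt hmR hγ hγ3
    refine ⟨(h.passesThrough_eight_iff hγ (hmem ho) hC).2 hP, fun hle => ?_, fun _ => ?_⟩
    · exact ⟨z₁_lt hγ ho.t_pos ht1 hP (hk.trans_le (hone hγ hle)), zT_le_zM hγ ho.t_pos ht1⟩
    · refine ⟨z₂_lt hγ ho.t_pos ht1 hP (hk.trans_le ?_), zT_le_zM hγ ho.t_pos ht1⟩
      -- γ(γ-1)/(γ+1) ≤ 3/2 amounts to (2γ+1)(γ-3) ≤ 0.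
      rw [div_le_iff₀ (by linarith)]
      nlinarith
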